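/- Let $s > 5/2$ be real and let $S^1 = \mathbb{R}/\mathbb{Z}$ be the circle of length one and $S^1_{4\pi} = \mathbb{R}/4\pi\mathbb{Z}$. Let $$\mathrm{Diff}_0^s(S^1) = \{\mathrm{id} + h \;:\; h \in H^s(S^1;\mathbb{R}),\ h_x > -1,\ h(0) = 0\}$$ be the group of orientation-preserving diffeomorphisms of $S^1$ of Sobolev class $H^s$ that fix $0$, regarded as an open subset of the affine space $\mathrm{id} + H^s_0(S^1;\mathbb{R})$, where $H_0^s(S^1;\mathbb{R}) = \{u \in H^s(S^1;\mathbb{R}) : u(0)=0\}$. Let $H^{s-1}(S^1;S^1_{4\pi})$ be the set of maps $S^1 \to S^1_{4\pi}$ of Sobolev class $H^{s-1}$, a smooth manifold modelled on $H^{s-1}(S^1;\mathbb{R})$ through the charts $\alpha_0 + a \mapsto a$, where $a \in H^{s-1}(S^1;\mathbb{R})$ and $|a| < 2\pi$. Let $G^s = \mathrm{Diff}_0^s(S^1) \times H^{s-1}(S^1;S^1_{4\pi})$, with the product manifold structure and the semidirect product multiplication $(\varphi,\alpha)(\psi,\beta) = (\varphi\circ\psi,\ \beta + \alpha\circ\psi)$.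 Its tangent space at every point is $H_0^s(S^1;\mathbb{R}) \times H^{s-1}(S^1;\mathbb{R})$. Equip $G^s$ with the right-invariant metric given by $$\langle U, V\rangle_{(\varphi,\alpha)} = \big\langle (U_1\circ\varphi^{-1}, U_2\circ\varphi^{-1}), (V_1\circ\varphi^{-1}, V_2\circ\varphi^{-1})\big\rangle_{(\mathrm{id},0)}, \qquad \langle (u,\rho),(v,\tau)\rangle_{(\mathrm{id},0)} = \frac14\int_{S^1} (u_x v_x + \rho\tau)\,dx .$$ Then $(G^s, \langle\cdot,\cdot\rangle)$ has constant sectional curvature equal to $1$. That is, $\langle\cdot,\cdot\rangle$ is a smooth weak Riemannian metric on $G^s$ (symmetric and positive definite on each tangent space); there is a smooth, torsion-free covariant derivative $\nabla$ on $G^s$ compatible with the metric; and for every such $\nabla$, with $R(X,Y)Z = \nabla_X\nabla_Y Z - \nabla_Y\nabla_X Z - \nabla_{[X,Y]}Z$, $$\frac{\langle R(X,Y)Y, X\rangle}{\langle X,X\rangle\langle Y,Y\rangle - \langle X,Y\rangle^2} = 1$$ at every point of $G^s$ and for all vector fields $X, Y$ that are smooth near the point and linearly independent at it. -/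

import Mathlib

open scoped Manifold ContDiff

noncomputable section

/-! ## Weak Riemannian metrics, Levi-Civita connections and sectional curvature -/

namespace WeakRiemannian

open Bundle

variable {E : Type*} [NormedAddCommGroup E] [NormedSpace ℝ E]
  {H : Type*} [TopologicalSpace H] (I : ModelWithCorners ℝ E H)
  {M : Type*} [TopologicalSpace M] [ChartedSpace H M]

/-- A vector field `X` is smooth at `x`. -/
def SmoothFieldAt [IsManifold I 1 M] (X : ∀ x : M, TangentSpace I x) (x : M) : Prop :=
  ContMDiffAt I I.tangent ∞ (fun y => (⟨y, X y⟩ : TangentBundle I M)) x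

/-- A vector field `X` is differentiable at `x`. -/
def DiffFieldAt [IsManifold I 1 M] (X : ∀ x : M, TangentSpace I x) (x : M) : Prop :=
  MDifferentiableAt I I.tangent (fun y => (⟨y, X y⟩ : TangentBundle I M)) x

/-- `g` is a (smooth) weak Riemannian metric: a smooth section of the bundle of continuous
bilinear forms on the tangent spaces which is symmetric and positive definite.  The norm of `g x`
need not induce the topology of the tangent space at `x`. -/
structure IsWeakRiemannianMetric [IsManifold I 1 M]
    (g : ∀ x : M, TangentSpace I x → TangentSpace I x → ℝ) : Prop where
  symm : ∀ (x : M) (u v : TangentSpace I x), g x u v = g x v u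
  pos : ∀ (x : M) (u : TangentSpace I x), u ≠ 0 → 0 < g x u u
  smooth : ∃ B : ∀ x : M, TangentSpace I x →L[ℝ] TangentSpace I x →L[ℝ] ℝ,
    (∀ (x : M) (u v : TangentSpace I x), B x u v = g x u v) ∧
    ContMDiff I (I.prod 𝓘(ℝ, E →L[ℝ] E →L[ℝ] ℝ)) ∞
      (fun x => TotalSpace.mk' (E →L[ℝ] E →L[ℝ] ℝ)
        (E := fun x : M => TangentSpace I x →L[ℝ] TangentSpace I x →L[ℝ] ℝ) x (B x))

variable {I}

/-- The covariant derivative `cov` (where `cov Y x v` is `∇_v Y` at `x`) is a Levi-Civita connection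
of `g`: it is smooth, torsion free and compatible with `g`. -/
structure IsLeviCivita [IsManifold I 1 M]
    (g : ∀ x : M, TangentSpace I x → TangentSpace I x → ℝ)
    (cov : CovariantDerivative I E (TangentSpace I : M → Type _)) : Prop where
  smooth : cov.ContMDiffCovariantDerivative ∞
  torsion_free : ∀ (X Y : ∀ x : M, TangentSpace I x) (x : M),
    DiffFieldAt I X x → DiffFieldAt I Y x →
      cov Y x (X x) - cov X x (Y x) = VectorField.mlieBracket I X Y x
  compatible : ∀ (Y Z : ∀ x : M, TangentSpace I x) (x : M) (v : TangentSpace I x),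
    DiffFieldAt I Y x → DiffFieldAt I Z x →
      mvfderiv I (fun y => g y (Y y) (Z y)) x v = g x (cov Y x v) (Z x) + g x (Y x) (cov Z x v)

/-- The curvature `R(X, Y) Z = ∇_X ∇_Y Z - ∇_Y ∇_X Z - ∇_[X, Y] Z` of a covariant derivative. -/
def curvature [IsManifold I 1 M] (cov : CovariantDerivative I E (TangentSpace I : M → Type _))
    (X Y Z : ∀ x : M, TangentSpace I x) (x : M) : TangentSpace I x :=
  cov (fun y => cov Z y (Y y)) x (X x) - cov (fun y => cov Z y (X y)) x (Y x)
    - cov Z x (VectorField.mlieBracket I X Y x)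

/-- The sectional curvature at `x` of the plane spanned by `X x` and `Y x`, i.e.
`g(R(X, Y) Y, X) / (g(X, X) g(Y, Y) - g(X, Y) ^ 2)`. -/
def sectionalCurvature [IsManifold I 1 M] (g : ∀ x : M, TangentSpace I x → TangentSpace I x → ℝ)
    (cov : CovariantDerivative I E (TangentSpace I : M → Type _))
    (X Y : ∀ x : M, TangentSpace I x) (x : M) : ℝ :=
  g x (curvature cov X Y Y x) (X x) /
    (g x (X x) (X x) * g x (Y x) (Y x) - g x (X x) (Y x) ^ 2)

variable (I) in
/-- `g` is a smooth weak Riemannian metric which has a Levi-Civita connection, and its sectional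
curvature equals `c` on every tangent plane (computed with arbitrary fields, smooth near the point,
whose values span the plane). -/
structure HasConstantSectionalCurvature [IsManifold I 1 M]
    (g : ∀ x : M, TangentSpace I x → TangentSpace I x → ℝ) (c : ℝ) : Prop where
  isWeakRiemannianMetric : IsWeakRiemannianMetric I g
  exists_leviCivita : ∃ cov : CovariantDerivative I E (TangentSpace I : M → Type _),
    IsLeviCivita g cov
  sectionalCurvature_eq : ∀ cov : CovariantDerivative I E (TangentSpace I : M → Type _),
    IsLeviCivita g cov → ∀ (x : M) (X Y : ∀ x : M, TangentSpace I x),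
      SmoothFieldAt I X x → SmoothFieldAt I Y x → LinearIndependent ℝ ![X x, Y x] →
        sectionalCurvature g cov X Y x = c

end WeakRiemannian

/-! ## Sobolev spaces on the circle of length one -/

namespace TwoHS

open AddCircle

/-- The circle `S¹` of length one. -/
abbrev S1 : Type := AddCircle (1 : ℝ)

/-- The circle `S¹_{4π}` of length `4π`. -/
abbrev S4pi : Type := AddCircle (4 * Real.pi)

/-- The Fourier coefficient of index `n` of `f`, multiplied by the weight `(1 + n²)^(r/2)`. -/
def weightedCoeff (r : ℝ) (f : C(S1, ℝ)) (n : ℤ) : ℂ :=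
  (((1 + (n : ℝ) ^ 2) ^ (r / 2) : ℝ) : ℂ) * fourierCoeff (fun x : S1 => ((f x : ℝ) : ℂ)) n

lemma integrable_ofReal (f : C(S1, ℝ)) :
    MeasureTheory.Integrable (fun x : S1 => ((f x : ℝ) : ℂ)) haarAddCircle :=
  (by fun_prop : Continuous fun x : S1 => ((f x : ℝ) : ℂ)).integrable_of_hasCompactSupport
    (HasCompactSupport.of_compactSpace _)

lemma weightedCoeff_add (r : ℝ) (f g : C(S1, ℝ)) :
    weightedCoeff r (f + g) = weightedCoeff r f + weightedCoeff r g := by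
  funext n
  have h := fourierCoeff.add (integrable_ofReal f) (integrable_ofReal g)
  have h2 : (fun x : S1 => (((f + g) x : ℝ) : ℂ)) =
      (fun x : S1 => ((f x : ℝ) : ℂ)) + fun x : S1 => ((g x : ℝ) : ℂ) := by
    funext x; simp
  simp only [weightedCoeff, Pi.add_apply, h2, h, mul_add]

lemma weightedCoeff_smul (r c : ℝ) (f : C(S1, ℝ)) :
    weightedCoeff r (c • f) = c • weightedCoeff r f := by
  funext n
  have h2 : (fun x : S1 => (((c • f) x : ℝ) : ℂ)) =
      fun x : S1 => (c : ℂ) * ((f x : ℝ) : ℂ) := by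
    funext x; simp
  simp only [weightedCoeff, Pi.smul_apply, h2, fourierCoeff.const_mul, Complex.real_smul]
  ring

/-- The continuous real functions `f` on `S¹` with `∑ (1 + n²)^r |f̂(n)|² < ∞`. -/
def sobolevSubmodule (r : ℝ) : Submodule ℝ C(S1, ℝ) where
  carrier := {f | Memℓp (weightedCoeff r f) 2}
  add_mem' {f g} hf hg := by
    simp only [Set.mem_ofPred_eq, weightedCoeff_add] at *
    exact hf.add hg
  zero_mem' := by
    have h : weightedCoeff r 0 = 0 := by simpa using weightedCoeff_smul r 0 0
    simp only [Set.mem_ofPred_eq, h]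
    exact zero_memℓp
  smul_mem' c f hf := by
    simp only [Set.mem_ofPred_eq, weightedCoeff_smul] at *
    exact hf.const_smul c

/-- The Sobolev space `H^r(S¹; ℝ)` of real order `r > 1/2`: the classes of functions with
`∑ (1 + n²)^r |f̂(n)|² < ∞`, each represented by its unique continuous representative. -/
def Sob (r : ℝ) : Type := sobolevSubmodule r

namespace Sob

variable {r : ℝ}

instance : AddCommGroup (Sob r) := inferInstanceAs (AddCommGroup (sobolevSubmodule r))

instance : Module ℝ (Sob r) := inferInstanceAs (Module ℝ (sobolevSubmodule r))

/-- The underlying continuous function. -/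
def toC : Sob r →ₗ[ℝ] C(S1, ℝ) := (sobolevSubmodule r).subtype

instance : CoeFun (Sob r) (fun _ => S1 → ℝ) := ⟨fun u => toC u⟩

lemma toC_injective : Function.Injective (toC : Sob r → C(S1, ℝ)) :=
  (sobolevSubmodule r).injective_subtype

/-- The weighted Fourier coefficients as a square summable sequence. -/
def toEll : Sob r →ₗ[ℝ] lp (fun _ : ℤ => ℂ) 2 where
  toFun u := ⟨weightedCoeff r (toC u), u.2⟩
  map_add' u v := by ext1; exact weightedCoeff_add r _ _
  map_smul' c u := by ext1; exact weightedCoeff_smul r c _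

end Sob

lemma fourierCoeff_eq_zero_imp (f : C(S1, ℝ))
    (h : ∀ n, fourierCoeff (fun x : S1 => ((f x : ℝ) : ℂ)) n = 0) : f = 0 := by
  set F : C(S1, ℂ) := ⟨fun x => ((f x : ℝ) : ℂ), by fun_prop⟩ with hF
  have h0 : ∀ n, fourierCoeff (F : S1 → ℂ) n = 0 := h
  have hs : Summable (fourierCoeff (F : S1 → ℂ)) := by
    have : fourierCoeff (F : S1 → ℂ) = 0 := funext h0
    rw [this]; exact summable_zero
  ext x
  have := has_pointwise_sum_fourier_series_of_summable hs x
  simp only [h0, zero_smul] at this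
  have h1 := this.unique hasSum_zero
  simpa [hF] using h1

lemma weight_pos (r : ℝ) (n : ℤ) : 0 < (1 + (n : ℝ) ^ 2) ^ (r / 2) := by positivity

lemma Sob.toEll_injective {r : ℝ} :
    Function.Injective (Sob.toEll : Sob r →ₗ[ℝ] lp (fun _ : ℤ => ℂ) 2) := by
  rw [injective_iff_map_eq_zero]
  intro u hu
  apply Sob.toC_injective
  rw [map_zero]
  apply fourierCoeff_eq_zero_imp
  intro n
  have h : weightedCoeff r (Sob.toC u) n = 0 := by
    have := congrArg (fun a : lp (fun _ : ℤ => ℂ) 2 => (a : ℤ → ℂ) n) hu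
    simpa [Sob.toEll] using this
  unfold weightedCoeff at h
  rcases mul_eq_zero.mp h with h | h
  · exact absurd (by exact_mod_cast h) (weight_pos r n).ne'
  · exact h

/-- The Sobolev norm `‖u‖² = ∑ (1 + n²)^r |û(n)|²`. -/
instance (r : ℝ) : NormedAddCommGroup (Sob r) :=
  NormedAddCommGroup.induced (Sob r) (lp (fun _ : ℤ => ℂ) 2) Sob.toEll Sob.toEll_injective

instance (r : ℝ) : NormedSpace ℝ (Sob r) :=
  NormedSpace.induced ℝ (Sob r) (lp (fun _ : ℤ => ℂ) 2) Sob.toEll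

/-! ### The Sobolev embedding -/

lemma summable_weight {q : ℝ} (hq : 1 < q) :
    Summable fun n : ℤ => (1 + (n : ℝ) ^ 2) ^ (-(q / 2)) := by
  refine Summable.of_norm_bounded_eventually (g := fun n : ℤ => |(n : ℝ)| ^ (-q))
    (Real.summable_abs_int_rpow hq) ?_
  have : ∀ᶠ n : ℤ in Filter.cofinite, n ≠ 0 :=
    (Set.finite_singleton (0 : ℤ)).compl_mem_cofinite
  filter_upwards [this] with n hn
  have hn' : 0 < |(n : ℝ)| := by positivity
  rw [Real.norm_of_nonneg (by positivity)]
  have h1 : |(n : ℝ)| ^ (-q) = ((n : ℝ) ^ 2) ^ (-(q / 2)) := by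
    rw [← sq_abs, ← Real.rpow_natCast, ← Real.rpow_mul hn'.le]
    congr 1; push_cast; ring
  rw [h1]
  exact Real.rpow_le_rpow_of_nonpos (by positivity) (by linarith) (by linarith)

/-- The absolutely convergent sums that control a function of class `H^r` and its derivatives up to
order `j < r - 1/2`. -/
lemma exists_bound {r : ℝ} (j : ℕ) (hr : (j : ℝ) + 1 / 2 < r) : ∃ C : ℝ, ∀ u : Sob r,
    Summable (fun n : ℤ =>
      |(n : ℝ)| ^ j * ‖fourierCoeff (fun x : S1 => ((u x : ℝ) : ℂ)) n‖) ∧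
    ∑' n : ℤ, |(n : ℝ)| ^ j * ‖fourierCoeff (fun x : S1 => ((u x : ℝ) : ℂ)) n‖ ≤ C * ‖u‖ := by
  set a : ℤ → ℝ := fun n => (1 + (n : ℝ) ^ 2) ^ (((j : ℝ) - r) / 2) with ha
  have ha2 : Summable fun n => a n ^ (2 : ℝ) := by
    have := summable_weight (q := 2 * (r - j)) (by linarith)
    refine this.congr fun n => ?_
    rw [ha, ← Real.rpow_mul (by positivity)]
    congr 1; ring
  refine ⟨(∑' n, a n ^ (2 : ℝ)) ^ (1 / (2 : ℝ)), fun u => ?_⟩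
  set c : ℤ → ℝ := fun n => ‖weightedCoeff r (Sob.toC u) n‖ with hc
  have hc2 : Summable fun n => c n ^ (2 : ℝ) := by
    have h : Memℓp (weightedCoeff r (Sob.toC u)) 2 := u.2
    simpa using h.summable (by norm_num)
  have hnorm : ‖u‖ = (∑' n, c n ^ (2 : ℝ)) ^ (1 / (2 : ℝ)) := by
    have : ‖u‖ = ‖Sob.toEll u‖ := rfl
    rw [this, lp.norm_eq_tsum_rpow (by norm_num)]
    simp [hc, Sob.toEll]
  obtain ⟨hs, hle⟩ := Real.summable_and_inner_le_Lp_mul_Lq_tsum_of_nonneg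
    (Real.HolderConjugate.two_two) (f := a) (g := c) (fun n => by positivity)
    (fun n => norm_nonneg _) ha2 hc2
  have hterm : ∀ n : ℤ, |(n : ℝ)| ^ j * ‖fourierCoeff (fun x : S1 => ((u x : ℝ) : ℂ)) n‖
      ≤ a n * c n := by
    intro n
    simp only [ha, hc, weightedCoeff, norm_mul, Complex.norm_real]
    rw [Real.norm_of_nonneg (weight_pos r n).le, ← mul_assoc,
      ← Real.rpow_add (by positivity)]
    gcongr
    have h1 : ((j : ℝ) - r) / 2 + r / 2 = (j : ℝ) * (1 / 2) := by ring
    rw [h1, mul_comm, Real.rpow_mul (by positivity), Real.rpow_natCast]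
    gcongr
    rw [← Real.sqrt_eq_rpow]
    exact Real.abs_le_sqrt (by linarith)
  have hs' := Summable.of_nonneg_of_le (fun n => by positivity) hterm hs
  refine ⟨hs', ?_⟩
  rw [hnorm]
  exact (hs'.tsum_le_tsum hterm hs).trans hle

lemma Sob.hasSum {r : ℝ} (hr : 1 / 2 < r) (u : Sob r) (x : S1) :
    HasSum (fun n : ℤ => fourierCoeff (fun x : S1 => ((u x : ℝ) : ℂ)) n * fourier n x)
      ((u x : ℝ) : ℂ) := by
  obtain ⟨C, hC⟩ := exists_bound (r := r) 0 (by simpa using hr)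
  have hs : Summable (fourierCoeff (fun x : S1 => ((u x : ℝ) : ℂ))) := by
    have := (hC u).1
    simp only [pow_zero, one_mul] at this
    exact this.of_norm
  set F : C(S1, ℂ) := ⟨fun x => ((u x : ℝ) : ℂ), by fun_prop⟩
  have := has_pointwise_sum_fourier_series_of_summable (f := F) hs x
  simp only [smul_eq_mul] at this
  exact this

/-- The Sobolev embedding `H^r ⊂ C⁰` for `r > 1/2`. -/
lemma Sob.exists_sup_bound {r : ℝ} (hr : 1 / 2 < r) : ∃ C : ℝ, ∀ u : Sob r,
    ‖Sob.toC u‖ ≤ C * ‖u‖ := by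
  obtain ⟨C, hC⟩ := exists_bound (r := r) 0 (by simpa using hr)
  refine ⟨C, fun u => ?_⟩
  obtain ⟨h1, h2⟩ := hC u
  simp only [pow_zero, one_mul] at h1 h2
  refine (ContinuousMap.norm_le _ ((tsum_nonneg fun n => norm_nonneg _).trans h2)).2 fun x => ?_
  have h3 := (Sob.hasSum hr u x).tsum_eq
  calc ‖Sob.toC u x‖ = ‖((u x : ℝ) : ℂ)‖ := (Complex.norm_real _).symm
    _ = ‖∑' n : ℤ, fourierCoeff (fun x : S1 => ((u x : ℝ) : ℂ)) n * fourier n x‖ := by rw [h3]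
    _ ≤ ∑' n : ℤ, ‖fourierCoeff (fun x : S1 => ((u x : ℝ) : ℂ)) n * fourier n x‖ := by
      apply norm_tsum_le_tsum_norm
      simpa [Circle.norm_coe] using h1
    _ ≤ C * ‖u‖ := by simpa [Circle.norm_coe] using h2

lemma Sob.continuous_toC {r : ℝ} (hr : 1 / 2 < r) : Continuous (Sob.toC : Sob r → C(S1, ℝ)) := by
  obtain ⟨C, hC⟩ := Sob.exists_sup_bound hr
  exact (LinearMap.mkContinuous Sob.toC C hC).continuous

/-- The Sobolev embedding `H^r ⊂ C¹` for `r > 3/2`. -/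
lemma Sob.exists_hasDerivAt {r : ℝ} (hr : 3 / 2 < r) : ∃ C : ℝ, ∀ u : Sob r,
    ∃ u' : ℝ → ℝ, Continuous u' ∧ Function.Periodic u' 1 ∧ (∀ t, |u' t| ≤ C * ‖u‖) ∧
      ∀ t : ℝ, HasDerivAt (fun y : ℝ => u (y : S1)) (u' t) t := by
  obtain ⟨C, hC⟩ := exists_bound (r := r) 1 (by norm_num; linarith)
  refine ⟨2 * Real.pi * C, fun u => ?_⟩
  obtain ⟨h1, h2⟩ := hC u
  simp only [pow_one] at h1 h2
  set c := fourierCoeff (fun x : S1 => ((u x : ℝ) : ℂ)) with hc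
  set D : ℤ → ℝ → ℂ := fun n t =>
    c n * (2 * Real.pi * Complex.I * n / (1 : ℝ) * fourier n (t : S1)) with hD
  have hDn : ∀ n t, ‖D n t‖ = 2 * Real.pi * (|(n : ℝ)| * ‖c n‖) := by
    intro n t
    simp only [hD, norm_mul, norm_div, Circle.norm_coe, fourier_apply]
    simp [abs_of_pos Real.pi_pos]
    ring
  have hsum : Summable fun n : ℤ => 2 * Real.pi * (|(n : ℝ)| * ‖c n‖) := h1.mul_left _
  have hder : ∀ t : ℝ, HasDerivAt (fun y : ℝ => ((u (y : S1) : ℝ) : ℂ)) (∑' n, D n t) t := by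
    intro t
    have := hasDerivAt_tsum (g := fun (n : ℤ) (y : ℝ) => c n * fourier n (y : S1)) (g' := D)
      (y₀ := 0) hsum
      (fun n y => (hasDerivAt_fourier (T := 1) n y).const_mul (c n))
      (fun n y => (hDn n y).le) (Sob.hasSum (by linarith) u _).summable t
    refine this.congr_of_eventuallyEq (Filter.Eventually.of_forall fun y => ?_)
    exact (Sob.hasSum (by linarith) u _).tsum_eq.symm
  refine ⟨fun t => (∑' n, D n t).re, ?_, ?_, ?_, ?_⟩
  · refine Complex.continuous_re.comp (continuous_tsum (fun n => ?_) hsum fun n t => (hDn n t).le)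
    have : Continuous fun t : ℝ => fourier n (t : S1) :=
      (fourier n).continuous.comp (AddCircle.continuous_mk' 1)
    fun_prop
  · intro t
    have : ((t + 1 : ℝ) : S1) = (t : S1) := AddCircle.coe_add_period 1 t
    simp only [hD, this]
  · intro t
    refine (Complex.abs_re_le_norm _).trans ?_
    refine (norm_tsum_le_tsum_norm (by simpa only [hDn] using hsum)).trans ?_
    simp only [hDn, tsum_mul_left]
    rw [mul_assoc (2 * Real.pi)]
    exact mul_le_mul_of_nonneg_left h2 (by positivity)
  · intro t
    have := (Complex.reCLM.hasFDerivAt (x := ((u (t : S1) : ℝ) : ℂ))).comp_hasDerivAt t (hder t)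
    simpa [Function.comp_def] using this

/-! ## The manifold `G^s` -/

/-- `H₀^s(S¹; ℝ)`, the functions of class `H^s` that vanish at `0`. -/
def Sob0 (s : ℝ) : Submodule ℝ (Sob s) where
  carrier := {u | u (0 : S1) = 0}
  add_mem' {u v} hu hv := by
    simp only [Set.mem_ofPred_eq, map_add, ContinuousMap.add_apply] at *
    rw [hu, hv, add_zero]
  zero_mem' := by simp
  smul_mem' c u hu := by
    simp only [Set.mem_ofPred_eq, map_smul, ContinuousMap.smul_apply] at *
    rw [hu, smul_zero]

/-- The model space `H₀^s(S¹; ℝ) × H^{s-1}(S¹; ℝ)` of `G^s`. -/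
abbrev Model (s : ℝ) : Type := Sob0 s × Sob (s - 1)

/-- `id + h` is an orientation preserving diffeomorphism: its derivative `1 + h_x` is positive.
The circle diffeomorphism is represented by its lift `t ↦ t + h t` to `ℝ`. -/
def IsDisplacement {s : ℝ} (h : Sob0 s) : Prop :=
  ∀ t : ℝ, 0 < deriv (fun y : ℝ => y + h.1 (y : S1)) t

/-- A map `α : S¹ → S¹_{4π}` is of class `H^r` (`r > 1/2`): it has a lift `ℝ → ℝ` which is the sum
of a linear function (given by the winding number `k`) and a periodic function of class `H^r`. -/
def IsSobolevAngle (r : ℝ) (α : S1 → S4pi) : Prop :=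
  ∃ (k : ℤ) (a : Sob r), ∀ t : ℝ, α (t : S1) = ((4 * Real.pi * k * t + a (t : S1) : ℝ) : S4pi)

/-- The space `G^s = Diff₀^s(S¹) × H^{s-1}(S¹; S¹_{4π})` of pairs `(φ, α)`, where `φ = id + h`. -/
@[ext]
structure GSpace (s : ℝ) where
  /-- the displacement `h = φ - id` -/
  disp : Sob0 s
  disp_pos : IsDisplacement disp
  /-- the angle `α` -/
  angle : S1 → S4pi
  angle_mem : IsSobolevAngle (s - 1) angle

namespace GSpace

variable {s : ℝ}

/-- The lift `ℝ → ℝ` of the diffeomorphism `φ`, with `φ(0) = 0` and `φ(t + 1) = φ(t) + 1`. -/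
def phi (p : GSpace s) : ℝ ≃o ℝ :=
  StrictMono.orderIsoOfSurjective (fun y : ℝ => y + p.disp.1 (y : S1))
    (strictMono_of_deriv_pos p.disp_pos) <| by
      have hcont : Continuous fun y : ℝ => p.disp.1 (y : S1) :=
        (Sob.toC p.disp.1).continuous.comp (AddCircle.continuous_mk' 1)
      have hb : ∀ y : ℝ, |p.disp.1 (y : S1)| ≤ ‖Sob.toC p.disp.1‖ :=
        fun y => (Sob.toC p.disp.1).norm_coe_le_norm _
      refine Continuous.surjective (by fun_prop) ?_ ?_
      · refine Filter.tendsto_atTop_mono (f := fun y : ℝ => y + -‖Sob.toC p.disp.1‖) (fun y => ?_)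
          (Filter.tendsto_atTop_add_const_right _ _ Filter.tendsto_id)
        have := (abs_le.1 (hb y)).1
        linarith
      · refine Filter.tendsto_atBot_mono (f := fun y : ℝ => y + ‖Sob.toC p.disp.1‖) (fun y => ?_)
          (Filter.tendsto_atBot_add_const_right _ _ Filter.tendsto_id)
        have := (abs_le.1 (hb y)).2
        linarith

lemma phi_apply (p : GSpace s) (t : ℝ) : p.phi t = t + p.disp.1 (t : S1) := rfl

end GSpace

/-! ### The manifold structure -/

/-- `a` takes values in the interval `(-2π, 2π)`. -/
def IsSmall {r : ℝ} (a : Sob r) : Prop := ∀ x, |a x| < 2 * Real.pi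

lemma small_unique {r : ℝ} {a b : Sob r} (ha : IsSmall a) (hb : IsSmall b)
    (h : ∀ x : S1, ((a x : ℝ) : S4pi) = ((b x : ℝ) : S4pi)) : a = b := by
  apply Sob.toC_injective
  ext x
  have h1 : ((a x - b x : ℝ) : S4pi) = 0 := by
    rw [AddCircle.coe_sub, h x, sub_self]
  obtain ⟨n, hn⟩ := (AddCircle.coe_eq_zero_iff _).1 h1
  have ha' := abs_lt.1 (ha x)
  have hb' := abs_lt.1 (hb x)
  have hpi := Real.pi_pos
  rw [zsmul_eq_mul] at hn
  have hn1 : (n : ℝ) < 1 := by nlinarith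
  have hn2 : (-1 : ℝ) < n := by nlinarith
  have hn0 : n = 0 := by
    have h3 : n < 1 := by exact_mod_cast hn1
    have h4 : -1 < n := by exact_mod_cast hn2
    omega
  rw [hn0] at hn
  simp only [Int.cast_zero, zero_mul] at hn
  linarith

lemma isOpen_small {r : ℝ} (hr : 1 / 2 < r) : IsOpen {a : Sob r | IsSmall a} := by
  have h : {a : Sob r | IsSmall a} = Sob.toC ⁻¹' Metric.ball 0 (2 * Real.pi) := by
    ext a
    simp only [Set.mem_ofPred_eq, Set.mem_preimage, mem_ball_zero_iff]
    exact (ContinuousMap.norm_lt_iff (Sob.toC a) (by positivity : (0 : ℝ) < 2 * Real.pi)).symm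
  rw [h]
  exact Metric.isOpen_ball.preimage (Sob.continuous_toC hr)

lemma isOpen_displacement {s : ℝ} (hs : 3 / 2 < s) :
    IsOpen {h : Sob0 s | IsDisplacement h} := by
  obtain ⟨C, hC⟩ := Sob.exists_hasDerivAt hs
  rw [Metric.isOpen_iff]
  intro h hh
  obtain ⟨h', hcont, hper, -, hder⟩ := hC h.1
  have hd : ∀ t, deriv (fun y : ℝ => y + h.1 (y : S1)) t = 1 + h' t :=
    fun t => ((hasDerivAt_id' t).add (hder t)).deriv
  obtain ⟨t₀, -, ht₀⟩ := isCompact_Icc.exists_isMinOn (Set.nonempty_Icc.2 (zero_le_one' ℝ))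
    hcont.continuousOn
  have hpos : 0 < 1 + h' t₀ := by rw [← hd]; exact hh t₀
  have hmin : ∀ t, h' t₀ ≤ h' t := by
    intro t
    obtain ⟨y, hy, hty⟩ := hper.exists_mem_Ico₀ one_pos t
    rw [hty]
    exact ht₀ ⟨hy.1, hy.2.le⟩
  refine ⟨(1 + h' t₀) / (|C| + 1), by positivity, fun k hk t => ?_⟩
  obtain ⟨e', -, -, hbound, hder'⟩ := hC (k.1 - h.1)
  have hk' : ‖k.1 - h.1‖ < (1 + h' t₀) / (|C| + 1) := by
    rw [Metric.mem_ball, dist_eq_norm] at hk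
    exact hk
  have hk1 : |e' t| < 1 + h' t₀ := by
    refine (hbound t).trans_lt ?_
    rw [lt_div_iff₀ (by positivity)] at hk'
    have := le_abs_self C
    nlinarith [norm_nonneg (k.1 - h.1)]
  have hsum : HasDerivAt (fun y : ℝ => y + k.1 (y : S1)) (1 + (h' t + e' t)) t := by
    have := (hasDerivAt_id' t).add ((hder t).add (hder' t))
    refine this.congr_of_eventuallyEq (Filter.Eventually.of_forall fun y => ?_)
    simp [map_sub]
  rw [hsum.deriv]
  have := (abs_lt.1 hk1).1
  have := hmin t
  linarith

namespace GSpace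

variable {s : ℝ}

/-- The angle `α` lies within `2π` of the angle `α₀`, through the difference `a`. -/
def IsAngleDiff (α₀ α : S1 → S4pi) (a : Sob (s - 1)) : Prop :=
  IsSmall a ∧ ∀ x, α x = α₀ x + ((a x : ℝ) : S4pi)

lemma isAngleDiff_unique {α₀ α : S1 → S4pi} {a b : Sob (s - 1)} (ha : IsAngleDiff α₀ α a)
    (hb : IsAngleDiff α₀ α b) : a = b :=
  small_unique ha.1 hb.1 fun x => add_left_cancel ((ha.2 x).symm.trans (hb.2 x))

open Classical in
/-- The difference `α - α₀` as a real function with values in `(-2π, 2π)`, if there is one. -/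
def angleCoord (α₀ α : S1 → S4pi) : Sob (s - 1) :=
  if h : ∃ a : Sob (s - 1), IsAngleDiff α₀ α a then h.choose else 0

lemma angleCoord_eq {α₀ α : S1 → S4pi} {a : Sob (s - 1)} (ha : IsAngleDiff α₀ α a) :
    angleCoord α₀ α = a := by
  have h : ∃ a : Sob (s - 1), IsAngleDiff α₀ α a := ⟨a, ha⟩
  rw [angleCoord, dif_pos h]
  exact isAngleDiff_unique h.choose_spec ha

/-- The point `(id + h, α₀ + a)`. -/
def shift (p₀ : GSpace s) (h : Sob0 s) (hh : IsDisplacement h) (a : Sob (s - 1)) : GSpace s where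
  disp := h
  disp_pos := hh
  angle x := p₀.angle x + ((a x : ℝ) : S4pi)
  angle_mem := by
    obtain ⟨k, b, hb⟩ := p₀.angle_mem
    refine ⟨k, b + a, fun t => ?_⟩
    change p₀.angle (t : S1) + ((a (t : S1) : ℝ) : S4pi) = _
    rw [hb, ← AddCircle.coe_add, map_add, ContinuousMap.add_apply, add_assoc]

open Classical in
/-- The chart of `G^s` around `p₀ = (φ₀, α₀)`: it sends `(id + h, α₀ + a)`, where `a` takes values
in `(-2π, 2π)`, to `(h, a)`. -/
def chart (p₀ : GSpace s) : PartialEquiv (GSpace s) (Model s) where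
  toFun p := (p.disp, angleCoord p₀.angle p.angle)
  invFun v := if h : IsDisplacement v.1 then shift p₀ v.1 h v.2 else p₀
  source := {p | ∃ a : Sob (s - 1), IsAngleDiff p₀.angle p.angle a}
  target := {v | IsDisplacement v.1 ∧ IsSmall v.2}
  map_source' := by
    rintro p ⟨a, ha⟩
    refine ⟨p.disp_pos, ?_⟩
    simp only [angleCoord_eq ha]
    exact ha.1
  map_target' := by
    rintro v ⟨hv, hv'⟩
    rw [dif_pos hv]
    exact ⟨v.2, hv', fun x => rfl⟩
  left_inv' := by
    rintro p ⟨a, ha⟩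
    simp only [angleCoord_eq ha]
    rw [dif_pos p.disp_pos]
    ext x
    · rfl
    · exact (ha.2 x).symm
  right_inv' := by
    rintro v ⟨hv, hv'⟩
    rw [dif_pos hv]
    refine Prod.ext rfl ?_
    exact angleCoord_eq ⟨hv', fun x => rfl⟩

/-- Changes of charts are locally translations. -/
lemma chart_trans_local (hs : 5 / 2 < s) (p₀ p₁ : GSpace s) {v : Model s}
    (hv : v ∈ ((chart p₀).symm.trans (chart p₁)).source) :
    ∃ d : Model s, ∃ N ∈ nhds v, N ⊆ ((chart p₀).symm.trans (chart p₁)).source ∧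
      Set.EqOn ((chart p₀).symm.trans (chart p₁)) (fun w => w + d) N := by
  obtain ⟨⟨hv1, hv2⟩, b, hb⟩ := hv
  have hsym : ∀ w : Model s, ∀ hw : IsDisplacement w.1, (chart p₀).symm w = shift p₀ w.1 hw w.2 :=
    fun w hw => dif_pos hw
  change IsAngleDiff p₁.angle ((chart p₀).symm v).angle b at hb
  rw [hsym v hv1] at hb
  have key : ∀ w : Model s, ∀ hw : IsDisplacement w.1, IsSmall (w.2 + (b - v.2)) →
      IsAngleDiff p₁.angle (shift p₀ w.1 hw w.2).angle (w.2 + (b - v.2)) := by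
    intro w hw hw'
    refine ⟨hw', fun x => ?_⟩
    have h1 : p₀.angle x + ((v.2 x : ℝ) : S4pi) = p₁.angle x + ((b x : ℝ) : S4pi) := hb.2 x
    change p₀.angle x + ((w.2 x : ℝ) : S4pi) = _
    have h2 : p₀.angle x = p₁.angle x + ((b x : ℝ) : S4pi) - ((v.2 x : ℝ) : S4pi) :=
      eq_sub_of_add_eq h1
    rw [h2]
    simp only [map_add, map_sub, ContinuousMap.add_apply, ContinuousMap.sub_apply,
      AddCircle.coe_add, AddCircle.coe_sub]
    abel
  refine ⟨(0, b - v.2), {w | IsDisplacement w.1 ∧ IsSmall w.2 ∧ IsSmall (w.2 + (b - v.2))},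
    ?_, ?_, ?_⟩
  · refine IsOpen.mem_nhds ?_ ⟨hv1, hv2, by simpa using hb.1⟩
    have h1 := (isOpen_displacement (s := s) (by linarith)).preimage
      (continuous_fst : Continuous (Prod.fst : Model s → Sob0 s))
    have h2 := (isOpen_small (r := s - 1) (by linarith)).preimage
      (continuous_snd : Continuous (Prod.snd : Model s → Sob (s - 1)))
    have h3 := (isOpen_small (r := s - 1) (by linarith)).preimage
      (by fun_prop : Continuous (fun w : Model s => w.2 + (b - v.2)))
    exact h1.inter (h2.inter h3)
  · rintro w ⟨hw1, hw2, hw3⟩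
    refine ⟨⟨hw1, hw2⟩, w.2 + (b - v.2), ?_⟩
    change IsAngleDiff p₁.angle ((chart p₀).symm w).angle _
    rw [hsym w hw1]
    exact key w hw1 hw3
  · rintro w ⟨hw1, hw2, hw3⟩
    change chart p₁ ((chart p₀).symm w) = _
    rw [hsym w hw1]
    refine Prod.ext ?_ ?_
    · change w.1 = w.1 + 0
      rw [add_zero]
    · exact angleCoord_eq (key w hw1 hw3)

/-- The atlas of all the charts. -/
def core (hs : 5 / 2 < s) : ChartedSpaceCore (Model s) (GSpace s) where
  atlas := Set.range chart
  chartAt := chart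
  mem_chart_source p := by
    refine ⟨0, fun x => ?_, fun x => ?_⟩
    · simp [Real.pi_pos]
    · simp
  chart_mem_atlas p := ⟨p, rfl⟩
  open_source := by
    rintro _ _ ⟨p₀, rfl⟩ ⟨p₁, rfl⟩
    rw [isOpen_iff_mem_nhds]
    intro v hv
    obtain ⟨d, N, hN, hsub, -⟩ := chart_trans_local hs p₀ p₁ hv
    exact Filter.mem_of_superset hN hsub
  continuousOn_toFun := by
    rintro _ _ ⟨p₀, rfl⟩ ⟨p₁, rfl⟩ v hv
    obtain ⟨d, N, hN, -, heq⟩ := chart_trans_local hs p₀ p₁ hv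
    refine ContinuousAt.continuousWithinAt ?_
    exact (by fun_prop : Continuous fun w : Model s => w + d).continuousAt.congr
      (heq.eventuallyEq_of_mem hN).symm

instance [hs : Fact (5 / 2 < s)] : TopologicalSpace (GSpace s) := (core hs.out).toTopologicalSpace

instance [hs : Fact (5 / 2 < s)] : ChartedSpace (Model s) (GSpace s) := (core hs.out).toChartedSpace

instance [hs : Fact (5 / 2 < s)] (n : ℕ∞ω) : IsManifold 𝓘(ℝ, Model s) n (GSpace s) := by
  refine isManifold_of_contDiffOn _ _ _ ?_
  intro e e' he he'
  obtain ⟨_, ⟨p₀, rfl⟩, rfl⟩ := Set.mem_iUnion₂.1 he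
  obtain ⟨_, ⟨p₁, rfl⟩, rfl⟩ := Set.mem_iUnion₂.1 he'
  intro v hv
  have hv' : v ∈ ((chart p₀).symm.trans (chart p₁)).source := hv.1
  obtain ⟨d, N, hN, -, heq⟩ := chart_trans_local hs.out p₀ p₁ hv'
  refine ContDiffAt.contDiffWithinAt ?_
  refine (by fun_prop : ContDiff ℝ n fun w : Model s => w + d).contDiffAt.congr_of_eventuallyEq ?_
  exact heq.eventuallyEq_of_mem hN

/-! ### The right-invariant metric -/

/-- The inner product `¼ ∫ (u_x v_x + ρ τ) dx` of `(u, ρ)` and `(v, τ)` at the identity; functions on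
`S¹` are written as `1`-periodic functions on `ℝ`. -/
def innerId (u ρ v τ : ℝ → ℝ) : ℝ :=
  1 / 4 * ∫ x in (0 : ℝ)..1, (deriv u x * deriv v x + ρ x * τ x)

/-- The right-invariant metric on `G^s`: tangent vectors `U = (U₁, U₂)` and `V = (V₁, V₂)` at
`(φ, α)` are moved to the identity by the right translation `U ↦ (U₁ ∘ φ⁻¹, U₂ ∘ φ⁻¹)`. -/
def metric (s : ℝ) [Fact (5 / 2 < s)] (p : GSpace s) (U V : TangentSpace 𝓘(ℝ, Model s) p) : ℝ :=
  let U' : Model s := U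
  let V' : Model s := V
  innerId (fun x => U'.1.1 (p.phi.symm x : S1)) (fun x => U'.2 (p.phi.symm x : S1))
    (fun x => V'.1.1 (p.phi.symm x : S1)) (fun x => V'.2 (p.phi.symm x : S1))

/-- `r` is the product `p q` in the semidirect product, i.e. `(φ, α)(ψ, β) = (φ ∘ ψ, β + α ∘ ψ)`. -/
def IsMul (p q r : GSpace s) : Prop :=
  (∀ t : ℝ, r.phi t = p.phi (q.phi t)) ∧
    ∀ t : ℝ, r.angle (t : S1) = q.angle (t : S1) + p.angle (q.phi t : S1)

/-- `U'` is the image of the tangent vector `U` under the right multiplication by `q`. -/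
def IsRightTranslate (q : GSpace s) (U U' : Model s) : Prop :=
  ∀ t : ℝ, U'.1.1 (t : S1) = U.1.1 (q.phi t : S1) ∧ U'.2 (t : S1) = U.2 (q.phi t : S1)

/-- The metric is right-invariant. -/
lemma metric_right_invariant [Fact (5 / 2 < s)] {p q r : GSpace s} (h : IsMul p q r)
    {U U' V V' : Model s} (hU : IsRightTranslate q U U') (hV : IsRightTranslate q V V') :
    metric s r U' V' = metric s p U V := by
  have hsymm : ∀ x : ℝ, q.phi (r.phi.symm x) = p.phi.symm x := by
    intro x
    rw [OrderIso.eq_symm_apply, ← h.1, OrderIso.apply_symm_apply]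
  simp only [metric, fun t => (hU t).1, fun t => (hU t).2, fun t => (hV t).1, fun t => (hV t).2,
    hsymm]

end GSpace

end TwoHS

end

/-!
The argument is a computation in charts, made rigorous by two reductions.

*Charts.* The charts of `G^s` differ locally by translations (in the angle), so the tangent bundle
is globally `G^s × Model s`, vector fields are functions with values in the model space, and a
connection is a derivative plus a Christoffel map `Γ`. If `Γ` is smooth and symmetric, if the
metric `G` is `Γ`-parallel and if `D_u Γ(v, w) - D_v Γ(u, w) + Γ(u, Γ(v, w)) - Γ(v, Γ(u, w))`
equals `c (G(v, w) u - G(u, w) v)`, then `∇ = D + Γ` is a Levi-Civita connection of curvature `c`.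
Although the metric is weak, the Koszul argument still gives uniqueness (`leviCivita_unique`),
because the difference of two Levi-Civita connections is a trilinear form which is symmetric in
one pair of arguments and skew in another. This is `IsSpaceForm.hasConstantSectionalCurvature`.

*The metric.* Substituting `x = φ(t)` in the right-invariant metric gives, with `ρ = φ_x`,
`G(U, V) = ¼ ∫ (u' v' / ρ + μ ν ρ) dt` for `U = (u, μ)` and `V = (v, ν)` (`GSpace.metric_eq`).
The inverse `φ⁻¹`, which is not a smooth function of `φ` in `H^s`, has disappeared: only
`ρ = 1 + h'` and `1 / ρ` enter, and they depend smoothly on `h`. The Christoffel map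
`Γ(U, V) = (z, ζ)` is `z' = - u' v' / (2 ρ) - μ ν ρ / 2 + 2 G(U, V) ρ` and
`ζ = (u' ν + v' μ) / (2 ρ)`, where the last term of `z'` makes its mean zero, so that `z` is a
periodic function with `z(0) = 0`. That `G` is parallel and that the curvature is one are then
pointwise identities between polynomials in `ρ`, `1 / ρ`, `u'`, `μ`, … with constant coefficients
`G(·, ·)`; the integrals that appear cancel by parallelism and the symmetry of `Γ`
(`fderiv_metricMap_eq`, `curvature_chrisMap`).

*Analysis.* What is needed of Sobolev spaces is that `H^{s-1}` is a Banach algebra, that the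
reciprocal of a function without zeros is again in it and depends smoothly on the function, and
that differentiation is an isomorphism from `H₀^s` onto the functions of mean zero in `H^{s-1}`.
The product estimate is the Cauchy-Schwarz inequality for the convolution of Fourier coefficients.
For the reciprocals, Gelfand theory reduces invertibility to the determination of the characters:
these are the point evaluations, since the norms of the exponentials grow only polynomially
(`exists_eval`).
-/

open scoped Topology

noncomputable section

namespace TwoHS

open AddCircle

/-! ### Fourier coefficients and the product estimate -/

lemma memℓp_two_iff {x : ℤ → ℂ} : Memℓp x 2 ↔ Summable fun n => ‖x n‖ ^ 2 := by
  rw [memℓp_gen_iff (by norm_num)]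
  simp

lemma lp_norm_sq (x : lp (fun _ : ℤ => ℂ) 2) : ‖x‖ ^ 2 = ∑' n, ‖x n‖ ^ 2 := by
  have := lp.norm_rpow_eq_tsum (p := 2) (by norm_num) x
  simpa using this

/-- The `n`-th Fourier coefficient as a continuous linear functional. -/
def coeffCLM (n : ℤ) : C(S1, ℂ) →L[ℂ] ℂ :=
  LinearMap.mkContinuous
    { toFun := fun f => fourierCoeff f n
      map_add' := fun f g => by
        have hf : MeasureTheory.Integrable f haarAddCircle :=
          f.continuous.integrable_of_hasCompactSupport (HasCompactSupport.of_compactSpace _)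
        have hg : MeasureTheory.Integrable g haarAddCircle :=
          g.continuous.integrable_of_hasCompactSupport (HasCompactSupport.of_compactSpace _)
        exact congrFun (fourierCoeff.add hf hg) n
      map_smul' := fun c f => fourierCoeff.const_smul f c n } 1 fun f => by
    rw [one_mul]
    have h := MeasureTheory.norm_integral_le_of_norm_le_const (μ := haarAddCircle)
      (f := fun x : S1 => fourier (-n) x • f x) (C := ‖f‖)
      (Filter.Eventually.of_forall fun x => by
        rw [norm_smul, fourier_apply, Circle.norm_coe, one_mul]
        exact f.norm_coe_le_norm x)
    simpa [fourierCoeff] using h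

lemma coeffCLM_apply (n : ℤ) (f : C(S1, ℂ)) : coeffCLM n f = fourierCoeff f n := rfl

lemma coeffCLM_fourier (n m : ℤ) : coeffCLM n (fourier m) = if n = m then 1 else 0 := by
  rw [coeffCLM_apply, fourierCoeff_fourier, Pi.single_apply]

lemma coeffCLM_fourier_mul (n m : ℤ) (g : C(S1, ℂ)) :
    coeffCLM n (fourier m * g) = coeffCLM (n - m) g := by
  simp only [coeffCLM_apply, fourierCoeff]
  congr 1
  ext x
  rw [ContinuousMap.mul_apply, smul_eq_mul, smul_eq_mul, ← mul_assoc, ← fourier_add]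
  congr 3
  ring

/-- The weight `(1 + n²)^r`, the square of the weight in `weightedCoeff`. -/
def wt (r : ℝ) (n : ℤ) : ℝ := (1 + (n : ℝ) ^ 2) ^ r

lemma wt_pos (r : ℝ) (n : ℤ) : 0 < wt r n := by unfold wt; positivity

lemma one_le_wt {r : ℝ} (hr : 0 ≤ r) (n : ℤ) : 1 ≤ wt r n :=
  Real.one_le_rpow (by nlinarith [sq_nonneg (n : ℝ)]) hr

lemma sq_weight (r : ℝ) (n : ℤ) : ((1 + (n : ℝ) ^ 2) ^ (r / 2)) ^ 2 = wt r n := by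
  rw [wt, ← Real.rpow_natCast, ← Real.rpow_mul (by positivity)]
  congr 1; push_cast; ring

lemma summable_inv_wt {r : ℝ} (hr : 1 / 2 < r) : Summable fun n : ℤ => (wt r n)⁻¹ := by
  refine (summable_weight (q := 2 * r) (by linarith)).congr fun n => ?_
  rw [wt, ← Real.rpow_neg (by positivity)]
  congr 1; ring

/-- The weight of a sum is controlled by the weights of the summands. -/
lemma wt_le {r : ℝ} (hr : 0 ≤ r) (n m : ℤ) : wt r n ≤ 4 ^ r * (wt r m + wt r (n - m)) := by
  have h4 : ∀ k l : ℤ, (n : ℝ) = k + l → (l : ℝ) ^ 2 ≤ (k : ℝ) ^ 2 → wt r n ≤ 4 ^ r * wt r k := by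
    intro k l h1 h2
    rw [wt, wt, ← Real.mul_rpow (by norm_num) (by positivity)]
    refine Real.rpow_le_rpow (by positivity) ?_ hr
    rw [h1]
    nlinarith [sq_nonneg ((k : ℝ) - l)]
  have hp : (0 : ℝ) < 4 ^ r := by positivity
  have p1 := wt_pos r m
  have p2 := wt_pos r (n - m)
  rcases le_total (((n - m : ℤ) : ℝ) ^ 2) ((m : ℝ) ^ 2) with h | h
  · have := h4 m (n - m) (by push_cast; ring) h
    nlinarith
  · have := h4 (n - m) m (by push_cast; ring) h
    nlinarith

/-- A constant `K` with `‖f g‖² ≤ K ‖f‖² ‖g‖²` for the norm `‖f‖² = ∑ (1 + n²)^r |f̂(n)|²`. -/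
def prodConst (r : ℝ) : ℝ := 4 ^ r * (2 * ∑' n : ℤ, (wt r n)⁻¹)

lemma prodConst_pos {r : ℝ} (hr : 1 / 2 < r) : 0 < prodConst r := by
  have := (summable_inv_wt hr).tsum_pos (fun n => (inv_pos.2 (wt_pos r n)).le) 0
    (inv_pos.2 (wt_pos r 0))
  unfold prodConst
  positivity

lemma summable_inv_wt_mul {r : ℝ} (hr : 1 / 2 < r) (n : ℤ) :
    Summable (fun m => (wt r m * wt r (n - m))⁻¹) := by
  refine Summable.of_nonneg_of_le (fun m => (inv_pos.2 (mul_pos (wt_pos r m) (wt_pos r _))).le)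
    (fun m => ?_) (summable_inv_wt hr)
  refine inv_anti₀ (wt_pos r m) ?_
  exact le_mul_of_one_le_right (wt_pos r m).le (one_le_wt (by linarith) _)

lemma wt_mul_tsum_le {r : ℝ} (hr : 1 / 2 < r) (n : ℤ) :
    wt r n * ∑' m, (wt r m * wt r (n - m))⁻¹ ≤ prodConst r := by
  have hs := summable_inv_wt hr
  have hs' : Summable fun m : ℤ => (wt r (n - m))⁻¹ :=
    hs.comp_injective (Equiv.subLeft n).injective
  have he : ∑' m : ℤ, (wt r (n - m))⁻¹ = ∑' m : ℤ, (wt r m)⁻¹ :=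
    (Equiv.subLeft n).tsum_eq fun m => (wt r m)⁻¹
  have hterm : ∀ m, wt r n * (wt r m * wt r (n - m))⁻¹ ≤
      4 ^ r * ((wt r m)⁻¹ + (wt r (n - m))⁻¹) := by
    intro m
    have p1 := wt_pos r m
    have p2 := wt_pos r (n - m)
    have h := wt_le (r := r) (by linarith) n m
    generalize wt r m = a at *
    generalize wt r (n - m) = b at *
    rw [← div_eq_mul_inv, div_le_iff₀ (by positivity)]
    refine h.trans_eq ?_
    field_simp
    ring
  have hle := Summable.tsum_le_tsum hterm ((summable_inv_wt_mul hr n).mul_left (wt r n))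
    ((hs.add hs').mul_left (4 ^ r))
  rw [tsum_mul_left, tsum_mul_left, hs.tsum_add hs', he, ← two_mul] at hle
  exact hle

/-- `f` is of class `H^r`, i.e. `∑ (1 + n²)^r |f̂(n)|² < ∞`. -/
def SobMem (r : ℝ) (f : C(S1, ℂ)) : Prop := Summable fun n => wt r n * ‖coeffCLM n f‖ ^ 2

lemma summable_norm_of_summable_sq {r : ℝ} (hr : 1 / 2 < r) {c : ℤ → ℂ}
    (h : Summable fun n => wt r n * ‖c n‖ ^ 2) : Summable fun n => ‖c n‖ := by
  refine Summable.of_nonneg_of_le (fun n => norm_nonneg _) (fun n => ?_)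
    ((summable_inv_wt hr).add h)
  have h0 := wt_pos r n
  have h1 : wt r n * ((wt r n)⁻¹ - ‖c n‖) ^ 2 = (wt r n)⁻¹ - 2 * ‖c n‖ + wt r n * ‖c n‖ ^ 2 := by
    field_simp
    ring
  have h2 := mul_nonneg h0.le (sq_nonneg ((wt r n)⁻¹ - ‖c n‖))
  have h3 := norm_nonneg (c n)
  linarith

lemma SobMem.summable {r : ℝ} (hr : 1 / 2 < r) {f : C(S1, ℂ)} (hf : SobMem r f) :
    Summable fun n => ‖coeffCLM n f‖ := summable_norm_of_summable_sq hr hf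

lemma SobMem.hasSum {r : ℝ} (hr : 1 / 2 < r) {f : C(S1, ℂ)} (hf : SobMem r f) :
    HasSum (fun n => coeffCLM n f • fourier n) f :=
  hasSum_fourier_series_of_summable (hf.summable hr).of_norm

lemma hasSum_coeff_mul {r : ℝ} (hr : 1 / 2 < r) {f : C(S1, ℂ)} (hf : SobMem r f) (g : C(S1, ℂ))
    (n : ℤ) : HasSum (fun m => coeffCLM m f * coeffCLM (n - m) g) (coeffCLM n (f * g)) := by
  have h1 := ((hf.hasSum hr).mul_right g).mapL (coeffCLM n)
  convert h1 using 2 with m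
  rw [smul_mul_assoc, map_smul, coeffCLM_fourier_mul, smul_eq_mul]

/-- The product estimate in `H^r`, `r > 1/2`, for one Fourier coefficient: by Cauchy-Schwarz the
convolution of the coefficients is controlled by the convolution of their weighted squares. -/
lemma wt_mul_coeff_mul_le {r : ℝ} (hr : 1 / 2 < r) {f g : C(S1, ℂ)} (hf : SobMem r f)
    (hg : SobMem r g) (n : ℤ) :
    wt r n * ‖coeffCLM n (f * g)‖ ^ 2 ≤ prodConst r *
      ∑' m, (wt r m * ‖coeffCLM m f‖ ^ 2) * (wt r (n - m) * ‖coeffCLM (n - m) g‖ ^ 2) := by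
  set A : ℤ → ℝ := fun m => wt r m * ‖coeffCLM m f‖ ^ 2 with hA
  set B : ℤ → ℝ := fun m => wt r m * ‖coeffCLM m g‖ ^ 2 with hB
  have hA0 : ∀ m, 0 ≤ A m := fun m => mul_nonneg (wt_pos r m).le (sq_nonneg _)
  have hB0 : ∀ m, 0 ≤ B m := fun m => mul_nonneg (wt_pos r m).le (sq_nonneg _)
  have hAB : Summable fun m => A m * B (n - m) := by
    refine Summable.of_nonneg_of_le (fun m => mul_nonneg (hA0 m) (hB0 _)) (fun m => ?_)
      (Summable.mul_right (∑' k, B k) hf)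
    exact mul_le_mul_of_nonneg_left (hg.le_tsum _ fun k _ => hB0 k) (hA0 m)
  have hw := summable_inv_wt_mul hr n
  have hw0 : ∀ m, 0 ≤ (wt r m * wt r (n - m))⁻¹ := fun m =>
    (inv_pos.2 (mul_pos (wt_pos r m) (wt_pos r _))).le
  obtain ⟨hs, hle⟩ := Real.summable_and_inner_le_Lp_mul_Lq_tsum_of_nonneg
    Real.HolderConjugate.two_two (f := fun m => √((wt r m * wt r (n - m))⁻¹))
    (g := fun m => √(A m * B (n - m))) (fun m => Real.sqrt_nonneg _) (fun m => Real.sqrt_nonneg _)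
    (by simpa only [Real.rpow_two, Real.sq_sqrt (hw0 _)] using hw)
    (by simpa only [Real.rpow_two, Real.sq_sqrt (mul_nonneg (hA0 _) (hB0 _))] using hAB)
  simp only [Real.rpow_two, Real.sq_sqrt (hw0 _), Real.sq_sqrt (mul_nonneg (hA0 _) (hB0 _)),
    ← Real.sqrt_eq_rpow] at hle
  have hterm : ∀ m, √((wt r m * wt r (n - m))⁻¹) * √(A m * B (n - m)) =
      ‖coeffCLM m f * coeffCLM (n - m) g‖ := by
    intro m
    rw [← Real.sqrt_mul (hw0 m), norm_mul]
    have h1 := (wt_pos r m).ne'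
    have h2 := (wt_pos r (n - m)).ne'
    have : (wt r m * wt r (n - m))⁻¹ * (A m * B (n - m)) =
        (‖coeffCLM m f‖ * ‖coeffCLM (n - m) g‖) ^ 2 := by
      simp only [hA, hB]
      field_simp
    rw [this, Real.sqrt_sq (by positivity)]
  simp only [hterm] at hs hle
  have hnorm : ‖coeffCLM n (f * g)‖ ≤ ∑' m, ‖coeffCLM m f * coeffCLM (n - m) g‖ := by
    rw [← (hasSum_coeff_mul hr hf g n).tsum_eq]
    exact norm_tsum_le_tsum_norm hs
  have hsq : ‖coeffCLM n (f * g)‖ ^ 2 ≤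
      (∑' m, (wt r m * wt r (n - m))⁻¹) * ∑' m, A m * B (n - m) := by
    refine (pow_le_pow_left₀ (norm_nonneg _) (hnorm.trans hle) 2).trans ?_
    rw [mul_pow, Real.sq_sqrt (tsum_nonneg hw0),
      Real.sq_sqrt (tsum_nonneg fun m => mul_nonneg (hA0 m) (hB0 _))]
  refine (mul_le_mul_of_nonneg_left hsq (wt_pos r n).le).trans ?_
  rw [← mul_assoc]
  exact mul_le_mul_of_nonneg_right (wt_mul_tsum_le hr n)
    (tsum_nonneg fun m => mul_nonneg (hA0 m) (hB0 _))

lemma SobMem.mul_and_tsum_le {r : ℝ} (hr : 1 / 2 < r) {f g : C(S1, ℂ)} (hf : SobMem r f)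
    (hg : SobMem r g) : SobMem r (f * g) ∧
      ∑' n, wt r n * ‖coeffCLM n (f * g)‖ ^ 2 ≤ prodConst r *
        ((∑' n, wt r n * ‖coeffCLM n f‖ ^ 2) * ∑' n, wt r n * ‖coeffCLM n g‖ ^ 2) := by
  have hA0 : ∀ (f : C(S1, ℂ)) (m : ℤ), 0 ≤ wt r m * ‖coeffCLM m f‖ ^ 2 :=
    fun f m => mul_nonneg (wt_pos r m).le (sq_nonneg _)
  -- The substitution `(n, m) ↦ (m, n - m)` turns the sum of the convolutions into a product of
  -- sums.
  let e : ℤ × ℤ ≃ ℤ × ℤ :=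
    { toFun := fun p => (p.2, p.1 - p.2)
      invFun := fun p => (p.1 + p.2, p.1)
      left_inv := fun p => by simp
      right_inv := fun p => by simp }
  have hprod := Summable.mul_of_nonneg hf hg (hA0 f) (hA0 g)
  have hconv := e.summable_iff.2 hprod
  have htsum : ∑' n, ∑' m, (wt r m * ‖coeffCLM m f‖ ^ 2) *
      (wt r (n - m) * ‖coeffCLM (n - m) g‖ ^ 2) =
      (∑' n, wt r n * ‖coeffCLM n f‖ ^ 2) * ∑' n, wt r n * ‖coeffCLM n g‖ ^ 2 := by
    have h1 := hconv.tsum_prod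
    have h2 := e.tsum_eq fun x : ℤ × ℤ => (wt r x.1 * ‖coeffCLM x.1 f‖ ^ 2) *
      (wt r x.2 * ‖coeffCLM x.2 g‖ ^ 2)
    rw [Summable.tsum_mul_tsum hf hg hprod, ← h2]
    exact h1.symm
  have hmem : SobMem r (f * g) :=
    Summable.of_nonneg_of_le (hA0 _) (wt_mul_coeff_mul_le hr hf hg) (hconv.prod.mul_left _)
  refine ⟨hmem, ?_⟩
  rw [← htsum, ← tsum_mul_left]
  exact hmem.tsum_le_tsum (wt_mul_coeff_mul_le hr hf hg) (hconv.prod.mul_left _)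

lemma sobMem_algebraMap (r : ℝ) (c : ℂ) : SobMem r (algebraMap ℂ C(S1, ℂ) c) := by
  have h : algebraMap ℂ C(S1, ℂ) c = c • fourier 0 := by
    ext x
    simp
  refine summable_of_ne_finset_zero (s := {0}) fun n hn => ?_
  rw [h, map_smul, coeffCLM_fourier, if_neg (by simpa using hn)]
  simp

lemma SobMem.add {r : ℝ} {f g : C(S1, ℂ)} (hf : SobMem r f) (hg : SobMem r g) :
    SobMem r (f + g) := by
  refine Summable.of_nonneg_of_le (fun n => mul_nonneg (wt_pos r n).le (sq_nonneg _)) (fun n => ?_)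
    ((Summable.add hf hg).mul_left 2)
  have h := wt_pos r n
  have h1 : ‖coeffCLM n (f + g)‖ ^ 2 ≤ 2 * (‖coeffCLM n f‖ ^ 2 + ‖coeffCLM n g‖ ^ 2) := by
    rw [map_add]
    refine (pow_le_pow_left₀ (norm_nonneg _) (norm_add_le _ _) 2).trans ?_
    nlinarith [sq_nonneg (‖coeffCLM n f‖ - ‖coeffCLM n g‖)]
  nlinarith [mul_le_mul_of_nonneg_left h1 h.le]

/-! ### The complex Sobolev space as a Banach algebra -/

/-- The complex functions of class `H^r` form a subalgebra of the continuous functions. -/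
def sobSubalgebra (r : ℝ) [hr : Fact (1 / 2 < r)] : Subalgebra ℂ C(S1, ℂ) where
  carrier := {f | SobMem r f}
  mul_mem' hf hg := (SobMem.mul_and_tsum_le hr.out hf hg).1
  add_mem' hf hg := SobMem.add hf hg
  algebraMap_mem' c := sobMem_algebraMap r c

/-- The Sobolev space `H^r(S¹; ℂ)`, `r > 1/2`, as an algebra of functions. -/
def CSob (r : ℝ) [Fact (1 / 2 < r)] : Type := sobSubalgebra r

namespace CSob

variable {r : ℝ} [hr : Fact (1 / 2 < r)]

instance : CommRing (CSob r) := inferInstanceAs (CommRing (sobSubalgebra r))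

instance : Algebra ℂ (CSob r) := inferInstanceAs (Algebra ℂ (sobSubalgebra r))

/-- The underlying continuous function. -/
def toC : CSob r →ₐ[ℂ] C(S1, ℂ) := (sobSubalgebra r).val

lemma toC_injective : Function.Injective (toC : CSob r → C(S1, ℂ)) := Subtype.val_injective

lemma sobMem (f : CSob r) : SobMem r (toC f) := f.2

/-- The weight, scaled by the square root of the constant in the product estimate, which makes the
norm of `H^r` submultiplicative. -/
def scaledWt (r : ℝ) (n : ℤ) : ℝ := √(prodConst r * wt r n)

lemma scaledWt_sq (n : ℤ) : scaledWt r n ^ 2 = prodConst r * wt r n :=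
  Real.sq_sqrt (mul_pos (prodConst_pos hr.out) (wt_pos r n)).le

lemma scaledWt_pos (n : ℤ) : 0 < scaledWt r n :=
  Real.sqrt_pos.2 (mul_pos (prodConst_pos hr.out) (wt_pos r n))

lemma norm_scaledWt_mul_sq (n : ℤ) (z : ℂ) :
    ‖(scaledWt r n : ℂ) * z‖ ^ 2 = prodConst r * (wt r n * ‖z‖ ^ 2) := by
  rw [norm_mul, mul_pow, Complex.norm_real, Real.norm_of_nonneg (scaledWt_pos n).le, scaledWt_sq,
    mul_assoc]

/-- The weighted Fourier coefficients as a square summable sequence. -/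
def toEll : CSob r →ₗ[ℂ] lp (fun _ : ℤ => ℂ) 2 where
  toFun f := ⟨fun n => (scaledWt r n : ℂ) * coeffCLM n (toC f), by
    refine memℓp_two_iff.2 ?_
    simp only [norm_scaledWt_mul_sq]
    exact (sobMem f).mul_left _⟩
  map_add' f g := by
    ext n
    change (scaledWt r n : ℂ) * coeffCLM n (toC (f + g)) =
      (scaledWt r n : ℂ) * coeffCLM n (toC f) + (scaledWt r n : ℂ) * coeffCLM n (toC g)
    rw [map_add, map_add, mul_add]
  map_smul' c f := by
    ext n
    change (scaledWt r n : ℂ) * coeffCLM n (toC (c • f)) =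
      c * ((scaledWt r n : ℂ) * coeffCLM n (toC f))
    rw [map_smul, map_smul, smul_eq_mul, mul_left_comm]

lemma toEll_apply (f : CSob r) (n : ℤ) : toEll f n = (scaledWt r n : ℂ) * coeffCLM n (toC f) := rfl

lemma scaledWt_ne (n : ℤ) : (scaledWt r n : ℂ) ≠ 0 := by
  exact_mod_cast (scaledWt_pos n).ne'

lemma toEll_injective : Function.Injective (toEll : CSob r → lp (fun _ : ℤ => ℂ) 2) := by
  rw [injective_iff_map_eq_zero]
  intro f hf
  apply toC_injective
  have h : ∀ n, coeffCLM n (toC f) = 0 := by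
    intro n
    have h1 : toEll f n = 0 := by rw [hf, lp.coeFn_zero, Pi.zero_apply]
    rw [toEll_apply] at h1
    exact (mul_eq_zero.1 h1).resolve_left (scaledWt_ne n)
  have h2 := (sobMem f).hasSum hr.out
  have h3 : (fun n => coeffCLM n (toC f) • (fourier n : C(S1, ℂ))) = fun _ => 0 := by
    funext n
    rw [h n]
    exact zero_smul ℂ (fourier n : C(S1, ℂ))
  rw [h3] at h2
  rw [map_zero]
  exact h2.unique hasSum_zero

lemma toEll_surjective : Function.Surjective (toEll : CSob r → lp (fun _ : ℤ => ℂ) 2) := by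
  intro x
  set c : ℤ → ℂ := fun n => x n / scaledWt r n with hc
  have hx : ∀ n, (scaledWt r n : ℂ) * c n = x n := fun n => mul_div_cancel₀ _ (scaledWt_ne n)
  have hsum : Summable fun n => wt r n * ‖c n‖ ^ 2 := by
    have h1 : Summable fun n => ‖x n‖ ^ 2 := memℓp_two_iff.1 x.2
    have h2 := h1.mul_left (prodConst r)⁻¹
    refine h2.congr fun n => ?_
    rw [← hx, norm_scaledWt_mul_sq, inv_mul_cancel_left₀ (prodConst_pos hr.out).ne']
  have hs : Summable fun n => c n • (fourier n : C(S1, ℂ)) := by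
    refine Summable.of_norm ?_
    refine (summable_norm_of_summable_sq hr.out hsum).congr fun n => ?_
    rw [norm_smul, fourier_norm, mul_one]
  set f : C(S1, ℂ) := ∑' n, c n • (fourier n : C(S1, ℂ)) with hf
  have hcoeff : ∀ n, coeffCLM n f = c n := by
    intro n
    have h1 := hs.hasSum.mapL (coeffCLM n)
    refine h1.unique ((hasSum_ite_eq n (c n)).congr_fun fun m => ?_)
    rw [map_smul, coeffCLM_fourier, smul_eq_mul]
    by_cases hm : m = n
    · simp [hm]
    · simp [hm, Ne.symm hm]
  refine ⟨⟨f, ?_⟩, ?_⟩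
  · change Summable fun n => wt r n * ‖coeffCLM n f‖ ^ 2
    simpa only [hcoeff] using hsum
  · ext n
    refine (toEll_apply _ n).trans ?_
    rw [← hx, ← hcoeff]
    rfl

/-- The norm `‖f‖² = K ∑ (1 + n²)^r |f̂(n)|²`. -/
instance : NormedAddCommGroup (CSob r) :=
  NormedAddCommGroup.induced (CSob r) (lp (fun _ : ℤ => ℂ) 2) toEll toEll_injective

lemma norm_def (f : CSob r) : ‖f‖ = ‖toEll f‖ := rfl

lemma norm_sq (f : CSob r) :
    ‖f‖ ^ 2 = prodConst r * ∑' n, wt r n * ‖coeffCLM n (toC f)‖ ^ 2 := by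
  rw [norm_def, lp_norm_sq, ← tsum_mul_left]
  simp only [toEll_apply, norm_scaledWt_mul_sq]

instance : NormedCommRing (CSob r) where
  dist_eq f g := dist_eq_norm_neg_add f g
  norm_mul_le f g := by
    refine le_of_sq_le_sq ?_ (by positivity)
    have h := ((sobMem f).mul_and_tsum_le hr.out (sobMem g)).2
    rw [mul_pow, norm_sq, norm_sq, norm_sq, map_mul]
    have h2 := mul_le_mul_of_nonneg_left h (prodConst_pos hr.out).le
    refine h2.trans_eq ?_
    ring
  mul_comm f g := mul_comm f g

instance : NormedAlgebra ℂ (CSob r) where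
  norm_smul_le c f := by
    rw [norm_def, map_smul, norm_smul, norm_def]

/-- The weighted Fourier coefficients as an isometry. -/
def ellEquiv : CSob r ≃ₗᵢ[ℂ] lp (fun _ : ℤ => ℂ) 2 :=
  { LinearEquiv.ofBijective toEll ⟨toEll_injective, toEll_surjective⟩ with
    norm_map' := fun _ => rfl }

instance : CompleteSpace (CSob r) :=
  (completeSpace_congr (e := ellEquiv.toEquiv) ellEquiv.isometry.isUniformEmbedding).2 inferInstance

end CSob

end TwoHS

namespace TwoHS

open AddCircle

namespace CSob

/-! ### The characters of the Sobolev algebra -/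

lemma sobMem_fourier {r : ℝ} (n : ℤ) : SobMem r (fourier n) := by
  refine summable_of_ne_finset_zero (s := {n}) fun m hm => ?_
  rw [coeffCLM_fourier, if_neg (by simpa using hm)]
  simp

variable {r : ℝ} [hr : Fact (1 / 2 < r)]

/-- The exponential of frequency `n`. -/
def expo (r : ℝ) [Fact (1 / 2 < r)] (n : ℤ) : CSob r := ⟨fourier n, sobMem_fourier n⟩

lemma toC_expo (n : ℤ) : toC (expo r n) = fourier n := rfl

lemma expo_add (m n : ℤ) : expo r (m + n) = expo r m * expo r n := by
  apply toC_injective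
  rw [map_mul, toC_expo, toC_expo, toC_expo]
  ext x
  exact fourier_add

lemma expo_zero : expo r 0 = 1 := by
  apply toC_injective
  rw [map_one, toC_expo]
  ext x
  exact fourier_zero

lemma toEll_expo (n : ℤ) : toEll (expo r n) = lp.single 2 n (scaledWt r n : ℂ) := by
  ext m
  refine (toEll_apply _ m).trans ?_
  rw [toC_expo, coeffCLM_fourier, lp.coeFn_single]
  by_cases h : m = n
  · subst h
    simp
  · simp [h]

lemma norm_expo (n : ℤ) : ‖expo r n‖ = scaledWt r n := by
  rw [norm_def, toEll_expo, lp.norm_single (by norm_num), Complex.norm_real,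
    Real.norm_of_nonneg (scaledWt_pos n).le]

lemma hasSum_expo (f : CSob r) : HasSum (fun n => coeffCLM n (toC f) • expo r n) f := by
  have h := lp.hasSum_single (p := 2) (by norm_num) (ellEquiv f)
  have h2 := h.mapL (ellEquiv (r := r)).symm.toContinuousLinearEquiv.toContinuousLinearMap
  have h3 : ∀ n, (ellEquiv (r := r)).symm (lp.single 2 n (ellEquiv f n)) =
      coeffCLM n (toC f) • expo r n := by
    intro n
    rw [LinearIsometryEquiv.symm_apply_eq]
    change _ = toEll (coeffCLM n (toC f) • expo r n)
    rw [map_smul, toEll_expo, ← lp.single_smul]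
    congr 1
    exact (toEll_apply f n).trans (mul_comm _ _)
  have h4 : (ellEquiv (r := r)).symm (ellEquiv f) = f := (ellEquiv (r := r)).symm_apply_apply f
  have h5 : HasSum (fun n => (ellEquiv (r := r)).symm (lp.single 2 n (ellEquiv f n)))
    ((ellEquiv (r := r)).symm (ellEquiv f)) := h2
  rw [h4] at h5
  exact h5.congr_fun fun n => (h3 n).symm

lemma scaledWt_le (n : ℕ) :
    scaledWt r n ≤ √(prodConst r) * ((n : ℝ) + 1) ^ ⌈r⌉₊ := by
  rw [scaledWt, Real.sqrt_mul (prodConst_pos hr.out).le]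
  refine mul_le_mul_of_nonneg_left ?_ (Real.sqrt_nonneg _)
  rw [Real.sqrt_le_left (by positivity), ← pow_mul, mul_comm, pow_mul, wt,
    ← Real.rpow_natCast _ ⌈r⌉₊]
  have h1 : (1 : ℝ) ≤ 1 + ((n : ℤ) : ℝ) ^ 2 := by nlinarith [sq_nonneg ((n : ℤ) : ℝ)]
  refine (Real.rpow_le_rpow_of_exponent_le h1 (Nat.le_ceil r)).trans ?_
  refine Real.rpow_le_rpow (by positivity) ?_ (by positivity)
  push_cast
  nlinarith [(Nat.cast_nonneg n : (0 : ℝ) ≤ n)]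

lemma le_one_of_pow_le {t C : ℝ} (k : ℕ) (h : ∀ n : ℕ, t ^ n ≤ C * ((n : ℝ) + 1) ^ k) : t ≤ 1 := by
  by_contra! ht
  have h1 := ((tendsto_pow_const_div_const_pow_of_one_lt k ht).comp
    (Filter.tendsto_add_atTop_nat 1)).const_mul (C * t)
  rw [mul_zero] at h1
  have h2 : ∀ n : ℕ, 1 ≤ C * t * (((n + 1 : ℕ) : ℝ) ^ k / t ^ (n + 1)) := by
    intro n
    have hp : 0 < t ^ (n + 1) := by positivity
    rw [← mul_div_assoc, one_le_div hp, pow_succ]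
    have := mul_le_mul_of_nonneg_right (h n) (by linarith : 0 ≤ t)
    push_cast
    linarith
  have h3 := ge_of_tendsto' h1 h2
  norm_num at h3

open WeakDual in
/-- Every character of `H^r` is the evaluation at a point: it sends the exponential of frequency
one to a number `z` whose powers grow at most polynomially in both directions, so that `|z| = 1`,
and the exponentials span a dense subspace. -/
lemma exists_eval (χ : characterSpace ℂ (CSob r)) : ∃ x : S1, ∀ f : CSob r, χ f = toC f x := by
  have hbound : ∀ n : ℤ, ‖χ (expo r n)‖ ≤ scaledWt r n * ‖(1 : CSob r)‖ := by
    intro n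
    rw [← norm_expo]
    exact AlgHom.norm_apply_le_self_mul_norm_one χ (expo r n)
  have hpow : ∀ (n : ℕ) (k : ℤ), χ (expo r (n * k)) = χ (expo r k) ^ n := by
    intro n k
    induction n with
    | zero => simp [expo_zero]
    | succ n ih =>
      rw [pow_succ, ← ih, ← map_mul, ← expo_add]
      congr 2
      push_cast
      ring
  have hinv : χ (expo r 1) * χ (expo r (-1)) = 1 := by
    rw [← map_mul, ← expo_add, add_neg_cancel, expo_zero, map_one]
  have hsymm : ∀ n : ℤ, scaledWt r (-n) = scaledWt r n := by
    intro n
    simp [scaledWt, wt]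
  have hle : ∀ k : ℤ, (k = 1 ∨ k = -1) → ‖χ (expo r k)‖ ≤ 1 := by
    intro k hk
    refine le_one_of_pow_le (C := √(prodConst r) * ‖(1 : CSob r)‖) ⌈r⌉₊ fun n => ?_
    rw [← norm_pow, ← hpow]
    have h1 : scaledWt r (n * k) = scaledWt r n := by
      rcases hk with rfl | rfl
      · rw [mul_one]
      · rw [mul_neg_one, hsymm]
    refine (hbound _).trans ?_
    rw [h1, mul_right_comm]
    exact mul_le_mul_of_nonneg_right (scaledWt_le n) (norm_nonneg _)
  have hz : ‖χ (expo r 1)‖ = 1 := by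
    refine le_antisymm (hle 1 (Or.inl rfl)) ?_
    have h1 := hle (-1) (Or.inr rfl)
    have h2 : ‖χ (expo r 1)‖ * ‖χ (expo r (-1))‖ = 1 := by rw [← norm_mul, hinv, norm_one]
    nlinarith [norm_nonneg (χ (expo r 1))]
  obtain ⟨x, hx⟩ := (AddCircle.homeomorphCircle (one_ne_zero : (1 : ℝ) ≠ 0)).surjective
    ⟨χ (expo r 1), mem_sphere_zero_iff_norm.2 hz⟩
  have hx1 : (fourier 1 x : ℂ) = χ (expo r 1) := by
    rw [fourier_one, ← AddCircle.homeomorphCircle_apply (one_ne_zero : (1 : ℝ) ≠ 0), hx]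
  have hexp : ∀ n : ℤ, χ (expo r n) = fourier n x := by
    have hn : ∀ n : ℕ, χ (expo r n) = (fourier n x : ℂ) := by
      intro n
      have h := hpow n 1
      rw [mul_one, ← hx1] at h
      rw [h]
      induction n with
      | zero => simp
      | succ n ih =>
        have := hpow n 1
        rw [mul_one, ← hx1] at this
        rw [pow_succ, ih this]
        push_cast
        exact fourier_add.symm
    intro n
    obtain ⟨m, rfl | rfl⟩ := n.eq_nat_or_neg
    · exact hn m
    · have h1 : χ (expo r (-(m : ℤ))) * χ (expo r m) = 1 := by
        rw [← map_mul, ← expo_add, neg_add_cancel, expo_zero, map_one]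
      have h2 : (fourier (-(m : ℤ)) x : ℂ) * fourier m x = 1 := by
        rw [← fourier_add, neg_add_cancel, fourier_zero]
      rw [hn] at h1
      exact mul_right_cancel₀ (right_ne_zero_of_mul_eq_one h2) (h1.trans h2.symm)
  refine ⟨x, fun f => ?_⟩
  have h1 := (hasSum_expo f).map χ (map_continuous χ)
  have h2 := ((sobMem f).hasSum hr.out).mapL (ContinuousMap.evalCLM ℂ x)
  refine h1.unique (h2.congr_fun fun n => ?_)
  rw [Function.comp_apply, map_smul, hexp]
  rfl

/-- Wiener's lemma for `H^r`: a function without zeros is invertible, as it lies in the kernel of no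
character. -/
lemma isUnit_of_ne_zero {f : CSob r} (hf : ∀ x, toC f x ≠ 0) : IsUnit f := by
  by_contra h
  obtain ⟨χ, hχ⟩ := WeakDual.CharacterSpace.exists_apply_eq_zero h
  obtain ⟨x, hx⟩ := exists_eval χ
  exact hf x ((hx f).symm.trans hχ)

/-! ### Products and reciprocals in the real Sobolev space -/

/-- A real continuous function as a complex one. -/
def cplx (f : C(S1, ℝ)) : C(S1, ℂ) := ⟨fun x => ((f x : ℝ) : ℂ), by fun_prop⟩

lemma norm_weightedCoeff_sq (r : ℝ) (f : C(S1, ℝ)) (n : ℤ) :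
    ‖weightedCoeff r f n‖ ^ 2 = wt r n * ‖coeffCLM n (cplx f)‖ ^ 2 := by
  rw [weightedCoeff, norm_mul, mul_pow, Complex.norm_real, Real.norm_of_nonneg (weight_pos r n).le,
    sq_weight]
  rfl

lemma sobMem_cplx_iff {r : ℝ} {f : C(S1, ℝ)} : SobMem r (cplx f) ↔ f ∈ sobolevSubmodule r := by
  change _ ↔ Memℓp (weightedCoeff r f) 2
  rw [memℓp_two_iff]
  simp only [norm_weightedCoeff_sq]
  rfl

lemma _root_.TwoHS.Sob.norm_sq {r : ℝ} (u : Sob r) :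
    ‖u‖ ^ 2 = ∑' n, wt r n * ‖coeffCLM n (cplx (Sob.toC u))‖ ^ 2 := by
  have h : ‖u‖ = ‖Sob.toEll u‖ := rfl
  rw [h, lp_norm_sq]
  exact tsum_congr fun n => norm_weightedCoeff_sq r _ n

/-- The complexification `H^r(S¹; ℝ) → H^r(S¹; ℂ)`. -/
def ofReal : Sob r →L[ℝ] CSob r :=
  LinearMap.mkContinuous
    { toFun := fun u => ⟨cplx (Sob.toC u), sobMem_cplx_iff.2 u.2⟩
      map_add' := fun u v => by
        apply toC_injective
        ext x
        exact (congrArg Complex.ofReal (congrFun (congrArg _ (map_add Sob.toC u v)) x)).trans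
          (Complex.ofReal_add _ _)
      map_smul' := fun c u => by
        apply toC_injective
        ext x
        exact (congrArg Complex.ofReal (congrFun (congrArg _ (map_smul Sob.toC c u)) x)).trans
          (Complex.ofReal_mul _ _) } √(prodConst r) fun u => by
    refine le_of_sq_le_sq ?_ (by positivity)
    rw [mul_pow, Real.sq_sqrt (prodConst_pos hr.out).le, Sob.norm_sq, norm_sq]
    exact le_rfl

lemma ofReal_apply (u : Sob r) (x : S1) : toC (ofReal u) x = ((u x : ℝ) : ℂ) := rfl

/-- The real part of a complex continuous function. -/
def reC (f : C(S1, ℂ)) : C(S1, ℝ) := ⟨fun x => (f x).re, by fun_prop⟩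

lemma coeffCLM_star (n : ℤ) (f : C(S1, ℂ)) :
    coeffCLM n (star f) = (starRingEnd ℂ) (coeffCLM (-n) f) := by
  rw [coeffCLM_apply, coeffCLM_apply, fourierCoeff, fourierCoeff, ← integral_conj]
  congr 1
  ext x
  rw [smul_eq_mul, smul_eq_mul, map_mul, fourier_neg, neg_neg]
  rfl

lemma cplx_reC (f : C(S1, ℂ)) : cplx (reC f) = (2⁻¹ : ℂ) • (f + star f) := by
  ext x
  have h : ((f x).re : ℂ) = 2⁻¹ * (f x + (starRingEnd ℂ) (f x)) := by
    rw [Complex.add_conj]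
    push_cast
    ring
  exact h

lemma wt_neg (r : ℝ) (n : ℤ) : wt r (-n) = wt r n := by simp [wt]

lemma wt_mul_coeffCLM_reC_le (r : ℝ) (f : C(S1, ℂ)) (n : ℤ) :
    wt r n * ‖coeffCLM n (cplx (reC f))‖ ^ 2 ≤
      2⁻¹ * (wt r n * ‖coeffCLM n f‖ ^ 2 + wt r (-n) * ‖coeffCLM (-n) f‖ ^ 2) := by
  have h0 := wt_pos r n
  have h1 : ‖coeffCLM n (cplx (reC f))‖ ^ 2 ≤
      2⁻¹ * (‖coeffCLM n f‖ ^ 2 + ‖coeffCLM (-n) f‖ ^ 2) := by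
    rw [cplx_reC, map_smul, map_add, coeffCLM_star, smul_eq_mul, norm_mul]
    have h2 := norm_add_le (coeffCLM n f) ((starRingEnd ℂ) (coeffCLM (-n) f))
    rw [RCLike.norm_conj] at h2
    have h3 : ‖(2⁻¹ : ℂ)‖ = 2⁻¹ := by norm_num
    rw [h3, mul_pow]
    have h4 := pow_le_pow_left₀ (norm_nonneg _) h2 2
    nlinarith [sq_nonneg (‖coeffCLM n f‖ - ‖coeffCLM (-n) f‖)]
  rw [wt_neg]
  nlinarith [mul_le_mul_of_nonneg_left h1 h0.le]

lemma sobMem_reC {r : ℝ} {f : C(S1, ℂ)} (hf : SobMem r f) : SobMem r (cplx (reC f)) ∧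
    ∑' n, wt r n * ‖coeffCLM n (cplx (reC f))‖ ^ 2 ≤ ∑' n, wt r n * ‖coeffCLM n f‖ ^ 2 := by
  have hneg : Summable fun n => wt r (-n) * ‖coeffCLM (-n) f‖ ^ 2 :=
    Summable.comp_injective hf (Equiv.neg ℤ).injective
  have hs := (Summable.add hf hneg).mul_left 2⁻¹
  have hmem : SobMem r (cplx (reC f)) := Summable.of_nonneg_of_le
    (fun n => mul_nonneg (wt_pos r n).le (sq_nonneg _)) (wt_mul_coeffCLM_reC_le r f) hs
  refine ⟨hmem, ?_⟩
  have h1 := Summable.tsum_le_tsum (wt_mul_coeffCLM_reC_le r f) hmem hs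
  have h2 : ∑' n, wt r (-n) * ‖coeffCLM (-n) f‖ ^ 2 = ∑' n, wt r n * ‖coeffCLM n f‖ ^ 2 :=
    (Equiv.neg ℤ).tsum_eq fun n => wt r n * ‖coeffCLM n f‖ ^ 2
  rw [tsum_mul_left, Summable.tsum_add hf hneg, h2] at h1
  linarith

/-- The real part `H^r(S¹; ℂ) → H^r(S¹; ℝ)`. -/
def re : CSob r →L[ℝ] Sob r :=
  LinearMap.mkContinuous
    { toFun := fun f => ⟨reC (toC f), sobMem_cplx_iff.1 (sobMem_reC (sobMem f)).1⟩
      map_add' := fun f g => by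
        apply Sob.toC_injective
        ext x
        exact Complex.add_re _ _
      map_smul' := fun c f => by
        apply Sob.toC_injective
        ext x
        exact Complex.re_ofReal_mul _ _ } (√(prodConst r))⁻¹ fun f => by
    refine le_of_sq_le_sq ?_ (by positivity)
    rw [mul_pow, inv_pow, Real.sq_sqrt (prodConst_pos hr.out).le, Sob.norm_sq, norm_sq,
      inv_mul_cancel_left₀ (prodConst_pos hr.out).ne']
    exact (sobMem_reC (sobMem f)).2

lemma re_apply (f : CSob r) (x : S1) : re f x = (toC f x).re := rfl

end CSob

namespace Sob

lemma ext_apply {r : ℝ} {u v : Sob r} (h : ∀ x, u x = v x) : u = v :=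
  toC_injective (ContinuousMap.ext h)

variable {r : ℝ} [hr : Fact (1 / 2 < r)]

/-- Multiplication in `H^r(S¹; ℝ)`. -/
def mul : Sob r →L[ℝ] Sob r →L[ℝ] Sob r :=
  (ContinuousLinearMap.compL ℝ (Sob r) (CSob r) (Sob r) CSob.re).comp
    ((ContinuousLinearMap.mul ℝ (CSob r)).bilinearComp CSob.ofReal CSob.ofReal)

lemma mul_apply (u v : Sob r) (x : S1) : mul u v x = u x * v x := by
  change CSob.re (CSob.ofReal u * CSob.ofReal v) x = _
  rw [CSob.re_apply, map_mul, ContinuousMap.mul_apply, CSob.ofReal_apply, CSob.ofReal_apply,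
    ← Complex.ofReal_mul, Complex.ofReal_re]

/-- The reciprocal in `H^r(S¹; ℝ)`; it has no meaning for functions with zeros. -/
def inv (u : Sob r) : Sob r := CSob.re (Ring.inverse (CSob.ofReal u))

lemma isUnit_ofReal {u : Sob r} (hu : ∀ x, u x ≠ 0) : IsUnit (CSob.ofReal u) :=
  CSob.isUnit_of_ne_zero fun x => by
    rw [CSob.ofReal_apply]
    exact_mod_cast hu x

lemma inv_apply {u : Sob r} (hu : ∀ x, u x ≠ 0) (x : S1) : inv u x = (u x)⁻¹ := by
  have h := congrArg (fun f => CSob.toC f x) (Ring.mul_inverse_cancel _ (isUnit_ofReal hu))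
  simp only [map_mul, map_one, ContinuousMap.mul_apply, ContinuousMap.one_apply,
    CSob.ofReal_apply] at h
  rw [inv, CSob.re_apply, eq_inv_of_mul_eq_one_right h, ← Complex.ofReal_inv, Complex.ofReal_re]

lemma contDiffAt_inv {n : ℕ∞ω} {u : Sob r} (hu : ∀ x, u x ≠ 0) : ContDiffAt ℝ n inv u := by
  have h1 : ContDiffAt ℝ n Ring.inverse (CSob.ofReal u) := by
    have := contDiffAt_ringInverse ℝ (n := n) (isUnit_ofReal hu).unit
    exact this
  exact CSob.re.contDiff.contDiffAt.comp u (h1.comp u CSob.ofReal.contDiff.contDiffAt)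

end Sob

end TwoHS

namespace TwoHS

open AddCircle CSob

/-! ### Differentiation and integration of Sobolev functions -/

/-- The function on the circle induced by a continuous function of period one. -/
def periodicLift (f : ℝ → ℝ) (hf : Continuous f) (hp : Function.Periodic f 1) : C(S1, ℝ) :=
  ⟨hp.lift, continuous_coinduced_dom.2 hf⟩

lemma continuous_coe_comp (f : C(S1, ℝ)) : Continuous fun t : ℝ => f (t : S1) :=
  f.continuous.comp (AddCircle.continuous_mk' 1)

lemma periodic_coe_comp (f : C(S1, ℝ)) : Function.Periodic (fun t : ℝ => f (t : S1)) 1 := by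
  intro t
  have : ((t + 1 : ℝ) : S1) = (t : S1) := AddCircle.coe_add_period 1 t
  simp only [this]

lemma ext_coe {f g : C(S1, ℝ)} (h : ∀ t : ℝ, f (t : S1) = g (t : S1)) : f = g := by
  ext x
  induction x using QuotientAddGroup.induction_on with
  | H t => exact h t

lemma norm_coeffCLM_le (n : ℤ) (f : C(S1, ℂ)) : ‖coeffCLM n f‖ ≤ ‖f‖ := by
  have h := (coeffCLM n).le_of_opNorm_le (LinearMap.mkContinuous_norm_le _ zero_le_one _) f
  rwa [one_mul] at h

lemma coeffCLM_eq_integral (n : ℤ) (f : C(S1, ℂ)) :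
    coeffCLM n f = ∫ t in (0 : ℝ)..1, fourier (-n) (t : S1) * f (t : S1) := by
  rw [coeffCLM_apply, fourierCoeff_eq_intervalIntegral f n 0]
  simp

lemma coeffCLM_deriv {f f' : C(S1, ℝ)}
    (h : ∀ t : ℝ, HasDerivAt (fun y : ℝ => f (y : S1)) (f' (t : S1)) t) (n : ℤ) :
    coeffCLM n (cplx f') = 2 * Real.pi * Complex.I * n * coeffCLM n (cplx f) := by
  have h1 : ∀ t : ℝ, HasDerivAt (fun y : ℝ => (cplx f) (y : S1)) (cplx f' (t : S1)) t :=
    fun t => (h t).ofReal_comp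
  have h2 : ∀ t : ℝ, HasDerivAt (fun y : ℝ => (fourier (-n) (y : S1) : ℂ))
      (-2 * Real.pi * Complex.I * n * fourier (-n) (t : S1)) t := by
    intro t
    have := hasDerivAt_fourier_neg 1 n t
    simpa using this
  have hc : ∀ m : ℤ, Continuous fun t : ℝ => (fourier m (t : S1) : ℂ) := fun m =>
    (fourier m).continuous.comp (AddCircle.continuous_mk' 1)
  have hcf : ∀ g : C(S1, ℝ), Continuous fun t : ℝ => cplx g (t : S1) := fun g =>
    (cplx g).continuous.comp (AddCircle.continuous_mk' 1)
  have hd : ∀ t : ℝ, HasDerivAt (fun y : ℝ => (fourier (-n) (y : S1) : ℂ) * cplx f (y : S1))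
      (-2 * Real.pi * Complex.I * n * fourier (-n) (t : S1) * cplx f (t : S1) +
        fourier (-n) (t : S1) * cplx f' (t : S1)) t := fun t => (h2 t).mul (h1 t)
  have hint := intervalIntegral.integral_eq_sub_of_hasDerivAt (a := 0) (b := 1) (fun t _ => hd t)
    (by
      apply Continuous.intervalIntegrable
      have h3 := hc (-n)
      have h4 := hcf f
      have h5 := hcf f'
      fun_prop)
  have hone : ((1 : ℝ) : S1) = ((0 : ℝ) : S1) := by
    rw [AddCircle.coe_period, AddCircle.coe_zero]
  have hi1 : IntervalIntegrable (fun t : ℝ => -2 * Real.pi * Complex.I * n *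
      (fourier (-n) (t : S1) * cplx f (t : S1))) MeasureTheory.volume 0 1 :=
    (((hc (-n)).mul (hcf f)).const_mul _).intervalIntegrable _ _
  have hi2 : IntervalIntegrable (fun t : ℝ => (fourier (-n) (t : S1) : ℂ) * cplx f' (t : S1))
      MeasureTheory.volume 0 1 := ((hc (-n)).mul (hcf f')).intervalIntegrable _ _
  simp only [mul_assoc (-2 * Real.pi * Complex.I * n : ℂ)] at hint
  rw [hone, sub_self, intervalIntegral.integral_add hi1 hi2, intervalIntegral.integral_const_mul,
    ← coeffCLM_eq_integral, ← coeffCLM_eq_integral] at hint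
  linear_combination hint

lemma wt_sub_one (s : ℝ) (n : ℤ) : wt s n = wt (s - 1) n * (1 + (n : ℝ) ^ 2) := by
  rw [wt, wt, ← Real.rpow_add_one (by positivity), sub_add_cancel]

lemma norm_coeff_deriv_sq {f f' : C(S1, ℝ)}
    (h : ∀ t : ℝ, HasDerivAt (fun y : ℝ => f (y : S1)) (f' (t : S1)) t) (n : ℤ) :
    ‖coeffCLM n (cplx f')‖ ^ 2 = (2 * Real.pi) ^ 2 * (n : ℝ) ^ 2 * ‖coeffCLM n (cplx f)‖ ^ 2 := by
  rw [coeffCLM_deriv h]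
  simp only [norm_mul, Complex.norm_I, Complex.norm_real, Complex.norm_ofNat, Complex.norm_intCast,
    mul_pow, sq_abs, Real.norm_eq_abs]
  ring

/-- The derivative maps `H^s` to `H^{s-1}`. -/
lemma wt_deriv_le {f f' : C(S1, ℝ)} (s : ℝ)
    (h : ∀ t : ℝ, HasDerivAt (fun y : ℝ => f (y : S1)) (f' (t : S1)) t) (n : ℤ) :
    wt (s - 1) n * ‖coeffCLM n (cplx f')‖ ^ 2 ≤
      (2 * Real.pi) ^ 2 * (wt s n * ‖coeffCLM n (cplx f)‖ ^ 2) := by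
  rw [norm_coeff_deriv_sq h, wt_sub_one s]
  have h1 := wt_pos (s - 1) n
  have h2 : (n : ℝ) ^ 2 ≤ 1 + (n : ℝ) ^ 2 := by linarith
  have h3 : 0 ≤ wt (s - 1) n * ((2 * Real.pi) ^ 2 * ‖coeffCLM n (cplx f)‖ ^ 2) := by positivity
  nlinarith [mul_le_mul_of_nonneg_left h2 h3]

/-- A primitive gains one derivative, up to its mean. -/
lemma wt_le_deriv {f f' : C(S1, ℝ)} (s : ℝ)
    (h : ∀ t : ℝ, HasDerivAt (fun y : ℝ => f (y : S1)) (f' (t : S1)) t) {n : ℤ} (hn : n ≠ 0) :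
    wt s n * ‖coeffCLM n (cplx f)‖ ^ 2 ≤ wt (s - 1) n * ‖coeffCLM n (cplx f')‖ ^ 2 := by
  rw [norm_coeff_deriv_sq h, wt_sub_one]
  have h1 := wt_pos (s - 1) n
  have hn1 : (1 : ℝ) ≤ (n : ℝ) ^ 2 := by
    have : (1 : ℤ) ≤ n ^ 2 := by nlinarith [Int.one_le_abs hn, sq_abs n]
    exact_mod_cast this
  have h2 : 1 + (n : ℝ) ^ 2 ≤ (2 * Real.pi) ^ 2 * (n : ℝ) ^ 2 := by
    have h4 : 9 ≤ Real.pi ^ 2 := by nlinarith [Real.pi_gt_three]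
    nlinarith
  have h3 : 0 ≤ wt (s - 1) n * ‖coeffCLM n (cplx f)‖ ^ 2 := by positivity
  nlinarith [mul_le_mul_of_nonneg_left h2 h3]

namespace Sob

lemma ext_real {r : ℝ} {u v : Sob r} (h : ∀ t : ℝ, u (t : S1) = v (t : S1)) : u = v :=
  toC_injective (ext_coe h)

/-- The inclusion of `H^r`, `r > 1/2`, in the continuous functions. -/
def toCL {r : ℝ} (hr : 1 / 2 < r) : Sob r →L[ℝ] C(S1, ℝ) := ⟨toC, continuous_toC hr⟩

lemma exists_derivC {s : ℝ} (hs : 3 / 2 < s) (u : Sob s) : ∃ f' : C(S1, ℝ),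
    ∀ t : ℝ, HasDerivAt (fun y : ℝ => u (y : S1)) (f' (t : S1)) t := by
  obtain ⟨C, hC⟩ := exists_hasDerivAt hs
  obtain ⟨u', hc, hp, -, hd⟩ := hC u
  exact ⟨periodicLift u' hc hp, hd⟩

/-- The derivative of `u ∈ H^s` as a continuous function. -/
def derivC {s : ℝ} (hs : 3 / 2 < s) (u : Sob s) : C(S1, ℝ) := (exists_derivC hs u).choose

lemma hasDerivAt_derivC {s : ℝ} (hs : 3 / 2 < s) (u : Sob s) (t : ℝ) :
    HasDerivAt (fun y : ℝ => u (y : S1)) (derivC hs u (t : S1)) t :=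
  (exists_derivC hs u).choose_spec t

/-- The derivative `H^s → H^{s-1}`. -/
def diff {s : ℝ} (hs : 3 / 2 < s) : Sob s →L[ℝ] Sob (s - 1) :=
  LinearMap.mkContinuous
    { toFun := fun u => ⟨derivC hs u, sobMem_cplx_iff.1 (Summable.of_nonneg_of_le
        (fun n => mul_nonneg (wt_pos _ n).le (sq_nonneg _)) (wt_deriv_le s (hasDerivAt_derivC hs u))
        ((sobMem_cplx_iff.2 u.2).mul_left _))⟩
      map_add' := fun u v => by
        refine ext_real fun t => ?_
        refine (hasDerivAt_derivC hs (u + v) t).unique ?_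
        exact (hasDerivAt_derivC hs u t).add (hasDerivAt_derivC hs v t)
      map_smul' := fun c u => by
        refine ext_real fun t => ?_
        refine (hasDerivAt_derivC hs (c • u) t).unique ?_
        exact (hasDerivAt_derivC hs u t).const_mul c } (2 * Real.pi) fun u => by
    refine le_of_sq_le_sq ?_ (by positivity)
    rw [mul_pow (2 * Real.pi) ‖u‖, norm_sq, norm_sq, ← tsum_mul_left]
    have h := (sobMem_cplx_iff.2 u.2).mul_left ((2 * Real.pi) ^ 2)
    exact Summable.tsum_le_tsum (wt_deriv_le s (hasDerivAt_derivC hs u))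
      (Summable.of_nonneg_of_le (fun n => mul_nonneg (wt_pos _ n).le (sq_nonneg _))
        (wt_deriv_le s (hasDerivAt_derivC hs u)) h) h

lemma hasDerivAt_diff {s : ℝ} (hs : 3 / 2 < s) (u : Sob s) (t : ℝ) :
    HasDerivAt (fun y : ℝ => u (y : S1)) (diff hs u (t : S1)) t := hasDerivAt_derivC hs u t

/-- The integral over the circle. -/
def integralC : C(S1, ℝ) →L[ℝ] ℝ :=
  LinearMap.mkContinuous
    { toFun := fun f => ∫ t in (0 : ℝ)..1, f (t : S1)
      map_add' := fun f g => intervalIntegral.integral_add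
        ((continuous_coe_comp f).intervalIntegrable _ _)
        ((continuous_coe_comp g).intervalIntegrable _ _)
      map_smul' := fun c f => intervalIntegral.integral_const_mul c _ } 1 fun f => by
    have := intervalIntegral.norm_integral_le_of_norm_le_const (a := 0) (b := 1) (C := ‖f‖)
      (f := fun t : ℝ => f (t : S1)) fun t _ => f.norm_coe_le_norm _
    simpa using this

lemma integralC_apply (f : C(S1, ℝ)) : integralC f = ∫ t in (0 : ℝ)..1, f (t : S1) := rfl

/-- The periodic primitive, vanishing at zero, of `f` minus its mean. -/
def primC (f : C(S1, ℝ)) : C(S1, ℝ) :=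
  periodicLift (fun t => (∫ y in (0 : ℝ)..t, f (y : S1)) - t * integralC f)
    (by
      have := intervalIntegral.continuous_primitive (μ := MeasureTheory.volume)
        (fun a b => (continuous_coe_comp f).intervalIntegrable a b) 0
      fun_prop)
    (fun t => by
      have h1 := (periodic_coe_comp f).intervalIntegral_add_eq t 0
      have h2 := intervalIntegral.integral_add_adjacent_intervals (μ := MeasureTheory.volume)
        ((continuous_coe_comp f).intervalIntegrable 0 t)
        ((continuous_coe_comp f).intervalIntegrable t (t + 1))
      rw [zero_add] at h1
      simp only [← h2, h1, integralC_apply]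
      ring)

lemma primC_coe (f : C(S1, ℝ)) (t : ℝ) :
    primC f (t : S1) = (∫ y in (0 : ℝ)..t, f (y : S1)) - t * integralC f := rfl

lemma hasDerivAt_primC (f : C(S1, ℝ)) (t : ℝ) : HasDerivAt (fun y : ℝ => primC f (y : S1))
    ((f - ContinuousMap.const S1 (integralC f)) (t : S1)) t := by
  have h1 := (continuous_coe_comp f).integral_hasStrictDerivAt 0 t
  have h2 := h1.hasDerivAt.sub ((hasDerivAt_id' t).mul_const (integralC f))
  rw [one_mul] at h2
  exact h2

lemma primC_zero (f : C(S1, ℝ)) : primC f (0 : S1) = 0 := by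
  have := primC_coe f 0
  simpa using this

lemma norm_integralC_le (f : C(S1, ℝ)) : |integralC f| ≤ ‖f‖ := by
  have := intervalIntegral.norm_integral_le_of_norm_le_const (a := 0) (b := 1) (C := ‖f‖)
    (f := fun t : ℝ => f (t : S1)) fun t _ => f.norm_coe_le_norm _
  rwa [sub_zero, abs_one, mul_one] at this

lemma norm_primC_le (f : C(S1, ℝ)) : ‖primC f‖ ≤ 2 * ‖f‖ := by
  refine (ContinuousMap.norm_le _ (by positivity)).2 fun x => ?_
  induction x using QuotientAddGroup.induction_on with
  | H t =>
    obtain ⟨y, hy, hty⟩ := (periodic_coe_comp (primC f)).exists_mem_Ico₀ one_pos t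
    refine (congrArg norm hty).trans_le ?_
    change ‖primC f (y : S1)‖ ≤ _
    rw [primC_coe]
    have h1 := intervalIntegral.norm_integral_le_of_norm_le_const (a := 0) (b := y) (C := ‖f‖)
      (f := fun t : ℝ => f (t : S1)) fun t _ => f.norm_coe_le_norm _
    rw [sub_zero, abs_of_nonneg hy.1] at h1
    have h2 : ‖y * integralC f‖ ≤ ‖f‖ := by
      rw [norm_mul, Real.norm_eq_abs, Real.norm_eq_abs, abs_of_nonneg hy.1]
      nlinarith [norm_integralC_le f, hy.1, hy.2, norm_nonneg f, abs_nonneg (integralC f)]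
    refine (norm_sub_le _ _).trans ?_
    nlinarith [hy.2, norm_nonneg f]

lemma coeffCLM_const {n : ℤ} (hn : n ≠ 0) (c : ℝ) :
    coeffCLM n (cplx (ContinuousMap.const S1 c)) = 0 := by
  have h : cplx (ContinuousMap.const S1 c) = (c : ℂ) • (fourier 0 : C(S1, ℂ)) := by
    ext x
    simp [cplx]
  rw [h, map_smul, coeffCLM_fourier, if_neg hn, smul_zero]

lemma cplx_sub (f g : C(S1, ℝ)) : cplx (f - g) = cplx f - cplx g := by
  ext x
  exact Complex.ofReal_sub _ _

lemma norm_cplx (f : C(S1, ℝ)) : ‖cplx f‖ = ‖f‖ := by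
  refine le_antisymm ((ContinuousMap.norm_le _ (norm_nonneg _)).2 fun x => ?_)
    ((ContinuousMap.norm_le _ (norm_nonneg _)).2 fun x => ?_)
  · exact (Complex.norm_real _).trans_le (f.norm_coe_le_norm x)
  · exact (Complex.norm_real _).symm.trans_le ((cplx f).norm_coe_le_norm x)

lemma wt_primC_le (s : ℝ) (f : C(S1, ℝ)) (n : ℤ) :
    wt s n * ‖coeffCLM n (cplx (primC f))‖ ^ 2 ≤
      wt (s - 1) n * ‖coeffCLM n (cplx f)‖ ^ 2 + if n = 0 then (2 * ‖f‖) ^ 2 else 0 := by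
  by_cases hn : n = 0
  · subst hn
    rw [if_pos rfl]
    have h0 : wt s 0 = 1 := by simp [wt]
    have h1 : 0 ≤ wt (s - 1) 0 * ‖coeffCLM 0 (cplx f)‖ ^ 2 :=
      mul_nonneg (wt_pos _ _).le (sq_nonneg _)
    have h2 : ‖coeffCLM 0 (cplx (primC f))‖ ≤ 2 * ‖f‖ := by
      refine (norm_coeffCLM_le 0 _).trans ?_
      rw [norm_cplx]
      exact norm_primC_le f
    have h3 := pow_le_pow_left₀ (norm_nonneg _) h2 2
    rw [h0, one_mul]
    linarith
  · have h1 := wt_le_deriv s (hasDerivAt_primC f) hn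
    rw [cplx_sub, map_sub, coeffCLM_const hn, sub_zero] at h1
    rw [if_neg hn, add_zero]
    exact h1

lemma summable_primC {s : ℝ} {f : C(S1, ℝ)} (hf : f ∈ sobolevSubmodule (s - 1)) :
    SobMem s (cplx (primC f)) ∧ ∑' n, wt s n * ‖coeffCLM n (cplx (primC f))‖ ^ 2 ≤
      ∑' n, wt (s - 1) n * ‖coeffCLM n (cplx f)‖ ^ 2 + (2 * ‖f‖) ^ 2 := by
  have h1 : SobMem (s - 1) (cplx f) := sobMem_cplx_iff.2 hf
  have h2 := hasSum_ite_eq (0 : ℤ) ((2 * ‖f‖) ^ 2)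
  have h3 := Summable.add h1 h2.summable
  have h4 : SobMem s (cplx (primC f)) := Summable.of_nonneg_of_le
    (fun n => mul_nonneg (wt_pos _ n).le (sq_nonneg _)) (wt_primC_le s f) h3
  refine ⟨h4, ?_⟩
  have h5 := Summable.tsum_le_tsum (wt_primC_le s f) h4 h3
  rwa [Summable.tsum_add h1 h2.summable, h2.tsum_eq] at h5

lemma primC_add (f g : C(S1, ℝ)) : primC (f + g) = primC f + primC g := by
  refine ext_coe fun t => ?_
  rw [ContinuousMap.add_apply, primC_coe, primC_coe, primC_coe, map_add]
  have h := intervalIntegral.integral_add (μ := MeasureTheory.volume)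
    ((continuous_coe_comp f).intervalIntegrable 0 t)
    ((continuous_coe_comp g).intervalIntegrable 0 t)
  simp only [ContinuousMap.add_apply]
  rw [h]
  ring

lemma primC_smul (c : ℝ) (f : C(S1, ℝ)) : primC (c • f) = c • primC f := by
  refine ext_coe fun t => ?_
  rw [ContinuousMap.smul_apply, primC_coe, primC_coe, map_smul]
  simp only [ContinuousMap.smul_apply, smul_eq_mul]
  rw [intervalIntegral.integral_const_mul]
  ring

/-- The primitive of `v ∈ H^{s-1}` minus its mean, as an element of `H^s`. -/
def primSob {s : ℝ} (v : Sob (s - 1)) : Sob s :=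
  ⟨primC (toC v), sobMem_cplx_iff.1 (summable_primC v.2).1⟩

lemma norm_primSob_sq_le {s : ℝ} (v : Sob (s - 1)) :
    ‖primSob v‖ ^ 2 ≤ ‖v‖ ^ 2 + (2 * ‖toC v‖) ^ 2 := by
  rw [norm_sq (primSob v), norm_sq v]
  exact (summable_primC v.2).2

/-- The continuous primitive `H^{s-1} → H₀^s` of a function minus its mean. -/
def prim {s : ℝ} (hs : 3 / 2 < s) : Sob (s - 1) →L[ℝ] Sob0 s :=
  LinearMap.mkContinuous
    { toFun := fun v => ⟨primSob v, primC_zero _⟩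
      map_add' := fun u v => by
        apply Subtype.ext
        apply toC_injective
        exact (congrArg primC (map_add toC u v)).trans (primC_add _ _)
      map_smul' := fun c u => by
        apply Subtype.ext
        apply toC_injective
        exact (congrArg primC (map_smul toC c u)).trans (primC_smul _ _) }
    (1 + 2 * ‖toCL (r := s - 1) (by linarith)‖) fun v => by
    refine le_of_sq_le_sq ?_ (by positivity)
    have h2 := (toCL (r := s - 1) (by linarith)).le_opNorm v
    refine (norm_primSob_sq_le v).trans ?_
    have h4 : ‖toC v‖ ≤ ‖toCL (r := s - 1) (by linarith)‖ * ‖v‖ := h2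
    have h5 := pow_le_pow_left₀ (by positivity) (mul_le_mul_of_nonneg_left h4 zero_le_two) 2
    nlinarith [norm_nonneg v, norm_nonneg (toCL (r := s - 1) (by linarith)),
      mul_nonneg (norm_nonneg (toCL (r := s - 1) (by linarith))) (sq_nonneg ‖v‖)]

/-- The mean of a Sobolev function. -/
def mean {r : ℝ} (hr : 1 / 2 < r) : Sob r →L[ℝ] ℝ := integralC.comp (toCL hr)

lemma mean_apply {r : ℝ} (hr : 1 / 2 < r) (v : Sob r) :
    mean hr v = ∫ t in (0 : ℝ)..1, v (t : S1) := rfl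

lemma diff_prim {s : ℝ} (hs : 3 / 2 < s) (v : Sob (s - 1)) (t : ℝ) :
    diff hs (prim hs v).1 (t : S1) = v (t : S1) - mean (by linarith) v :=
  (hasDerivAt_diff hs (prim hs v).1 t).unique (hasDerivAt_primC (toC v) t)

/-- A function of class `H^s` that vanishes at zero is determined by its derivative. -/
lemma sob0_ext {s : ℝ} (hs : 3 / 2 < s) {u v : Sob0 s}
    (h : ∀ t : ℝ, diff hs u.1 (t : S1) = diff hs v.1 (t : S1)) : u = v := by
  apply Subtype.ext
  refine ext_real fun t => ?_
  have hd : ∀ y : ℝ, HasDerivAt (fun y : ℝ => u.1 (y : S1) - v.1 (y : S1)) 0 y := fun y => by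
    have := (hasDerivAt_diff hs u.1 y).sub (hasDerivAt_diff hs v.1 y)
    rwa [h, sub_self] at this
  have hc := is_const_of_deriv_eq_zero (fun y => (hd y).differentiableAt)
    (fun y => (hd y).deriv) t 0
  have hu : u.1 ((0 : ℝ) : S1) = 0 := u.2
  have hv : v.1 ((0 : ℝ) : S1) = 0 := v.2
  simp only [hu, hv] at hc
  linarith

lemma mean_diff {s : ℝ} (hs : 3 / 2 < s) (u : Sob s) :
    mean (by linarith) (diff hs u) = 0 := by
  have h := intervalIntegral.integral_eq_sub_of_hasDerivAt (a := 0) (b := 1)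
    (fun t _ => hasDerivAt_diff hs u t)
    ((continuous_coe_comp (toC (diff hs u))).intervalIntegrable _ _)
  have hone : ((1 : ℝ) : S1) = ((0 : ℝ) : S1) := by
    rw [AddCircle.coe_period, AddCircle.coe_zero]
  rw [mean_apply, h, hone, sub_self]

end Sob

end TwoHS

namespace TwoHS

/-! ### The metric and the Christoffel map on the model space -/

/-- Composition of a bilinear map `X × X → A` with a linear map `A → F`, linear in both. -/
def postBilin (X A F : Type*) [NormedAddCommGroup X] [NormedSpace ℝ X] [NormedAddCommGroup A]
    [NormedSpace ℝ A] [NormedAddCommGroup F] [NormedSpace ℝ F] :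
    (A →L[ℝ] F) →L[ℝ] (X →L[ℝ] X →L[ℝ] A) →L[ℝ] (X →L[ℝ] X →L[ℝ] F) :=
  (ContinuousLinearMap.compL ℝ X (X →L[ℝ] A) (X →L[ℝ] F)).comp
    (ContinuousLinearMap.compL ℝ X A F)

lemma contDiffAt_clm_comp {E F G : Type*} [NormedAddCommGroup E] [NormedSpace ℝ E]
    [NormedAddCommGroup F] [NormedSpace ℝ F] [NormedAddCommGroup G] [NormedSpace ℝ G]
    (L : F →L[ℝ] G) {f : E → F} {v : E} (hf : ContDiffAt ℝ ∞ f v) :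
    ContDiffAt ℝ ∞ (fun w => L (f w)) v := L.contDiff.contDiffAt.comp v hf

lemma contDiffAt_clm_comp₂ {E F F' G : Type*} [NormedAddCommGroup E] [NormedSpace ℝ E]
    [NormedAddCommGroup F] [NormedSpace ℝ F] [NormedAddCommGroup F'] [NormedSpace ℝ F']
    [NormedAddCommGroup G] [NormedSpace ℝ G] (B : F →L[ℝ] F' →L[ℝ] G) {f : E → F} {g : E → F'}
    {v : E} (hf : ContDiffAt ℝ ∞ f v) (hg : ContDiffAt ℝ ∞ g v) :
    ContDiffAt ℝ ∞ (fun w => B (f w) (g w)) v := (contDiffAt_clm_comp B hf).clm_apply hg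

lemma hasFDerivAt_clm_comp {E F G : Type*} [NormedAddCommGroup E] [NormedSpace ℝ E]
    [NormedAddCommGroup F] [NormedSpace ℝ F] [NormedAddCommGroup G] [NormedSpace ℝ G]
    (L : F →L[ℝ] G) {f : E → F} {f' : E →L[ℝ] F} {v : E} (hf : HasFDerivAt f f' v) :
    HasFDerivAt (fun w => L (f w)) (L.comp f') v := L.hasFDerivAt.comp v hf

/-- The operations on tangent vectors on which the geometry of `G^s` depends: `A` is an algebra of
functions on `ι` with the mean value `mean`, and a tangent vector `U = (u, μ)` in `X` is the same
thing as the pair of its derivative `u_x = velDeriv U`, of mean zero, and `μ = angVel U`. The model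
space of `G^s` is the case of interest; the computations below use no other property of it. -/
structure TangentData (ι X A : Type*) [NormedAddCommGroup X] [NormedSpace ℝ X]
    [NormedAddCommGroup A] [NormedSpace ℝ A] where
  /-- the evaluation of the functions in `A` -/
  ev : ι → A →ₗ[ℝ] ℝ
  ext : ∀ {a b : A}, (∀ x, ev x a = ev x b) → a = b
  /-- the pointwise multiplication -/
  mul : A →L[ℝ] A →L[ℝ] A
  ev_mul : ∀ x a b, ev x (mul a b) = ev x a * ev x b
  /-- the constant function one -/
  one : A
  ev_one : ∀ x, ev x one = 1
  /-- the reciprocal of a positive function -/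
  inv : A → A
  ev_inv : ∀ {a}, (∀ x, 0 < ev x a) → ∀ x, ev x (inv a) = (ev x a)⁻¹
  contDiffAt_inv : ∀ {a}, (∀ x, 0 < ev x a) → ContDiffAt ℝ ∞ inv a
  /-- the mean value -/
  mean : A →L[ℝ] ℝ
  mean_one : mean one = 1
  mean_pos : ∀ {a}, (∀ x, 0 ≤ ev x a) → a ≠ 0 → 0 < mean a
  /-- the derivative of the first component -/
  velDeriv : X →L[ℝ] A
  /-- the second component -/
  angVel : X →L[ℝ] A
  mean_velDeriv : ∀ U, mean (velDeriv U) = 0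
  vec_ext : ∀ {U V}, velDeriv U = velDeriv V → angVel U = angVel V → U = V
  /-- the vector whose first component is the primitive of a function minus its mean -/
  primInl : A →L[ℝ] X
  /-- the vector with the given second component and first component zero -/
  angInr : A →L[ℝ] X
  velDeriv_primInl : ∀ {a}, mean a = 0 → velDeriv (primInl a) = a
  angVel_primInl : ∀ a, angVel (primInl a) = 0
  velDeriv_angInr : ∀ a, velDeriv (angInr a) = 0
  angVel_angInr : ∀ a, angVel (angInr a) = a
  isOpen_pos : IsOpen {v : X | ∀ x, 0 < ev x (one + velDeriv v)}

namespace TangentData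

variable {ι X A : Type*} [NormedAddCommGroup X] [NormedSpace ℝ X]
    [NormedAddCommGroup A] [NormedSpace ℝ A] (S : TangentData ι X A)

/-- The Jacobian `φ_x = 1 + h_x` of `φ = id + h`. -/
def jac (v : X) : A := S.one + S.velDeriv v

/-- The reciprocal of the Jacobian. -/
def invJac (v : X) : A := S.inv (S.jac v)

/-- The trilinear map `(σ, U, V) ↦ σ a(U) b(V)`. -/
def triple (a b : X →L[ℝ] A) :
    A →L[ℝ] X →L[ℝ] X →L[ℝ] A :=
  (ContinuousLinearMap.flipₗᵢ ℝ (A →L[ℝ] A) (X →L[ℝ] X →L[ℝ] A) (X →L[ℝ] X →L[ℝ] A)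
    (postBilin X A A) (S.mul.bilinearComp a b)).comp S.mul

lemma triple_apply (a b : X →L[ℝ] A) (σ : A) (U V : X) :
    S.triple a b σ U V = S.mul σ (S.mul (a U) (b V)) := rfl

lemma triple_coe (a b : X →L[ℝ] A) (σ : A) (U V : X) (x : ι) :
    S.ev x (S.triple a b σ U V) = S.ev x σ * (S.ev x (a U) * S.ev x (b V)) := by
  rw [S.triple_apply, S.ev_mul, S.ev_mul]

/-- The form `((ρ, σ), U, V) ↦ σ u_x v_x + ρ μ ν`, which is four times the integrand of the metric
when `ρ` is the Jacobian and `σ` its reciprocal. -/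
def energyDensity : (A × A) →L[ℝ] X →L[ℝ] X →L[ℝ] A :=
  (S.triple S.velDeriv S.velDeriv).comp (ContinuousLinearMap.snd ℝ _ _) +
    (S.triple S.angVel S.angVel).comp (ContinuousLinearMap.fst ℝ _ _)

/-- The pair formed by the Jacobian and its reciprocal, on which the geometry depends. -/
def jacPair (v : X) : A × A := (S.jac v, S.invJac v)

/-- The form `((ρ, σ), U, V) ↦ ¼ ∫ (σ u_x v_x + ρ μ ν)`, linear in the pair `(ρ, σ)`. -/
def metricOf : (A × A) →L[ℝ] X →L[ℝ] X →L[ℝ] ℝ :=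
  (postBilin X A ℝ ((1 / 4 : ℝ) • S.mean)).comp S.energyDensity

lemma metricOf_apply (p : A × A) (U V : X) :
    S.metricOf p U V = 1 / 4 * S.mean (S.mul p.2 (S.mul (S.velDeriv U) (S.velDeriv V)) +
      S.mul p.1 (S.mul (S.angVel U) (S.angVel V))) := rfl

/-- The form `((ρ, σ), U, V) ↦ - (σ u_x v_x + ρ μ ν) / 2`, the part of the derivative of the first
component of the Christoffel map that is linear in the Jacobian and its reciprocal. -/
def chrisVel : (A × A) →L[ℝ] X →L[ℝ] X →L[ℝ] A :=
  (-1 / 2 : ℝ) • S.energyDensity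

/-- The form `((ρ, σ), U, V) ↦ σ (u_x ν + μ v_x) / 2`, the second component of the Christoffel
map. -/
def chrisAng : (A × A) →L[ℝ] X →L[ℝ] X →L[ℝ] A :=
  (1 / 2 : ℝ) • ((S.triple S.velDeriv S.angVel + S.triple S.angVel S.velDeriv).comp
    (ContinuousLinearMap.snd ℝ _ _))

/-- The part of the Christoffel map that is linear in the Jacobian and its reciprocal. -/
def chrisLin : (A × A) →L[ℝ] X →L[ℝ] X →L[ℝ] X :=
  (postBilin X A X S.primInl).comp S.chrisVel +
    (postBilin X A X S.angInr).comp S.chrisAng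

/-- The form `(g, ρ) ↦ ((U, V) ↦ (z, 0))`, where `z` is the primitive of `2 g(U, V) ρ` minus its
mean; with the metric for `g` it is the remaining part of the Christoffel map. -/
def chrisQuad : (X →L[ℝ] X →L[ℝ] ℝ) →L[ℝ] A →L[ℝ]
    X →L[ℝ] X →L[ℝ] X :=
  ContinuousLinearMap.flipₗᵢ ℝ A (X →L[ℝ] X →L[ℝ] ℝ) (X →L[ℝ] X →L[ℝ] X)
    ((postBilin X ℝ X).comp ((2 : ℝ) • (ContinuousLinearMap.compL ℝ ℝ A X S.primInl).comp
      (ContinuousLinearMap.lsmul ℝ ℝ).flip))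

/-- The metric `¼ ∫ (u_x v_x / ρ + ρ μ ν)` at the point with coordinates `v`. -/
def metricMap (v : X) : X →L[ℝ] X →L[ℝ] ℝ := S.metricOf (S.jacPair v)

/-- The Christoffel map at the point with coordinates `v`: its components `(z, ζ)` are given by
`z_x = - (u_x v_x / ρ + ρ μ ν) / 2 + 2 G(U, V) ρ` and `ζ = (u_x ν + μ v_x) / (2 ρ)`. -/
def chrisMap (v : X) : X →L[ℝ] X →L[ℝ] X :=
  S.chrisLin (S.jacPair v) + S.chrisQuad (S.metricMap v) (S.jac v)

lemma chrisMap_apply (v U V : X) : S.chrisMap v U V =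
    S.primInl (S.chrisVel (S.jacPair v) U V + (2 * S.metricMap v U V) • S.jac v) +
      S.angInr (S.chrisAng (S.jacPair v) U V) := by
  change S.primInl (S.chrisVel (S.jacPair v) U V) + S.angInr (S.chrisAng (S.jacPair v) U V) +
    (2 : ℝ) • S.primInl (S.metricMap v U V • S.jac v) = _
  rw [map_add, mul_smul, map_smul S.primInl (2 : ℝ)]
  abel

lemma mean_jac (v : X) : S.mean (S.jac v) = 1 := by
  rw [jac, map_add, S.mean_velDeriv, S.mean_one, add_zero]

lemma chrisVel_coe (p : A × A) (U V : X) (x : ι) :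
    S.ev x (S.chrisVel p U V) =
      -1 / 2 * (S.ev x p.2 * (S.ev x (S.velDeriv U) * S.ev x (S.velDeriv V)) +
      S.ev x p.1 * (S.ev x (S.angVel U) * S.ev x (S.angVel V))) := by
  have h : S.chrisVel p U V = (-1 / 2 : ℝ) •
    (S.triple S.velDeriv S.velDeriv p.2 U V + S.triple S.angVel S.angVel p.1 U V) := rfl
  rw [h, map_smul, map_add, S.triple_coe, S.triple_coe, smul_eq_mul]

lemma chrisAng_coe (p : A × A) (U V : X) (x : ι) :
    S.ev x (S.chrisAng p U V) =
      1 / 2 * (S.ev x p.2 * (S.ev x (S.velDeriv U) * S.ev x (S.angVel V)) +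
      S.ev x p.2 * (S.ev x (S.angVel U) * S.ev x (S.velDeriv V))) := by
  have h : S.chrisAng p U V = (1 / 2 : ℝ) •
    (S.triple S.velDeriv S.angVel p.2 U V + S.triple S.angVel S.velDeriv p.2 U V) := rfl
  rw [h, map_smul, map_add, S.triple_coe, S.triple_coe, smul_eq_mul]

lemma mean_chrisVel (p : A × A) (U V : X) :
    S.mean (S.chrisVel p U V) = -2 * S.metricOf p U V := by
  have h : S.chrisVel p U V = (-1 / 2 : ℝ) • (S.mul p.2 (S.mul (S.velDeriv U) (S.velDeriv V)) +
      S.mul p.1 (S.mul (S.angVel U) (S.angVel V))) := rfl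
  rw [S.metricOf_apply, h, map_smul, smul_eq_mul]
  ring

/-- No mean has to be subtracted in the first component of the Christoffel map: the mean of its
linear part is `-2 G(U, V)`, and the Jacobian has mean one. -/
lemma velDeriv_chrisMap (v U V : X) : S.velDeriv (S.chrisMap v U V) =
    S.chrisVel (S.jacPair v) U V + (2 * S.metricMap v U V) • S.jac v := by
  rw [S.chrisMap_apply, map_add, S.velDeriv_angInr, add_zero, S.velDeriv_primInl]
  rw [map_add, S.mean_chrisVel, map_smul, S.mean_jac, smul_eq_mul, metricMap]
  ring

lemma angVel_chrisMap (v U V : X) : S.angVel (S.chrisMap v U V) =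
    S.chrisAng (S.jacPair v) U V := by
  rw [S.chrisMap_apply, map_add, S.angVel_primInl, S.angVel_angInr, zero_add]

/-! ### Derivatives of the metric and of the Christoffel map -/

/-- The points `v` where `id + h` is a diffeomorphism. -/
def Positive (v : X) : Prop := ∀ x, 0 < S.ev x (S.jac v)

lemma invJac_coe {v : X} (hv : S.Positive v) (x : ι) : S.ev x (S.invJac v) = (S.ev x (S.jac v))⁻¹ :=
  S.ev_inv hv x

lemma eventually_positive {v : X} (hv : S.Positive v) : ∀ᶠ w in 𝓝 v, S.Positive w :=
  S.isOpen_pos.mem_nhds hv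

lemma contDiff_jac : ContDiff ℝ ∞ (S.jac : X → A) :=
  contDiff_const.add S.velDeriv.contDiff

lemma contDiffAt_invJac {v : X} (hv : S.Positive v) :
    ContDiffAt ℝ ∞ S.invJac v :=
  (S.contDiffAt_inv hv).comp v S.contDiff_jac.contDiffAt

lemma contDiffAt_jacPair {v : X} (hv : S.Positive v) :
    ContDiffAt ℝ ∞ S.jacPair v := S.contDiff_jac.contDiffAt.prodMk (S.contDiffAt_invJac hv)

lemma contDiffAt_metricMap {v : X} (hv : S.Positive v) : ContDiffAt ℝ ∞ S.metricMap v :=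
  contDiffAt_clm_comp (F := A × A) (G := X →L[ℝ] X →L[ℝ] ℝ) S.metricOf (S.contDiffAt_jacPair hv)

lemma contDiffAt_chrisMap {v : X} (hv : S.Positive v) : ContDiffAt ℝ ∞ S.chrisMap v := by
  have h1 : ContDiffAt ℝ ∞ (fun w => S.chrisLin (S.jacPair w)) v :=
    contDiffAt_clm_comp (F := A × A) (G := X →L[ℝ] X →L[ℝ] X) S.chrisLin (S.contDiffAt_jacPair hv)
  have h3 : ContDiffAt ℝ ∞ (fun w => S.chrisQuad (S.metricMap w) (S.jac w)) v :=
    contDiffAt_clm_comp₂ (F := X →L[ℝ] X →L[ℝ] ℝ) (F' := A) (G := X →L[ℝ] X →L[ℝ] X) S.chrisQuad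
      (S.contDiffAt_metricMap hv) S.contDiff_jac.contDiffAt
  exact ContDiffAt.add (F := X →L[ℝ] X →L[ℝ] X) h1 h3

lemma hasFDerivAt_jac (v : X) : HasFDerivAt S.jac S.velDeriv v :=
  S.velDeriv.hasFDerivAt.const_add _

/-- The derivative of the reciprocal Jacobian, from that of the product of the two, which is
constant near `v`. -/
lemma fderiv_invJac {v : X} (hv : S.Positive v) (k : X) (x : ι) :
    S.ev x (fderiv ℝ S.invJac v k) =
      -(S.ev x (S.invJac v) * S.ev x (S.invJac v) * S.ev x (S.velDeriv k)) := by
  have h1 : HasFDerivAt S.invJac (fderiv ℝ S.invJac v) v :=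
    ((S.contDiffAt_invJac hv).differentiableAt (by simp)).hasFDerivAt
  have h2 := S.mul.hasFDerivAt_of_bilinear h1 (S.hasFDerivAt_jac v)
  have h3 : (fun w : X => S.mul (S.invJac w) (S.jac w)) =ᶠ[𝓝 v] fun _ => S.one := by
    filter_upwards [S.eventually_positive hv] with w hw
    refine S.ext fun x => ?_
    rw [S.ev_mul, S.invJac_coe hw, S.ev_one, inv_mul_cancel₀ (hw x).ne']
  have h4 := (h3.hasFDerivAt_iff.1 h2).unique (hasFDerivAt_const _ _)
  have h5 := congrArg (fun L : X →L[ℝ] A => S.ev x (L k)) h4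
  have h6 : S.ev x (S.invJac v) * S.ev x (S.velDeriv k) +
      S.ev x (fderiv ℝ S.invJac v k) * S.ev x (S.jac v) = 0 := by
    rw [← S.ev_mul, ← S.ev_mul, ← map_add]
    exact h5.trans (map_zero (S.ev x))
  have h7 : S.ev x (S.invJac v) * S.ev x (S.jac v) = 1 := by
    rw [S.invJac_coe hv, inv_mul_cancel₀ (hv x).ne']
  linear_combination S.ev x (S.invJac v) * h6 - S.ev x (fderiv ℝ S.invJac v k) * h7

/-- The derivative of the pair of the Jacobian and its reciprocal. -/
def jacPairDer (v : X) : X →L[ℝ] A × A :=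
  S.velDeriv.prod (fderiv ℝ S.invJac v)

lemma hasFDerivAt_jacPair {v : X} (hv : S.Positive v) :
    HasFDerivAt S.jacPair (S.jacPairDer v) v :=
  (S.hasFDerivAt_jac v).prodMk
    ((S.contDiffAt_invJac hv).differentiableAt (by simp)).hasFDerivAt

lemma fderiv_metricMap {v : X} (hv : S.Positive v) (k : X) :
    fderiv ℝ S.metricMap v k = S.metricOf (S.jacPairDer v k) := by
  have h : HasFDerivAt S.metricMap (ContinuousLinearMap.comp S.metricOf (S.jacPairDer v)) v :=
    hasFDerivAt_clm_comp (F := A × A) (G := X →L[ℝ] X →L[ℝ] ℝ) S.metricOf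
      (S.hasFDerivAt_jacPair hv)
  rw [h.fderiv]
  rfl

lemma fderiv_chrisMap {v : X} (hv : S.Positive v) (k U V : X) :
    fderiv ℝ S.chrisMap v k U V =
      S.primInl (S.chrisVel (S.jacPairDer v k) U V + (2 * fderiv ℝ S.metricMap v k U V) • S.jac v +
        (2 * S.metricMap v U V) • S.velDeriv k) + S.angInr (S.chrisAng (S.jacPairDer v k) U V) := by
  have h1 : HasFDerivAt S.metricMap (fderiv ℝ S.metricMap v) v :=
    ((S.contDiffAt_metricMap hv).differentiableAt (by simp)).hasFDerivAt
  have h2 : HasFDerivAt (fun w => S.chrisQuad (S.metricMap w) (S.jac w)) _ v :=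
    ContinuousLinearMap.hasFDerivAt_of_bilinear (E := X →L[ℝ] X →L[ℝ] ℝ) (F := A)
      (G := X →L[ℝ] X →L[ℝ] X) S.chrisQuad h1 (S.hasFDerivAt_jac v)
  have h4 : HasFDerivAt (fun w => S.chrisLin (S.jacPair w)) _ v :=
    hasFDerivAt_clm_comp (F := A × A) (G := X →L[ℝ] X →L[ℝ] X) S.chrisLin
      (S.hasFDerivAt_jacPair hv)
  have h3 : HasFDerivAt S.chrisMap _ v := HasFDerivAt.add (F := X →L[ℝ] X →L[ℝ] X) h4 h2
  rw [h3.fderiv]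
  change S.primInl (S.chrisVel (S.jacPairDer v k) U V) +
      S.angInr (S.chrisAng (S.jacPairDer v k) U V) +
    ((2 : ℝ) • S.primInl (S.metricMap v U V • S.velDeriv k) +
      (2 : ℝ) • S.primInl (fderiv ℝ S.metricMap v k U V • S.jac v)) = _
  rw [map_add, map_add, mul_smul, mul_smul, map_smul S.primInl (2 : ℝ), map_smul S.primInl (2 : ℝ)]
  abel

lemma velDeriv_fderiv_chrisMap {v : X} (hv : S.Positive v) (k U V : X) :
    S.velDeriv (fderiv ℝ S.chrisMap v k U V) =
      S.chrisVel (S.jacPairDer v k) U V + (2 * fderiv ℝ S.metricMap v k U V) • S.jac v +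
        (2 * S.metricMap v U V) • S.velDeriv k := by
  rw [S.fderiv_chrisMap hv, map_add, S.velDeriv_angInr, add_zero, S.velDeriv_primInl]
  rw [map_add, map_add, S.mean_chrisVel, map_smul, map_smul, S.mean_jac, S.mean_velDeriv,
    smul_eq_mul, smul_zero, S.fderiv_metricMap hv]
  ring

lemma angVel_fderiv_chrisMap {v : X} (hv : S.Positive v) (k U V : X) :
    S.angVel (fderiv ℝ S.chrisMap v k U V) = S.chrisAng (S.jacPairDer v k) U V := by
  rw [S.fderiv_chrisMap hv, map_add, S.angVel_primInl, S.angVel_angInr, zero_add]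

/-! ### The structure equations -/

lemma metricMap_symm (v U V : X) : S.metricMap v U V = S.metricMap v V U := by
  rw [metricMap, S.metricOf_apply, S.metricOf_apply]
  congr 2
  refine S.ext fun x => ?_
  simp only [map_add, S.ev_mul]
  ring

lemma metricMap_pos {v : X} (hv : S.Positive v) {U : X} (hU : U ≠ 0) : 0 < S.metricMap v U U := by
  have hterm : ∀ x, 0 < S.ev x (S.invJac v) ∧ 0 < S.ev x (S.jac v) := fun x =>
    ⟨by rw [S.invJac_coe hv]; exact inv_pos.2 (hv x), hv x⟩
  have hev : ∀ x, S.ev x (S.mul (S.invJac v) (S.mul (S.velDeriv U) (S.velDeriv U)) +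
      S.mul (S.jac v) (S.mul (S.angVel U) (S.angVel U))) =
      S.ev x (S.invJac v) * (S.ev x (S.velDeriv U) * S.ev x (S.velDeriv U)) +
        S.ev x (S.jac v) * (S.ev x (S.angVel U) * S.ev x (S.angVel U)) := fun x => by
    rw [map_add, S.ev_mul, S.ev_mul, S.ev_mul, S.ev_mul]
  have hmean := S.mean_pos (a := S.mul (S.invJac v) (S.mul (S.velDeriv U) (S.velDeriv U)) +
      S.mul (S.jac v) (S.mul (S.angVel U) (S.angVel U))) (fun x => by
    rw [hev]
    exact add_nonneg (mul_nonneg (hterm x).1.le (mul_self_nonneg _))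
      (mul_nonneg (hterm x).2.le (mul_self_nonneg _))) fun h0 => by
    refine hU (S.vec_ext ?_ ?_)
    all_goals
      rw [map_zero]
      refine S.ext fun x => ?_
      have h1 := hev x
      have h2 := mul_nonneg (hterm x).1.le (mul_self_nonneg (S.ev x (S.velDeriv U)))
      have h3 := mul_nonneg (hterm x).2.le (mul_self_nonneg (S.ev x (S.angVel U)))
      rw [h0, map_zero] at h1
      rw [map_zero]
    · have h4 := (mul_eq_zero.1 (le_antisymm (by linarith) h2)).resolve_left (hterm x).1.ne'
      exact mul_self_eq_zero.1 h4
    · have h4 := (mul_eq_zero.1 (le_antisymm (by linarith) h3)).resolve_left (hterm x).2.ne'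
      exact mul_self_eq_zero.1 h4
  have h := S.metricOf_apply (S.jacPair v) U U
  rw [metricMap, h]
  exact mul_pos (by norm_num) hmean

lemma chrisMap_symm (v U V : X) : S.chrisMap v U V = S.chrisMap v V U := by
  refine S.vec_ext ?_ ?_
  · rw [S.velDeriv_chrisMap, S.velDeriv_chrisMap, S.metricMap_symm v U V]
    congr 1
    refine S.ext fun x => ?_
    rw [S.chrisVel_coe, S.chrisVel_coe]
    ring
  · rw [S.angVel_chrisMap, S.angVel_chrisMap]
    refine S.ext fun x => ?_
    rw [S.chrisAng_coe, S.chrisAng_coe]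
    ring

/-- The metric is parallel for the Christoffel map. -/
lemma fderiv_metricMap_eq {v : X} (hv : S.Positive v) (w U V : X) :
    fderiv ℝ S.metricMap v w U V =
      S.metricMap v (S.chrisMap v w U) V + S.metricMap v U (S.chrisMap v w V) := by
  -- The integrands of the two sides differ by multiples of `u_x` and `v_x`, which have mean zero.
  have key : S.mul (S.jacPairDer v w).2 (S.mul (S.velDeriv U) (S.velDeriv V)) +
      S.mul (S.jacPairDer v w).1 (S.mul (S.angVel U) (S.angVel V)) =
      (S.mul (S.jacPair v).2 (S.mul (S.velDeriv (S.chrisMap v w U)) (S.velDeriv V)) +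
        S.mul (S.jacPair v).1 (S.mul (S.angVel (S.chrisMap v w U)) (S.angVel V))) +
      (S.mul (S.jacPair v).2 (S.mul (S.velDeriv U) (S.velDeriv (S.chrisMap v w V))) +
        S.mul (S.jacPair v).1 (S.mul (S.angVel U) (S.angVel (S.chrisMap v w V)))) -
      (2 * S.metricMap v w U) • S.velDeriv V - (2 * S.metricMap v w V) • S.velDeriv U := by
    refine S.ext fun x => ?_
    have h1 : S.ev x (S.jacPairDer v w).2 =
        -(S.ev x (S.invJac v) * S.ev x (S.invJac v) * S.ev x (S.velDeriv w)) :=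
      S.fderiv_invJac hv w x
    have h2 : (S.jacPairDer v w).1 = S.velDeriv w := rfl
    have h3 : (S.jacPair v).1 = S.jac v := rfl
    have h4 : (S.jacPair v).2 = S.invJac v := rfl
    have h7 : S.ev x (S.invJac v) * S.ev x (S.jac v) = 1 := by
      rw [S.invJac_coe hv, inv_mul_cancel₀ (hv x).ne']
    simp only [map_add, map_sub, map_smul, add_apply, smul_apply, smul_eq_mul, S.ev_mul,
      S.velDeriv_chrisMap, S.angVel_chrisMap, S.chrisVel_coe, S.chrisAng_coe, h1, h2, h3, h4]
    linear_combination (-(S.ev x (S.velDeriv w) * S.ev x (S.angVel U) * S.ev x (S.angVel V)) -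
      2 * (S.metricMap v w U * S.ev x (S.velDeriv V) +
        S.metricMap v w V * S.ev x (S.velDeriv U))) * h7
  have h := congrArg S.mean key
  rw [map_sub, map_sub, map_smul, map_smul, S.mean_velDeriv, S.mean_velDeriv, map_add _ (_ + _),
    smul_zero, smul_zero, sub_zero, sub_zero] at h
  rw [S.fderiv_metricMap hv, S.metricOf_apply, h, metricMap, S.metricOf_apply, S.metricOf_apply]
  ring

/-- The curvature of the Christoffel map is that of a space of constant curvature S.one. -/
lemma curvature_chrisMap {v : X} (hv : S.Positive v) (U V W : X) :
    fderiv ℝ S.chrisMap v U V W - fderiv ℝ S.chrisMap v V U W +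
      S.chrisMap v U (S.chrisMap v V W) - S.chrisMap v V (S.chrisMap v U W) =
      (1 : ℝ) • (S.metricMap v V W • U - S.metricMap v U W • V) := by
  have h1 : ∀ (k : X) (x : ι),
      S.ev x (S.jacPairDer v k).2 =
        -(S.ev x (S.invJac v) * S.ev x (S.invJac v) * S.ev x (S.velDeriv k)) := S.fderiv_invJac hv
  have h2 : ∀ k : X, (S.jacPairDer v k).1 = S.velDeriv k := fun _ => rfl
  have h3 : (S.jacPair v).1 = S.jac v := rfl
  have h4 : (S.jacPair v).2 = S.invJac v := rfl
  have h7 : ∀ x, S.ev x (S.invJac v) * S.ev x (S.jac v) = 1 := fun x => by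
    rw [S.invJac_coe hv, inv_mul_cancel₀ (hv x).ne']
  -- The derivatives of the metric occur only in this combination, which vanishes.
  have hG : fderiv ℝ S.metricMap v U V W - fderiv ℝ S.metricMap v V U W +
      S.metricMap v U (S.chrisMap v V W) - S.metricMap v V (S.chrisMap v U W) = 0 := by
    rw [S.fderiv_metricMap_eq hv, S.fderiv_metricMap_eq hv, S.chrisMap_symm v V U]
    ring
  rw [one_smul]
  refine S.vec_ext (S.ext fun x => ?_) (S.ext fun x => ?_)
  · simp only [map_add, map_sub, map_smul, smul_eq_mul, S.velDeriv_fderiv_chrisMap hv,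
      S.velDeriv_chrisMap, S.angVel_chrisMap, S.chrisVel_coe, S.chrisAng_coe, h1, h2, h3, h4]
    linear_combination (1 / 2 * (S.ev x (S.velDeriv U) * S.ev x (S.angVel V) * S.ev x (S.angVel W) -
        S.ev x (S.velDeriv V) * S.ev x (S.angVel U) * S.ev x (S.angVel W)) -
      (S.metricMap v V W * S.ev x (S.velDeriv U) - S.metricMap v U W * S.ev x (S.velDeriv V))) *
        h7 x +
      2 * S.ev x (S.jac v) * hG
  · simp only [map_add, map_sub, map_smul, smul_eq_mul, S.angVel_fderiv_chrisMap hv,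
      S.velDeriv_chrisMap, S.angVel_chrisMap, S.chrisVel_coe, S.chrisAng_coe, h1, h3, h4]
    linear_combination (S.metricMap v V W * S.ev x (S.angVel U) -
      S.metricMap v U W * S.ev x (S.angVel V)) * h7 x

end TangentData

end TwoHS

namespace TranslationAtlas

open WeakRiemannian Bundle

/-! ### Manifolds whose charts differ by translations -/

variable {E : Type*} [NormedAddCommGroup E] {M : Type*} [TopologicalSpace M] [ChartedSpace E M]
  {F : Type*}

variable (E M) in
/-- The preferred charts of `M` differ locally by translations of the model space. -/
def HasTranslationAtlas : Prop :=
  ∀ x y z : M, z ∈ (chartAt E x).source → z ∈ (chartAt E y).source →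
    ∃ d : E, ∀ᶠ w in 𝓝 (chartAt E x z), chartAt E y ((chartAt E x).symm w) = w + d

/-- The function `f` read in the preferred chart at `x`. -/
def rep (x : M) (f : M → F) : E → F := f ∘ (chartAt E x).symm

lemma rep_apply_self (x : M) (f : M → F) : rep x f (chartAt E x x) = f x := by
  simp [rep]

lemma rep_apply_mem {x y : M} (hy : y ∈ (chartAt E x).source) (f : M → F) :
    rep x f (chartAt E x y) = f y := by
  simp [rep, hy]

variable [NormedSpace ℝ E] [NormedAddCommGroup F] [NormedSpace ℝ F]

/-- A vector field on `M` as a function with values in the model space. -/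
def fieldFun (X : ∀ x : M, TangentSpace 𝓘(ℝ, E) x) : M → E := fun x => X x

/-- A function with values in the model space as a vector field on `M`. -/
def toField (X : M → E) : ∀ x : M, TangentSpace 𝓘(ℝ, E) x := fun x => X x

/-- The derivative of `f : M → F` at `x` as a linear map on the model space. -/
def der (f : M → F) (x : M) : E →L[ℝ] F := mvfderiv 𝓘(ℝ, E) f x

/-- The covariant derivative of the vector field `Y : M → E` at `x` as a linear map on the model
space. -/
def covDer [IsManifold 𝓘(ℝ, E) 1 M]
    (cov : CovariantDerivative 𝓘(ℝ, E) E (TangentSpace 𝓘(ℝ, E) : M → Type _)) (Y : M → E) (x : M) :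
    E →L[ℝ] E := cov (toField Y) x

lemma mdifferentiableAt_iff [IsManifold 𝓘(ℝ, E) 1 M] {x y : M} (hy : y ∈ (chartAt E x).source)
    {f : M → F} :
    MDifferentiableAt 𝓘(ℝ, E) 𝓘(ℝ, F) f y ↔ DifferentiableAt ℝ (rep x f) (chartAt E x y) := by
  rw [mdifferentiableAt_iff_source_of_mem_source hy]
  simp [rep, mdifferentiableWithinAt_univ, mdifferentiableAt_iff_differentiableAt]

lemma contMDiffAt_iff {n : ℕ∞ω} [IsManifold 𝓘(ℝ, E) n M] {x y : M}
    (hy : y ∈ (chartAt E x).source) {f : M → F} :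
    ContMDiffAt 𝓘(ℝ, E) 𝓘(ℝ, F) n f y ↔ ContDiffAt ℝ n (rep x f) (chartAt E x y) := by
  rw [contMDiffAt_iff_source_of_mem_source hy]
  simp [rep, contMDiffWithinAt_univ, contMDiffAt_iff_contDiffAt]

lemma der_self [IsManifold 𝓘(ℝ, E) 1 M] (x : M) (f : M → F) :
    der f x = fderiv ℝ (rep x f) (chartAt E x x) := by
  by_cases h : MDifferentiableAt 𝓘(ℝ, E) 𝓘(ℝ, F) f x
  · rw [der, h.mvfderiv]
    simp [rep, writtenInExtChartAt]
    rfl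
  · rw [der, mvfderiv, mfderiv_zero_of_not_mdifferentiableAt h, fderiv_zero_of_not_differentiableAt]
    · simp; rfl
    · rwa [← mdifferentiableAt_iff (mem_chart_source E x)]

/-- The derivative does not depend on the chart used to compute it. -/
lemma der_eq [IsManifold 𝓘(ℝ, E) 1 M] (hT : HasTranslationAtlas E M) {x y : M}
    (hy : y ∈ (chartAt E x).source) (f : M → F) :
    der f y = fderiv ℝ (rep x f) (chartAt E x y) := by
  obtain ⟨d, hd⟩ := hT x y y hy (mem_chart_source E y)
  rw [der_self]
  have hd0 : chartAt E y y = chartAt E x y + d := by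
    have := hd.self_of_nhds
    rwa [(chartAt E x).left_inv hy] at this
  have h1 : rep x f =ᶠ[𝓝 (chartAt E x y)] fun w => rep y f (w + d) := by
    have hcont : ContinuousAt (chartAt E x).symm (chartAt E x y) :=
      (chartAt E x).continuousAt_symm ((chartAt E x).map_source hy)
    have : ∀ᶠ w in 𝓝 (chartAt E x y), (chartAt E x).symm w ∈ (chartAt E y).source := by
      apply hcont
      rw [(chartAt E x).left_inv hy]
      exact (chartAt E y).open_source.mem_nhds (mem_chart_source E y)
    filter_upwards [hd, this] with w hw hw'
    rw [← hw, rep_apply_mem hw', rep, Function.comp_apply]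
  rw [h1.fderiv_eq, fderiv_comp_add_right, hd0]


lemma coordChange_eq [IsManifold 𝓘(ℝ, E) 1 M] (hT : HasTranslationAtlas E M) {x y : M}
    (hy : y ∈ (chartAt E x).source) (v : E) :
    (tangentBundleCore 𝓘(ℝ, E) M).coordChange (achart E y) (achart E x) y v = v := by
  obtain ⟨d, hd⟩ := hT y x y (mem_chart_source E y) hy
  rw [tangentBundleCore_coordChange]
  have h : (fun w => chartAt E x ((chartAt E y).symm w)) =ᶠ[𝓝 (chartAt E y y)] fun w => w + d := hd
  have h2 := h.fderiv_eq (𝕜 := ℝ)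
  rw [fderiv_add_const, fderiv_fun_id] at h2
  have h3 := DFunLike.congr_fun h2 v
  simpa [Function.comp_def] using h3

/-- The preferred trivializations of the tangent bundle are all the identity, so that the tangent
bundle is the product of `M` and the model space. -/
lemma trivializationAt_apply [IsManifold 𝓘(ℝ, E) 1 M] (hT : HasTranslationAtlas E M) {x y : M}
    (hy : y ∈ (chartAt E x).source) (v : TangentSpace 𝓘(ℝ, E) y) :
    (trivializationAt E (TangentSpace 𝓘(ℝ, E)) x ⟨y, v⟩).2 = v := by
  exact coordChange_eq hT hy v

lemma diffFieldAt_iff [IsManifold 𝓘(ℝ, E) 1 M] (hT : HasTranslationAtlas E M) {x y : M}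
    (hy : y ∈ (chartAt E x).source) {X : ∀ x : M, TangentSpace 𝓘(ℝ, E) x} :
    DiffFieldAt 𝓘(ℝ, E) X y ↔ DifferentiableAt ℝ (rep x (fieldFun X)) (chartAt E x y) := by
  rw [← mdifferentiableAt_iff hy, DiffFieldAt, mdifferentiableAt_totalSpace]
  have h : (fun z => (trivializationAt E (TangentSpace 𝓘(ℝ, E)) y
      (⟨z, X z⟩ : TangentBundle 𝓘(ℝ, E) M)).2) =ᶠ[𝓝 y] fieldFun X := by
    filter_upwards [(chartAt E y).open_source.mem_nhds (mem_chart_source E y)] with z hz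
    exact trivializationAt_apply hT hz _
  constructor
  · rintro ⟨-, h2⟩
    exact h2.congr_of_eventuallyEq h.symm
  · intro h2
    exact ⟨mdifferentiableAt_id, h2.congr_of_eventuallyEq h⟩

lemma contMDiffAt_field_iff [IsManifold 𝓘(ℝ, E) ∞ M] (hT : HasTranslationAtlas E M)
    {y : M} {X : ∀ x : M, TangentSpace 𝓘(ℝ, E) x} :
    SmoothFieldAt 𝓘(ℝ, E) X y ↔ ContMDiffAt 𝓘(ℝ, E) 𝓘(ℝ, E) ∞ (fieldFun X) y := by
  rw [SmoothFieldAt, contMDiffAt_totalSpace]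
  have h : (fun z => (trivializationAt E (TangentSpace 𝓘(ℝ, E)) y
      (⟨z, X z⟩ : TangentBundle 𝓘(ℝ, E) M)).2) =ᶠ[𝓝 y] fieldFun X := by
    filter_upwards [(chartAt E y).open_source.mem_nhds (mem_chart_source E y)] with z hz
    exact trivializationAt_apply hT hz _
  constructor
  · rintro ⟨-, h2⟩
    exact h2.congr_of_eventuallyEq h.symm
  · intro h2
    exact ⟨contMDiffAt_id, h2.congr_of_eventuallyEq h⟩

lemma continuousLinearMapAt_eq [IsManifold 𝓘(ℝ, E) 1 M] (hT : HasTranslationAtlas E M) {x y : M}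
    (hy : y ∈ (chartAt E x).source) :
    (trivializationAt E (TangentSpace 𝓘(ℝ, E)) x).continuousLinearMapAt ℝ y =
      ContinuousLinearMap.id ℝ E := by
  rw [TangentBundle.continuousLinearMapAt_trivializationAt_eq_core hy]
  ext v
  exact coordChange_eq hT hy v

lemma symmL_eq [IsManifold 𝓘(ℝ, E) 1 M] (hT : HasTranslationAtlas E M) {x y : M}
    (hy : y ∈ (chartAt E x).source) :
    (trivializationAt E (TangentSpace 𝓘(ℝ, E)) x).symmL ℝ y =
      ContinuousLinearMap.id ℝ E := by
  have hb : y ∈ (trivializationAt E (TangentSpace 𝓘(ℝ, E)) x).baseSet := hy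
  ext v
  have h1 := (trivializationAt E (TangentSpace 𝓘(ℝ, E)) x).symmL_continuousLinearMapAt
    (R := ℝ) hb v
  rw [continuousLinearMapAt_eq hT hy] at h1
  exact h1

lemma contMDiff_endomorphism [IsManifold 𝓘(ℝ, E) ∞ M] (hT : HasTranslationAtlas E M)
    {A : M → E →L[ℝ] E} (hA : ContMDiff 𝓘(ℝ, E) 𝓘(ℝ, E →L[ℝ] E) ∞ A) :
    ContMDiff 𝓘(ℝ, E) (𝓘(ℝ, E).prod 𝓘(ℝ, E →L[ℝ] E)) ∞
      (fun x => TotalSpace.mk' (E →L[ℝ] E)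
        (E := fun x : M => TangentSpace 𝓘(ℝ, E) x →L[ℝ] TangentSpace 𝓘(ℝ, E) x) x (A x)) := by
  intro x
  rw [contMDiffAt_hom_bundle]
  refine ⟨contMDiffAt_id, (hA x).congr_of_eventuallyEq ?_⟩
  filter_upwards [(chartAt E x).open_source.mem_nhds (mem_chart_source E x)] with z hz
  simp only [ContinuousLinearMap.inCoordinates]
  rw [continuousLinearMapAt_eq hT hz, symmL_eq hT hz]
  rfl

lemma contMDiff_bilinear [IsManifold 𝓘(ℝ, E) ∞ M] (hT : HasTranslationAtlas E M)
    {A : M → E →L[ℝ] E →L[ℝ] ℝ} (hA : ContMDiff 𝓘(ℝ, E) 𝓘(ℝ, E →L[ℝ] E →L[ℝ] ℝ) ∞ A) :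
    ContMDiff 𝓘(ℝ, E) (𝓘(ℝ, E).prod 𝓘(ℝ, E →L[ℝ] E →L[ℝ] ℝ)) ∞
      (fun x => TotalSpace.mk' (E →L[ℝ] E →L[ℝ] ℝ)
        (E := fun x : M => TangentSpace 𝓘(ℝ, E) x →L[ℝ] TangentSpace 𝓘(ℝ, E) x →L[ℝ] ℝ)
        x (A x)) := by
  intro x
  rw [contMDiffAt_hom_bundle]
  refine ⟨contMDiffAt_id, (hA x).congr_of_eventuallyEq ?_⟩
  filter_upwards [(chartAt E x).open_source.mem_nhds (mem_chart_source E x)] with z hz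
  have hb : z ∈ (trivializationAt (E →L[ℝ] ℝ)
    (fun x : M => TangentSpace 𝓘(ℝ, E) x →L[ℝ] ℝ) x).baseSet := by
    refine ⟨hz, ?_⟩
    simp
  ext u v
  simp only [ContinuousLinearMap.inCoordinates]
  rw [symmL_eq hT hz]
  simp only [ContinuousLinearMap.comp_apply]
  have h := (Trivialization.continuousLinearMapAt_apply_of_mem ℝ
    (trivializationAt (E →L[ℝ] ℝ) (fun x : M => TangentSpace 𝓘(ℝ, E) x →L[ℝ] ℝ) x) hb (A z u))
  rw [hom_trivializationAt_apply] at h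
  have h2 := DFunLike.congr_fun h v
  refine h2.trans ?_
  simp only [ContinuousLinearMap.inCoordinates]
  rw [symmL_eq hT hz]
  exact Trivialization.continuousLinearMapAt_apply_of_mem ℝ
    (trivializationAt ℝ (Bundle.Trivial M ℝ) x) (Set.mem_univ z) (A z u v)

lemma mfderiv_chartAt_symm [IsManifold 𝓘(ℝ, E) 1 M] (hT : HasTranslationAtlas E M) (x : M) {w : E}
    (hw : w ∈ (chartAt E x).target) :
    mfderiv 𝓘(ℝ, E) 𝓘(ℝ, E) (chartAt E x).symm w = ContinuousLinearMap.id ℝ E := by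
  set y : M := (chartAt E x).symm w with hy
  have hys : y ∈ (chartAt E x).source := (chartAt E x).map_target hw
  have hyw : chartAt E x y = w := (chartAt E x).right_inv hw
  obtain ⟨d, hd⟩ := hT x y y hys (mem_chart_source E y)
  rw [hyw] at hd
  have h : (fun w => chartAt E y ((chartAt E x).symm w)) =ᶠ[𝓝 w] fun w => w + d := hd
  have hm : MDifferentiableAt 𝓘(ℝ, E) 𝓘(ℝ, E) (chartAt E x).symm w :=
    mdifferentiableAt_atlas_symm (chart_mem_atlas E x) hw
  have h2 := h.fderiv_eq (𝕜 := ℝ)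
  rw [fderiv_add_const, fderiv_fun_id] at h2
  rw [hm.mfderiv, modelWithCornersSelf_coe, Set.range_id, fderivWithin_univ]
  exact h2

lemma mfderiv_chartAt_self [IsManifold 𝓘(ℝ, E) 1 M] (x : M) :
    mfderiv 𝓘(ℝ, E) 𝓘(ℝ, E) (chartAt E x) x = ContinuousLinearMap.id ℝ E := by
  have hm : MDifferentiableAt 𝓘(ℝ, E) 𝓘(ℝ, E) (chartAt E x) x :=
    mdifferentiableAt_atlas (chart_mem_atlas E x) (mem_chart_source E x)
  have h : ((chartAt E x) ∘ (chartAt E x).symm) =ᶠ[𝓝 (chartAt E x x)] fun w => w := by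
    filter_upwards [(chartAt E x).open_target.mem_nhds (mem_chart_target E x)] with w hw
    exact (chartAt E x).right_inv hw
  have h2 := h.fderiv_eq (𝕜 := ℝ)
  rw [fderiv_fun_id] at h2
  rw [hm.mfderiv, modelWithCornersSelf_coe, Set.range_id, fderivWithin_univ]
  exact h2

lemma mlieBracket_eq [IsManifold 𝓘(ℝ, E) 1 M] (hT : HasTranslationAtlas E M)
    (X Y : ∀ x : M, TangentSpace 𝓘(ℝ, E) x) (x : M) :
    VectorField.mlieBracket 𝓘(ℝ, E) X Y x =
      fderiv ℝ (rep x (fieldFun Y)) (chartAt E x x) (X x) -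
        fderiv ℝ (rep x (fieldFun X)) (chartAt E x x) (Y x) := by
  have hpull : ∀ Z : ∀ x : M, TangentSpace 𝓘(ℝ, E) x,
      VectorField.mpullbackWithin 𝓘(ℝ, E) 𝓘(ℝ, E) (extChartAt 𝓘(ℝ, E) x).symm Z
        (Set.range 𝓘(ℝ, E)) =ᶠ[𝓝 (chartAt E x x)] rep x (fieldFun Z) := by
    intro Z
    filter_upwards [(chartAt E x).open_target.mem_nhds (mem_chart_target E x)] with w hw
    rw [VectorField.mpullbackWithin_apply]
    have h1 : mfderivWithin 𝓘(ℝ, E) 𝓘(ℝ, E) (extChartAt 𝓘(ℝ, E) x).symm (Set.range 𝓘(ℝ, E)) w =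
        ContinuousLinearMap.id ℝ E := by
      rw [modelWithCornersSelf_coe, Set.range_id, mfderivWithin_univ]
      exact mfderiv_chartAt_symm hT x hw
    rw [h1]
    have h2 : (ContinuousLinearMap.id ℝ E).inverse = ContinuousLinearMap.id ℝ E :=
      ContinuousLinearMap.inverse_id
    exact DFunLike.congr_fun h2 _
  rw [← VectorField.mlieBracketWithin_univ, VectorField.mlieBracketWithin_apply]
  have h1 : mfderiv 𝓘(ℝ, E) 𝓘(ℝ, E) (extChartAt 𝓘(ℝ, E) x) x = ContinuousLinearMap.id ℝ E :=
    mfderiv_chartAt_self x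
  rw [h1]
  have h2 : (ContinuousLinearMap.id ℝ E).inverse = ContinuousLinearMap.id ℝ E :=
    ContinuousLinearMap.inverse_id
  refine (DFunLike.congr_fun h2 _).trans ?_
  have hX := hpull X
  have hY := hpull Y
  have key := Filter.EventuallyEq.lieBracket_vectorField (𝕜 := ℝ) hX hY
  have h3 := key.self_of_nhds
  simp only [VectorField.lieBracket, rep_apply_self] at h3
  rw [Set.preimage_univ, Set.univ_inter]
  nth_rw 3 [modelWithCornersSelf_coe]
  rw [Set.range_id]
  exact (congrFun VectorField.lieBracketWithin_univ _).trans h3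

/-! ### The Levi-Civita connection and its curvature -/

/-- Smooth symmetric positive definite forms `G x` together with smooth symmetric Christoffel maps
`Γ x` for which `G` is parallel and the curvature is `c (G(v, w) u - G(u, w) v)`. -/
structure IsSpaceForm (G : M → E →L[ℝ] E →L[ℝ] ℝ) (Γ : M → E →L[ℝ] E →L[ℝ] E) (c : ℝ) : Prop where
  contMDiff_metric : ContMDiff 𝓘(ℝ, E) 𝓘(ℝ, E →L[ℝ] E →L[ℝ] ℝ) ∞ G
  symm : ∀ x u v, G x u v = G x v u
  pos : ∀ x u, u ≠ 0 → 0 < G x u u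
  contMDiff_christoffel : ContMDiff 𝓘(ℝ, E) 𝓘(ℝ, E →L[ℝ] E →L[ℝ] E) ∞ Γ
  christoffel_symm : ∀ x u v, Γ x u v = Γ x v u
  der_metric : ∀ (x : M) (w u v : E),
    der G x w u v =
      G x (Γ x w u) v + G x u (Γ x w v)
  der_christoffel : ∀ (x : M) (u v w : E),
    der Γ x u v w -
      der Γ x v u w +
      Γ x u (Γ x v w) - Γ x v (Γ x u w) = c • (G x v w • u - G x u w • v)

lemma fderiv_clm_apply_apply {G : E → E →L[ℝ] E →L[ℝ] F} {a b : E → E} {x : E}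
    (hG : DifferentiableAt ℝ G x) (ha : DifferentiableAt ℝ a x) (hb : DifferentiableAt ℝ b x)
    (v : E) :
    fderiv ℝ (fun y => G y (a y) (b y)) x v =
      fderiv ℝ G x v (a x) (b x) + G x (fderiv ℝ a x v) (b x) + G x (a x) (fderiv ℝ b x v) := by
  have h := ((hG.hasFDerivAt.clm_apply ha.hasFDerivAt).clm_apply hb.hasFDerivAt).fderiv
  rw [h]
  simp
  abel

variable {G : M → E →L[ℝ] E →L[ℝ] ℝ} {Γ : M → E →L[ℝ] E →L[ℝ] E} {c : ℝ}

lemma der_add {f g : M → F} {x : M} (hf : MDifferentiableAt 𝓘(ℝ, E) 𝓘(ℝ, F) f x)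
    (hg : MDifferentiableAt 𝓘(ℝ, E) 𝓘(ℝ, F) g x) :
    der (E := E) (f + g) x = der f x + der g x :=
  mvfderiv_add hf hg

lemma der_smul {a : M → ℝ} {g : M → F} {x : M} (ha : MDifferentiableAt 𝓘(ℝ, E) 𝓘(ℝ, ℝ) a x)
    (hg : MDifferentiableAt 𝓘(ℝ, E) 𝓘(ℝ, F) g x) :
    der (E := E) (a • g) x = a x • der g x + (der a x).smulRight (g x) :=
  mvfderiv_smul ha hg

lemma mdifferentiableAt_of_diffFieldAt [IsManifold 𝓘(ℝ, E) 1 M] (hT : HasTranslationAtlas E M)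
    {X : ∀ x : M, TangentSpace 𝓘(ℝ, E) x} {x : M} (h : DiffFieldAt 𝓘(ℝ, E) X x) :
    MDifferentiableAt 𝓘(ℝ, E) 𝓘(ℝ, E) (fieldFun X) x :=
  (mdifferentiableAt_iff (mem_chart_source E x)).2
    ((diffFieldAt_iff hT (mem_chart_source E x)).1 h)

/-- The linear map `v ↦ D_v Y + Γ(v, Y)` on the model space. -/
def christoffelDer (Γ : M → E →L[ℝ] E →L[ℝ] E) (Y : M → E) (x : M) : E →L[ℝ] E :=
  der Y x + (Γ x).flip (Y x)

lemma christoffelDer_apply (Y : M → E) (x : M) (v : E) :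
    christoffelDer Γ Y x v = der Y x v + Γ x v (Y x) := rfl

lemma christoffelDer_add [IsManifold 𝓘(ℝ, E) 1 M] {Y Z : M → E} {x : M}
    (hY : MDifferentiableAt 𝓘(ℝ, E) 𝓘(ℝ, E) Y x) (hZ : MDifferentiableAt 𝓘(ℝ, E) 𝓘(ℝ, E) Z x) :
    christoffelDer Γ (Y + Z) x = christoffelDer Γ Y x + christoffelDer Γ Z x := by
  rw [christoffelDer, der_add hY hZ, Pi.add_apply, map_add, add_add_add_comm]
  rfl

lemma christoffelDer_smul [IsManifold 𝓘(ℝ, E) 1 M] {a : M → ℝ} {Y : M → E} {x : M}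
    (ha : MDifferentiableAt 𝓘(ℝ, E) 𝓘(ℝ, ℝ) a x) (hY : MDifferentiableAt 𝓘(ℝ, E) 𝓘(ℝ, E) Y x) :
    christoffelDer Γ (a • Y) x = a x • christoffelDer Γ Y x + (der a x).smulRight (Y x) := by
  rw [christoffelDer, der_smul ha hY, Pi.smul_apply', map_smul, christoffelDer, smul_add,
    add_right_comm]

/-- The covariant derivative `∇_v Y = D_v Y + Γ(v, Y)`. -/
def christoffelCov [IsManifold 𝓘(ℝ, E) 1 M] (hT : HasTranslationAtlas E M)
    (Γ : M → E →L[ℝ] E →L[ℝ] E) :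
    CovariantDerivative 𝓘(ℝ, E) E (TangentSpace 𝓘(ℝ, E) : M → Type _) where
  toFun Y x := christoffelDer (E := E) Γ (fieldFun Y) x
  isCovariantDerivativeOnUniv :=
    { add := fun hY hZ _ => christoffelDer_add (mdifferentiableAt_of_diffFieldAt hT hY)
        (mdifferentiableAt_of_diffFieldAt hT hZ)
      leibniz := fun hY ha _ => christoffelDer_smul ha (mdifferentiableAt_of_diffFieldAt hT hY) }

lemma covDer_christoffelCov [IsManifold 𝓘(ℝ, E) 1 M] (hT : HasTranslationAtlas E M) :
    covDer (christoffelCov hT Γ) = christoffelDer Γ := rfl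

lemma rep_christoffelDer [IsManifold 𝓘(ℝ, E) 1 M] (hT : HasTranslationAtlas E M) (Y : M → E)
    {x : M} {w : E} (hw : w ∈ (chartAt E x).target) :
    rep x (christoffelDer Γ Y) w = fderiv ℝ (rep x Y) w + (rep x Γ w).flip (rep x Y w) := by
  have := der_eq hT ((chartAt E x).map_target hw) Y
  rw [(chartAt E x).right_inv hw] at this
  rw [← this]
  rfl

lemma contMDiff_christoffelCov [IsManifold 𝓘(ℝ, E) ∞ M] (hT : HasTranslationAtlas E M)
    (hΓ : ContMDiff 𝓘(ℝ, E) 𝓘(ℝ, E →L[ℝ] E →L[ℝ] E) ∞ Γ) :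
    (christoffelCov hT Γ).ContMDiffCovariantDerivative ∞ := by
  refine ⟨⟨?_⟩⟩
  intro Y hY
  rw [contMDiffOn_univ] at hY ⊢
  refine contMDiff_endomorphism hT (A := christoffelDer Γ (fieldFun Y)) ?_
  intro x
  have hYx := (contMDiffAt_iff (mem_chart_source E x)).1 ((contMDiffAt_field_iff hT).1 (hY x))
  have hΓx := (contMDiffAt_iff (mem_chart_source E x)).1 (hΓ x)
  rw [contMDiffAt_iff (mem_chart_source E x)]
  have h : ContDiffAt ℝ ∞ (fun w => fderiv ℝ (rep x (fieldFun Y)) w +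
      (rep x Γ w).flip (rep x (fieldFun Y) w)) (chartAt E x x) := by
    refine (hYx.fderiv_right (by simp)).add ?_
    refine ContDiffAt.clm_apply ?_ hYx
    exact (ContinuousLinearMap.flipₗᵢ ℝ E E E).toContinuousLinearEquiv.contDiff.contDiffAt.comp
      _ hΓx
  refine h.congr_of_eventuallyEq ?_
  filter_upwards [(chartAt E x).open_target.mem_nhds (mem_chart_target E x)] with w hw
  exact rep_christoffelDer hT _ hw

lemma mlieBracket_eq_der [IsManifold 𝓘(ℝ, E) 1 M] (hT : HasTranslationAtlas E M)
    (X Y : M → E) (x : M) :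
    VectorField.mlieBracket 𝓘(ℝ, E) (toField X) (toField Y) x =
      der Y x (X x) - der X x (Y x) := by
  rw [mlieBracket_eq hT, der_self, der_self]
  rfl

/-- The defining properties of a Levi-Civita connection in terms of functions with values in the
model space. -/
lemma isLeviCivita_iff [IsManifold 𝓘(ℝ, E) 1 M] (hT : HasTranslationAtlas E M)
    {cov : CovariantDerivative 𝓘(ℝ, E) E (TangentSpace 𝓘(ℝ, E) : M → Type _)} :
    IsLeviCivita (I := 𝓘(ℝ, E)) (M := M) (fun x u v => G x u v) cov ↔
      cov.ContMDiffCovariantDerivative ∞ ∧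
      (∀ (X Y : M → E) (x : M), MDifferentiableAt 𝓘(ℝ, E) 𝓘(ℝ, E) X x →
        MDifferentiableAt 𝓘(ℝ, E) 𝓘(ℝ, E) Y x →
        covDer cov Y x (X x) - covDer cov X x (Y x) = der Y x (X x) - der X x (Y x)) ∧
      (∀ (Y Z : M → E) (x : M) (v : E), MDifferentiableAt 𝓘(ℝ, E) 𝓘(ℝ, E) Y x →
        MDifferentiableAt 𝓘(ℝ, E) 𝓘(ℝ, E) Z x →
        der (fun y => G y (Y y) (Z y)) x v =
          G x (covDer cov Y x v) (Z x) + G x (Y x) (covDer cov Z x v)) := by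
  have hd : ∀ (Y : M → E) (x : M), MDifferentiableAt 𝓘(ℝ, E) 𝓘(ℝ, E) Y x →
      DiffFieldAt 𝓘(ℝ, E) (toField Y) x := fun Y x h =>
    (diffFieldAt_iff hT (mem_chart_source E x)).2
      ((mdifferentiableAt_iff (mem_chart_source E x)).1 h)
  constructor
  · intro h
    refine ⟨h.smooth, fun X Y x hX hY => ?_, fun Y Z x v hY hZ => ?_⟩
    · rw [← mlieBracket_eq_der hT]
      exact h.torsion_free (toField X) (toField Y) x (hd X x hX) (hd Y x hY)
    · exact h.compatible (toField Y) (toField Z) x v (hd Y x hY) (hd Z x hZ)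
  · rintro ⟨h1, h2, h3⟩
    refine ⟨h1, fun X Y x hX hY => ?_, fun Y Z x v hY hZ => ?_⟩
    · exact (h2 (fieldFun X) (fieldFun Y) x (mdifferentiableAt_of_diffFieldAt hT hX)
        (mdifferentiableAt_of_diffFieldAt hT hY)).trans (mlieBracket_eq_der hT _ _ x).symm
    · exact h3 (fieldFun Y) (fieldFun Z) x v (mdifferentiableAt_of_diffFieldAt hT hY)
        (mdifferentiableAt_of_diffFieldAt hT hZ)

lemma IsSpaceForm.isLeviCivita [IsManifold 𝓘(ℝ, E) ∞ M] (hT : HasTranslationAtlas E M)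
    (h : IsSpaceForm G Γ c) :
    IsLeviCivita (I := 𝓘(ℝ, E)) (M := M) (fun x u v => G x u v) (christoffelCov hT Γ) := by
  rw [isLeviCivita_iff hT]
  refine ⟨contMDiff_christoffelCov hT h.contMDiff_christoffel, fun X Y x hX hY => ?_,
    fun Y Z x v hY hZ => ?_⟩
  · rw [covDer_christoffelCov, christoffelDer_apply, christoffelDer_apply,
      h.christoffel_symm x (X x) (Y x)]
    abel
  · have hY' := (mdifferentiableAt_iff (mem_chart_source E x)).1 hY
    have hZ' := (mdifferentiableAt_iff (mem_chart_source E x)).1 hZ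
    have hG := ((contMDiffAt_iff (mem_chart_source E x)).1 (h.contMDiff_metric x)).differentiableAt
      (by simp)
    have h1 := fderiv_clm_apply_apply hG hY' hZ' v
    have h2 := h.der_metric x v (Y x) (Z x)
    rw [der_self] at h2
    simp only [rep_apply_self] at h1
    rw [covDer_christoffelCov, christoffelDer_apply, christoffelDer_apply, der_self, der_self,
      der_self]
    refine h1.trans ?_
    rw [h2]
    simp only [map_add, add_apply]
    abel

/-- A torsion free connection compatible with a weak metric is determined on fields that are
differentiable at the point: the difference of two of them is a trilinear form which is symmetric
in one pair of arguments and skew in another. -/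
lemma leviCivita_unique [IsManifold 𝓘(ℝ, E) 1 M] (hT : HasTranslationAtlas E M)
    (hsymm : ∀ x u v, G x u v = G x v u) (hpos : ∀ x u, u ≠ 0 → 0 < G x u u)
    {cov cov' : CovariantDerivative 𝓘(ℝ, E) E (TangentSpace 𝓘(ℝ, E) : M → Type _)}
    (hc : IsLeviCivita (I := 𝓘(ℝ, E)) (M := M) (fun x u v => G x u v) cov)
    (hc' : IsLeviCivita (I := 𝓘(ℝ, E)) (M := M) (fun x u v => G x u v) cov')
    {Y : M → E} {x : M} (hY : MDifferentiableAt 𝓘(ℝ, E) 𝓘(ℝ, E) Y x) :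
    covDer cov Y x = covDer cov' Y x := by
  rw [isLeviCivita_iff hT] at hc hc'
  have hconst : ∀ u : E, MDifferentiableAt 𝓘(ℝ, E) 𝓘(ℝ, E) (fun _ : M => u) x := fun u =>
    mdifferentiableAt_const
  let S : (M → E) → E →L[ℝ] E := fun Z => covDer cov Z x - covDer cov' Z x
  have hS : ∀ Z v, S Z v = covDer cov Z x v - covDer cov' Z x v := fun Z v => rfl
  have hsym : ∀ u v : E, S (fun _ => u) v = S (fun _ => v) u := by
    intro u v
    have h1 := hc.2.1 (fun _ => v) (fun _ => u) x (hconst v) (hconst u)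
    have h2 := hc'.2.1 (fun _ => v) (fun _ => u) x (hconst v) (hconst u)
    have h3 := h1.trans h2.symm
    rw [hS, hS, sub_eq_sub_iff_sub_eq_sub]
    exact h3
  have hskew : ∀ (Z : M → E), MDifferentiableAt 𝓘(ℝ, E) 𝓘(ℝ, E) Z x → ∀ w v : E,
      G x (S Z v) w + G x (Z x) (S (fun _ => w) v) = 0 := by
    intro Z hZ w v
    have h1 := hc.2.2 Z (fun _ => w) x v hZ (hconst w)
    have h2 := hc'.2.2 Z (fun _ => w) x v hZ (hconst w)
    rw [hS, hS, map_sub, map_sub, sub_apply]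
    linarith
  -- Constant fields span the tangent spaces; on them the difference is symmetric and skew, hence
  -- zero.
  have hS0 : ∀ u v : E, S (fun _ => u) v = 0 := by
    have key : ∀ u v w : E, G x (S (fun _ => u) v) w = 0 := by
      intro u v w
      have sk : ∀ a b v : E, G x (S (fun _ => a) v) b = - G x (S (fun _ => b) v) a := by
        intro a b v
        have := hskew (fun _ => a) (hconst a) b v
        rw [hsymm x (S (fun _ => b) v) a]
        linarith
      have e1 := sk u w v
      have e2 := sk v u w
      have e3 := sk w v u
      rw [hsym w v] at e1
      rw [hsym u w] at e2
      rw [hsym v u] at e3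
      linarith
    intro u v
    by_contra hne
    exact (hpos x _ hne).ne' (key u v _)
  ext1 v
  have hz : S Y v = 0 := by
    by_contra hne
    have := hskew Y hY (S Y v) v
    rw [hS0, map_zero, add_zero] at this
    exact (hpos x _ hne).ne' this
  exact sub_eq_zero.1 hz

lemma IsSpaceForm.covDer_eq [IsManifold 𝓘(ℝ, E) ∞ M] (hT : HasTranslationAtlas E M)
    (h : IsSpaceForm G Γ c)
    {cov : CovariantDerivative 𝓘(ℝ, E) E (TangentSpace 𝓘(ℝ, E) : M → Type _)}
    (hc : IsLeviCivita (I := 𝓘(ℝ, E)) (M := M) (fun x u v => G x u v) cov)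
    {Y : M → E} {x : M} (hY : MDifferentiableAt 𝓘(ℝ, E) 𝓘(ℝ, E) Y x) :
    covDer cov Y x = christoffelDer Γ Y x :=
  leviCivita_unique hT h.symm h.pos hc (h.isLeviCivita hT) hY

/-- The derivative of `∇_X Y` in the direction `v`, read in a chart. -/
lemma IsSpaceForm.covDer_covDer [IsManifold 𝓘(ℝ, E) ∞ M] (hT : HasTranslationAtlas E M)
    (h : IsSpaceForm G Γ c)
    {cov : CovariantDerivative 𝓘(ℝ, E) E (TangentSpace 𝓘(ℝ, E) : M → Type _)}
    (hc : IsLeviCivita (I := 𝓘(ℝ, E)) (M := M) (fun x u v => G x u v) cov)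
    {X Y : M → E} {x : M} (hX : ContMDiffAt 𝓘(ℝ, E) 𝓘(ℝ, E) ∞ X x)
    (hY : ContMDiffAt 𝓘(ℝ, E) 𝓘(ℝ, E) ∞ Y x) (v : E) :
    covDer cov (fun y => covDer cov Y y (X y)) x v =
      fderiv ℝ (fderiv ℝ (rep x Y)) (chartAt E x x) v (X x) + der Y x (der X x v) +
      (der Γ x v (X x) (Y x) + Γ x (der X x v) (Y x) + Γ x (X x) (der Y x v)) +
      Γ x v (der Y x (X x) + Γ x (X x) (Y x)) := by
  have hX' := (contMDiffAt_iff (mem_chart_source E x)).1 hX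
  have hY' := (contMDiffAt_iff (mem_chart_source E x)).1 hY
  have hΓ' := (contMDiffAt_iff (mem_chart_source E x)).1 (h.contMDiff_christoffel x)
  have hDY : ContDiffAt ℝ ∞ (fderiv ℝ (rep x Y)) (chartAt E x x) := hY'.fderiv_right (by simp)
  have hrep : rep x (fun y => covDer cov Y y (X y)) =ᶠ[𝓝 (chartAt E x x)]
      fun w => fderiv ℝ (rep x Y) w (rep x X w) + rep x Γ w (rep x X w) (rep x Y w) := by
    have hY1 : ContDiffAt ℝ 1 (rep x Y) (chartAt E x x) := hY'.of_le (by norm_cast)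
    filter_upwards [(chartAt E x).open_target.mem_nhds (mem_chart_target E x),
      hY1.eventually (by simp)] with w hw hYw
    have hs := (chartAt E x).map_target hw
    have hYd : MDifferentiableAt 𝓘(ℝ, E) 𝓘(ℝ, E) Y ((chartAt E x).symm w) := by
      rw [mdifferentiableAt_iff hs, (chartAt E x).right_inv hw]
      exact hYw.differentiableAt (by simp)
    have h1 := rep_christoffelDer (Γ := Γ) hT Y hw
    change covDer cov Y ((chartAt E x).symm w) (X ((chartAt E x).symm w)) = _
    rw [h.covDer_eq hT hc hYd]
    exact DFunLike.congr_fun h1 (rep x X w)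
  have d1 := hDY.differentiableAt (by simp)
  have d2 := hX'.differentiableAt (by simp)
  have d3 := hY'.differentiableAt (by simp)
  have d4 := hΓ'.differentiableAt (by simp)
  have hsum := (d1.clm_apply d2).add ((d4.clm_apply d2).clm_apply d3)
  have hdiff : MDifferentiableAt 𝓘(ℝ, E) 𝓘(ℝ, E) (fun y => covDer cov Y y (X y)) x := by
    rw [mdifferentiableAt_iff (mem_chart_source E x)]
    exact hsum.congr_of_eventuallyEq hrep
  have hval : covDer cov Y x (X x) = der Y x (X x) + Γ x (X x) (Y x) := by
    rw [h.covDer_eq hT hc (hY.mdifferentiableAt (by simp))]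
    rfl
  rw [h.covDer_eq hT hc hdiff, christoffelDer_apply, hval]
  congr 1
  rw [der_self, hrep.fderiv_eq, fderiv_fun_add (d1.clm_apply d2) ((d4.clm_apply d2).clm_apply d3)]
  rw [add_apply, fderiv_clm_apply_apply d4 d2 d3, fderiv_clm_apply d1 d2]
  simp only [rep_apply_self, der_self, add_apply,
    ContinuousLinearMap.comp_apply, ContinuousLinearMap.flip_apply]
  abel

lemma IsSpaceForm.curvature_eq [IsManifold 𝓘(ℝ, E) ∞ M] (hT : HasTranslationAtlas E M)
    (h : IsSpaceForm G Γ c)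
    {cov : CovariantDerivative 𝓘(ℝ, E) E (TangentSpace 𝓘(ℝ, E) : M → Type _)}
    (hc : IsLeviCivita (I := 𝓘(ℝ, E)) (M := M) (fun x u v => G x u v) cov)
    {X Y Z : M → E} {x : M} (hX : ContMDiffAt 𝓘(ℝ, E) 𝓘(ℝ, E) ∞ X x)
    (hY : ContMDiffAt 𝓘(ℝ, E) 𝓘(ℝ, E) ∞ Y x) (hZ : ContMDiffAt 𝓘(ℝ, E) 𝓘(ℝ, E) ∞ Z x) :
    curvature cov (toField X) (toField Y) (toField Z) x =
      c • (G x (Y x) (Z x) • X x - G x (X x) (Z x) • Y x) := by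
  have hZ' := (contMDiffAt_iff (mem_chart_source E x)).1 hZ
  have hsymm : fderiv ℝ (fderiv ℝ (rep x Z)) (chartAt E x x) (X x) (Y x) =
      fderiv ℝ (fderiv ℝ (rep x Z)) (chartAt E x x) (Y x) (X x) :=
    (hZ'.isSymmSndFDerivAt (by
      rw [minSmoothness_of_isRCLikeNormedField]
      exact WithTop.coe_le_coe.2 (le_top (a := (2 : ℕ∞))))) _ _
  have e : curvature cov (toField X) (toField Y) (toField Z) x =
      covDer cov (fun y => covDer cov Z y (Y y)) x (X x) -
        covDer cov (fun y => covDer cov Z y (X y)) x (Y x) -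
        covDer cov Z x (der Y x (X x) - der X x (Y x)) := by
    rw [← mlieBracket_eq_der hT]
    rfl
  rw [e, h.covDer_covDer hT hc hY hZ, h.covDer_covDer hT hc hX hZ,
    h.covDer_eq hT hc (hZ.mdifferentiableAt (by simp)), christoffelDer_apply, hsymm,
    ← h.der_christoffel]
  simp only [map_add, map_sub, sub_apply]
  abel

/-- The Gram determinant: the strict Cauchy-Schwarz inequality. -/
lemma gram_pos {g : E →L[ℝ] E →L[ℝ] ℝ} (hsymm : ∀ u v, g u v = g v u)
    (hpos : ∀ u, u ≠ 0 → 0 < g u u) {u v : E} (hli : LinearIndependent ℝ ![u, v]) :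
    0 < g u u * g v v - g u v ^ 2 := by
  have hv : v ≠ 0 := hli.ne_zero 1
  have hvv := hpos v hv
  have hne : g v v • u - g u v • v ≠ 0 := by
    intro h0
    have := LinearIndependent.pair_iff.1 hli (g v v) (-(g u v))
      (by rw [neg_smul, ← sub_eq_add_neg, h0])
    exact hvv.ne' this.1
  have h1 := hpos _ hne
  simp only [map_sub, map_smul, sub_apply, smul_apply,
    smul_eq_mul, hsymm v u] at h1
  have h2 : 0 < g v v * (g u u * g v v - g u v ^ 2) := by nlinarith
  exact (pos_iff_pos_of_mul_pos h2).1 hvv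

theorem IsSpaceForm.hasConstantSectionalCurvature [IsManifold 𝓘(ℝ, E) ∞ M]
    (hT : HasTranslationAtlas E M) (h : IsSpaceForm G Γ c) :
    HasConstantSectionalCurvature 𝓘(ℝ, E) (M := M) (fun x u v => G x u v) c where
  isWeakRiemannianMetric :=
    { symm := h.symm
      pos := h.pos
      smooth := ⟨G, fun _ _ _ => rfl, contMDiff_bilinear hT h.contMDiff_metric⟩ }
  exists_leviCivita := ⟨_, h.isLeviCivita hT⟩
  sectionalCurvature_eq cov hc x X Y hX hY hli := by
    have hX' := (contMDiffAt_field_iff hT).1 hX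
    have hY' := (contMDiffAt_field_iff hT).1 hY
    have h1 := h.curvature_eq hT hc hX' hY' hY'
    have hli' : LinearIndependent ℝ ![fieldFun X x, fieldFun Y x] := hli
    have h2 := gram_pos (h.symm x) (h.pos x) hli'
    have e : sectionalCurvature (I := 𝓘(ℝ, E)) (M := M) (fun x u v => G x u v) cov X Y x =
        G x (c • (G x (fieldFun Y x) (fieldFun Y x) • fieldFun X x -
          G x (fieldFun X x) (fieldFun Y x) • fieldFun Y x)) (fieldFun X x) /
        (G x (fieldFun X x) (fieldFun X x) * G x (fieldFun Y x) (fieldFun Y x) -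
          G x (fieldFun X x) (fieldFun Y x) ^ 2) := by
      rw [← h1]
      rfl
    rw [e, div_eq_iff h2.ne']
    simp only [map_sub, map_smul, sub_apply, smul_apply,
      smul_eq_mul, h.symm x (fieldFun Y x) (fieldFun X x)]
    ring

end TranslationAtlas

namespace TwoHS

open Sob TranslationAtlas

/-! ### Manifolds with the geometry of constant curvature -/

namespace TangentData

variable {ι X A : Type*} [NormedAddCommGroup X] [NormedSpace ℝ X]
    [NormedAddCommGroup A] [NormedSpace ℝ A] (S : TangentData ι X A)

lemma metricMap_congr {v w : X} (h : S.jac v = S.jac w) : S.metricMap v = S.metricMap w := by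
  rw [metricMap, metricMap, jacPair, jacPair, invJac, invJac, h]

lemma chrisMap_congr {v w : X} (h : S.jac v = S.jac w) : S.chrisMap v = S.chrisMap w := by
  rw [chrisMap, chrisMap, S.metricMap_congr h, jacPair, jacPair, invJac, invJac, h]

/-- If the Jacobian of the points of a manifold modelled on `X`, given by the map `coord`, is also
the one computed from their coordinates in the charts, then the metric and the Christoffel map are
well defined on the manifold and have constant curvature one. -/
lemma isSpaceForm {M : Type*} [TopologicalSpace M] [ChartedSpace X M] [IsManifold 𝓘(ℝ, X) ∞ M]
    (coord : M → X) (hpos : ∀ x, S.Positive (coord x))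
    (hcoord : ∀ x : M, ∀ᶠ w in 𝓝 (chartAt X x x), S.jac (coord ((chartAt X x).symm w)) = S.jac w) :
    IsSpaceForm (fun x => S.metricMap (coord x)) (fun x => S.chrisMap (coord x)) 1 := by
  have : IsManifold 𝓘(ℝ, X) 1 M := IsManifold.of_le (n := ∞) (by simp)
  have hjac : ∀ x : M, S.jac (coord x) = S.jac (chartAt X x x) := fun x => by
    have h := (hcoord x).self_of_nhds
    rwa [(chartAt X x).left_inv (mem_chart_source X x)] at h
  have hpos' : ∀ x : M, S.Positive (chartAt X x x) := fun x i => by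
    rw [← hjac]
    exact hpos x i
  have hG : ∀ x : M, rep x (fun x => S.metricMap (coord x)) =ᶠ[𝓝 (chartAt X x x)] S.metricMap :=
    fun x => (hcoord x).mono fun w hw => S.metricMap_congr hw
  have hΓ : ∀ x : M, rep x (fun x => S.chrisMap (coord x)) =ᶠ[𝓝 (chartAt X x x)] S.chrisMap :=
    fun x => (hcoord x).mono fun w hw => S.chrisMap_congr hw
  have hdG : ∀ x : M, der (fun x => S.metricMap (coord x)) x =
      fderiv ℝ S.metricMap (chartAt X x x) := fun x => by
    rw [der_self, (hG x).fderiv_eq]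
  have hdΓ : ∀ x : M, der (fun x => S.chrisMap (coord x)) x =
      fderiv ℝ S.chrisMap (chartAt X x x) := fun x => by
    rw [der_self, (hΓ x).fderiv_eq]
  refine ⟨fun x => ?_, fun x u v => S.metricMap_symm _ u v,
    fun x u hu => S.metricMap_pos (hpos x) hu,
    fun x => ?_, fun x u v => S.chrisMap_symm _ u v, fun x w u v => ?_, fun x u v w => ?_⟩
  · rw [contMDiffAt_iff (mem_chart_source X x)]
    exact (S.contDiffAt_metricMap (hpos' x)).congr_of_eventuallyEq (hG x)
  · rw [contMDiffAt_iff (mem_chart_source X x)]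
    exact (S.contDiffAt_chrisMap (hpos' x)).congr_of_eventuallyEq (hΓ x)
  · rw [hdG, S.metricMap_congr (hjac x), S.chrisMap_congr (hjac x)]
    exact S.fderiv_metricMap_eq (hpos' x) w u v
  · rw [hdΓ, S.metricMap_congr (hjac x), S.chrisMap_congr (hjac x)]
    exact S.curvature_chrisMap (hpos' x) u v w

end TangentData

/-! ### The geometry of the group of circle diffeomorphisms -/

instance fact_half_lt {s : ℝ} [hs : Fact (5 / 2 < s)] : Fact (1 / 2 < s - 1) :=
  ⟨by linarith [hs.out]⟩

lemma half_lt (s : ℝ) [hs : Fact (5 / 2 < s)] : 1 / 2 < s - 1 := by linarith [hs.out]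

lemma three_halves_lt (s : ℝ) [hs : Fact (5 / 2 < s)] : 3 / 2 < s := by linarith [hs.out]

namespace Sob

/-- The constant function one. -/
def one (r : ℝ) [Fact (1 / 2 < r)] : Sob r := CSob.re 1

lemma one_apply {r : ℝ} [Fact (1 / 2 < r)] (x : S1) : one r x = 1 := by
  rw [one, CSob.re_apply, map_one]
  rfl

/-- The evaluation at a point. -/
def eval {r : ℝ} (x : S1) : Sob r →ₗ[ℝ] ℝ where
  toFun u := u x
  map_add' _ _ := rfl
  map_smul' _ _ := rfl

lemma mean_pos {r : ℝ} (hr : 1 / 2 < r) {a : Sob r} (h : ∀ x, 0 ≤ a x) (ha : a ≠ 0) :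
    0 < mean hr a := by
  rw [mean_apply]
  refine intervalIntegral.integral_pos zero_lt_one (continuous_coe_comp (toC a)).continuousOn
    (fun t _ => h t) ?_
  by_contra! h0
  refine ha (ext_real fun t => ?_)
  obtain ⟨y, hy, hty⟩ := (periodic_coe_comp (toC a)).exists_mem_Ico₀ one_pos t
  have h1 := le_antisymm (h0 y ⟨hy.1, hy.2.le⟩) (h y)
  exact hty.trans h1

end Sob

variable (s : ℝ) [hs : Fact (5 / 2 < s)]

/-- The derivative of the first component of a tangent vector of `G^s`. -/
def velDeriv : Model s →L[ℝ] Sob (s - 1) :=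
  (diff (three_halves_lt s)).comp ((Sob0 s).subtypeL.comp
    (ContinuousLinearMap.fst ℝ (Sob0 s) (Sob (s - 1))))

variable {s} in
lemma one_add_velDeriv_pos_iff (v : Model s) :
    (∀ x, 0 < Sob.eval x (Sob.one (s - 1) + velDeriv s v)) ↔ IsDisplacement v.1 := by
  have h : ∀ t : ℝ, Sob.eval (t : S1) (Sob.one (s - 1) + velDeriv s v) =
      deriv (fun y : ℝ => y + v.1.1 (y : S1)) t := fun t => by
    have h1 : HasDerivAt (fun y : ℝ => y + v.1.1 (y : S1)) _ t :=
      (hasDerivAt_id' t).add (hasDerivAt_diff (three_halves_lt s) v.1.1 t)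
    rw [h1.deriv, map_add]
    exact congrArg (· + _) (Sob.one_apply (r := s - 1) (t : S1))
  constructor
  · intro hv t
    rw [← h]
    exact hv _
  · intro hv x
    induction x using QuotientAddGroup.induction_on with
    | H t => exact (hv t).trans_eq (h t).symm

/-- The operations on the tangent vectors of `G^s`. -/
def tangentData : TangentData S1 (Model s) (Sob (s - 1)) where
  ev := Sob.eval
  ext := ext_apply
  mul := Sob.mul
  ev_mul x a b := mul_apply a b x
  one := Sob.one (s - 1)
  ev_one x := Sob.one_apply (r := s - 1) x
  inv := Sob.inv
  ev_inv h x := inv_apply (fun x => (h x).ne') x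
  contDiffAt_inv h := contDiffAt_inv fun x => (h x).ne'
  mean := mean (half_lt s)
  mean_one := by
    rw [mean_apply]
    simp only [Sob.one_apply]
    simp
  mean_pos := Sob.mean_pos (half_lt s)
  velDeriv := velDeriv s
  angVel := ContinuousLinearMap.snd ℝ (Sob0 s) (Sob (s - 1))
  mean_velDeriv U := mean_diff (three_halves_lt s) U.1.1
  vec_ext h1 h2 := Prod.ext
    (sob0_ext (three_halves_lt s) fun t => congrArg (fun a : Sob (s - 1) => a (t : S1)) h1) h2
  primInl := (ContinuousLinearMap.inl ℝ (Sob0 s) (Sob (s - 1))).comp (prim (three_halves_lt s))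
  angInr := ContinuousLinearMap.inr ℝ (Sob0 s) (Sob (s - 1))
  velDeriv_primInl {a} ha := by
    refine ext_real fun t => (diff_prim (three_halves_lt s) a t).trans ?_
    rw [ha, sub_zero]
  angVel_primInl _ := rfl
  velDeriv_angInr _ := map_zero (diff (three_halves_lt s))
  angVel_angInr _ := rfl
  isOpen_pos := by
    simp only [one_add_velDeriv_pos_iff]
    exact (isOpen_displacement (three_halves_lt s)).preimage continuous_fst

namespace GSpace

variable {s}

/-- The coordinates of a point, with the angle, on which the geometry does not depend, replaced by
zero. -/
def coord (p : GSpace s) : Model s := (p.disp, 0)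

lemma hasTranslationAtlas : HasTranslationAtlas (Model s) (GSpace s) := by
  intro x y z hx hy
  have hv : chart x z ∈ ((chart x).symm.trans (chart y)).source :=
    ⟨(chart x).map_source hx, by
      change (chart x).symm (chart x z) ∈ (chart y).source
      rw [(chart x).left_inv hx]
      exact hy⟩
  obtain ⟨d, N, hN, -, heq⟩ := chart_trans_local hs.out x y hv
  exact ⟨d, Filter.mem_of_superset hN heq⟩

lemma eventually_jac_coord (p : GSpace s) : ∀ᶠ w in 𝓝 (chartAt (Model s) p p),
    (tangentData s).jac (coord ((chartAt (Model s) p).symm w)) = (tangentData s).jac w := by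
  filter_upwards [(chartAt (Model s) p).open_target.mem_nhds (mem_chart_target _ p)] with w hw
  have h := congrArg Prod.fst ((chartAt (Model s) p).right_inv hw)
  have h2 : ((chartAt (Model s) p).symm w).disp = w.1 := h
  change Sob.one (s - 1) + diff (three_halves_lt s) ((chartAt (Model s) p).symm w).disp.1 = _
  rw [h2]
  rfl

lemma positive_coord (p : GSpace s) : (tangentData s).Positive p.coord :=
  (one_add_velDeriv_pos_iff p.coord).2 p.disp_pos

lemma isSpaceForm : IsSpaceForm (fun p : GSpace s => (tangentData s).metricMap p.coord)
    (fun p => (tangentData s).chrisMap p.coord) 1 :=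
  (tangentData s).isSpaceForm coord positive_coord eventually_jac_coord

/-- The right-invariant metric after the substitution `x = φ(t)`. -/
lemma metric_eq (p : GSpace s) (U V : Model s) :
    metric s p U V = (tangentData s).metricMap p.coord U V := by
  set J : C(S1, ℝ) := toC ((tangentData s).jac p.coord) with hJ
  have hJpos : ∀ x, 0 < J x := positive_coord p
  have hφ : ∀ t : ℝ, HasDerivAt p.phi (J (t : S1)) t := fun t => by
    have h1 : HasDerivAt p.phi _ t :=
      (hasDerivAt_id' t).add (hasDerivAt_diff (three_halves_lt s) p.disp.1 t)
    have h2 : J (t : S1) = 1 + diff (three_halves_lt s) p.disp.1 (t : S1) :=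
      congrArg (· + _) (Sob.one_apply (r := s - 1) (t : S1))
    rwa [h2]
  -- The derivative of `φ⁻¹`.
  have hψ : ∀ x : ℝ, HasDerivAt p.phi.symm (J (p.phi.symm x : S1))⁻¹ x := fun x =>
    HasDerivAt.of_local_left_inverse p.phi.symm.continuous.continuousAt (hφ _) (hJpos _).ne'
      (Filter.Eventually.of_forall p.phi.apply_symm_apply)
  have hd : ∀ (W : Model s) (x : ℝ), deriv (fun x => W.1.1 (p.phi.symm x : S1)) x =
      velDeriv s W (p.phi.symm x : S1) * (J (p.phi.symm x : S1))⁻¹ := fun W x =>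
    (HasDerivAt.comp x (hasDerivAt_diff (three_halves_lt s) W.1.1 (p.phi.symm x)) (hψ x)).deriv
  -- The integrand of the metric as a function of `t = φ⁻¹(x)`.
  set E : ℝ → ℝ := fun t => velDeriv s U (t : S1) * (J (t : S1))⁻¹ *
    (velDeriv s V (t : S1) * (J (t : S1))⁻¹) + U.2 (t : S1) * V.2 (t : S1) with hE
  have hEc : Continuous E := by
    have h1 := continuous_coe_comp (toC (velDeriv s U))
    have h2 := continuous_coe_comp (toC (velDeriv s V))
    have h3 := continuous_coe_comp (toC U.2)
    have h4 := continuous_coe_comp (toC V.2)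
    have h5 := (continuous_coe_comp J).inv₀ fun t => (hJpos t).ne'
    exact ((h1.mul h5).mul (h2.mul h5)).add (h3.mul h4)
  have h0 : p.phi 0 = 0 := by
    have h1 : p.disp.1 ((0 : ℝ) : S1) = 0 := p.disp.2
    rw [phi_apply, h1, zero_add]
  have h1 : p.phi 1 = 1 := by
    have h1 : p.disp.1 ((1 : ℝ) : S1) = 0 := by
      rw [AddCircle.coe_period]
      exact p.disp.2
    rw [phi_apply, h1, add_zero]
  have hsub := intervalIntegral.integral_comp_mul_deriv (a := 0) (b := 1) (g := E ∘ p.phi.symm)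
    (fun t _ => hφ t) (continuous_coe_comp J).continuousOn (hEc.comp p.phi.symm.continuous)
  rw [h0, h1] at hsub
  have hm : (tangentData s).metricMap p.coord U V = 1 / 4 * ∫ t in (0 : ℝ)..1,
      (Sob.mul ((tangentData s).invJac p.coord) (Sob.mul (velDeriv s U) (velDeriv s V)) +
        Sob.mul ((tangentData s).jac p.coord) (Sob.mul U.2 V.2) : Sob (s - 1)) (t : S1) := rfl
  rw [hm]
  have hl : metric s p U V = 1 / 4 * ∫ x in (0 : ℝ)..1, (E ∘ p.phi.symm) x := by
    simp only [metric, innerId, hd]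
    rfl
  rw [hl, ← hsub]
  congr 1
  refine intervalIntegral.integral_congr fun t _ => ?_
  have h2 : (tangentData s).invJac p.coord (t : S1) = (J (t : S1))⁻¹ :=
    (tangentData s).invJac_coe (positive_coord p) _
  have h3 := (hJpos t).ne'
  simp only [Function.comp_apply, OrderIso.symm_apply_apply, map_add, ContinuousMap.add_apply,
    mul_apply, h2, hE]
  rw [← hJ]
  field_simp

end GSpace

end TwoHS

end

theorem corollary3p2 (s : ℝ) [Fact (5 / 2 < s)] :
    WeakRiemannian.HasConstantSectionalCurvature 𝓘(ℝ, TwoHS.Model s)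
      (TwoHS.GSpace.metric s) 1 := by
  have h := TwoHS.GSpace.isSpaceForm.hasConstantSectionalCurvature
    (TwoHS.GSpace.hasTranslationAtlas (s := s))
  have e : TwoHS.GSpace.metric s =
      fun p U V => (TwoHS.tangentData s).metricMap (TwoHS.GSpace.coord p) U V := by
    funext p U V
    exact TwoHS.GSpace.metric_eq p U V
  rw [e]
  exact h
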